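/- Let $d\ge 1$ and let $\Omega$ be the flat unit torus $\mathbb T^d=(\mathbb R/\mathbb Z)^d$, or $\mathbb R^d$, or a bounded open subset of $\mathbb R^d$ with smooth boundary. If $d\ge 2$, let $P_\varepsilon$ $(\varepsilon>0)$ be the heat semigroup (generator $\Delta$) on $\Omega^2$, with Neumann boundary conditions if $\Omega$ has a boundary; if $d=1$, let $P_\varepsilon$ be instead the corresponding $1/2$-fractional heat semigroup $e^{-\varepsilon(-\Delta)^{1/2}}$ on $\Omega^2$. Let $V:\Omega\to\mathbb R$ be measurable and let $W:\Omega\times\Omega\to\mathbb R$ satisfy: (A) $W$ is symmetric, lower semicontinuous and in $L^1_{\rm loc}(\Omega^2)$; for all $\varepsilon>0$ and all $(x,y)\in\Omega^2$ the integral defining $(P_\varepsilon W)(x,y)$ converges absolutely; and $\int_{\Omega^2}P_\varepsilon W\,d\eta\,d\eta\ge 0$ for every $\varepsilon>0$ and every finite signed measure $\eta$ on $\Omega$ with $\eta(\Omega)=0$ for which this integral converges absolutely. (B1) There is $C_0<\infty$ with $|(P_\varepsilon W)(x,x)|\le C_0(|\ln\varepsilon|+1)$ for all $x\in\Omega$,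 $\varepsilon\in(0,1)$. (B2) For every probability measure $\rho$ on $\Omega$ with essentially bounded Lebesgue density and every $p\in[1,\infty)$ there are $\kappa>0$ and $C<\infty$, where $C$ depends only on $p$ and $\|d\rho/dx\|_{L^\infty(\Omega)}$, such that $\sup_{x\in\Omega}\|(P_\varepsilon W-W)(x,\cdot)\|_{L^p(\Omega;\rho)}^p\le C\varepsilon^{\kappa}$ for all $\varepsilon>0$. (B3) There are $\alpha,\varepsilon_0>0$ and $K<\infty$ with $W(x,y)-(P_\varepsilon W)(x,y)\ge -K\varepsilon^{\alpha}$ for all $x\ne y$ in $\Omega$ and $\varepsilon\in(0,\varepsilon_0)$. Let $\mathcal P_2(\Omega)$ be the set of Borel probability measures on $\Omega$ with finite second moment. For $\rho\in\mathcal P_2(\Omega)$ let $$E[\rho]=\int_\Omega \frac{d\rho}{dx}\log\frac{d\rho}{dx}\,dx+\int_\Omega V\,d\rho+\frac12\int_{\Omega^2}W\,d\rho\,d\rho$$ if $\rho\ll dx$ and the three integrals converge absolutely, and $E[\rho]=+\infty$ otherwise. Assume that $E$ has a unique minimiser $\bar\mu$ over $\mathcal P_2(\Omega)$, that $E[\bar\mu]<\infty$,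 and that $\bar\mu$ has an essentially bounded Lebesgue density. For $N\ge 1$ and $x\in\Omega^N$ put $$H_N(x)=\frac1{2N}\sum_{i\ne j}W(x_i,x_j)+\sum_{i=1}^N V(x_i),\qquad \tilde Z_N=\int_{\Omega^N}e^{-H_N}\,dx,\qquad M_N(dx)=\tilde Z_N^{-1}e^{-H_N(x)}\,dx,$$ $$\mathring I_W[\eta]=\frac12\int_{\{(y,z)\in\Omega^2:\,y\ne z\}}W(y,z)\,d\eta(y)\,d\eta(z),\qquad \eta^N_x=N^{-1/2}\Big(\sum_{i=1}^N\delta_{x_i}-N\bar\mu\Big),\qquad Z_N=\int_{\Omega^N}e^{-\mathring I_W[\eta^N_x]}\,d\bar\mu^{\otimes N}(x).$$ Then, for every $N\ge 1$, $M_N$ is a well-defined probability measure and $$Z_N=e^{N E[\bar\mu]}\tilde Z_N,\qquad M_N(dx)=Z_N^{-1}e^{-\mathring I_W[\eta^N_x]}\,\bar\mu^{\otimes N}(dx).$$ Moreover $$\sup_{N\ge 1}Z_N<\infty ,$$ and there is a constant $C<\infty$, independent of $N$, such that for every $N\ge 1$ $$\overline{\mathcal H}[M_N|\bar\mu^{\otimes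 N}]\le\frac CN,\qquad \overline{\mathcal H}[\bar\mu^{\otimes N}|M_N]\le\frac CN ,$$ where $\overline{\mathcal H}[P|Q]=\frac1N\int_{\Omega^N}\log\frac{dP}{dQ}\,dP$ ($+\infty$ if $P\not\ll Q$) is the averaged relative entropy. Finally, let $d_2$ be the quadratic Wasserstein distance, on $\Omega^N$ with respect to the distance $(\sum_i \mathrm{dist}(x_i,y_i)^2)^{1/2}$. If $\bar\mu$ satisfies a Talagrand inequality, i.e. there is $\Lambda<\infty$ with $d_2^2(\nu,\bar\mu)\le \Lambda\int_\Omega\log\frac{d\nu}{d\bar\mu}\,d\nu$ for all $\nu\in\mathcal P_2(\Omega)$ (the right side being $+\infty$ if $\nu\not\ll\bar\mu$), then there is $C<\infty$ such that for every $N\ge1$ $$\frac1N d_2^2(M_N,\bar\mu^{\otimes N})\le\frac CN .$$ -/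

import Mathlib

open MeasureTheory Set Filter Topology InformationTheory
open scoped ENNReal NNReal

noncomputable section

namespace MeanField

/-! ### Domains: the flat torus, the whole space, bounded smooth open sets -/

/-- `d`-dimensional Euclidean space. -/
abbrev Euc (d : ℕ) : Type := EuclideanSpace ℝ (Fin d)

/-- The flat unit torus `𝕋^d = (ℝ/ℤ)^d` with its Euclidean (`ℓ²`) product distance. -/
abbrev Torus (d : ℕ) : Type := PiLp 2 (fun _ : Fin d => UnitAddCircle)

/-- `U` has smooth boundary: near every boundary point, `U` is a strict sublevel set
of a smooth function with nonvanishing differential there. -/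
def HasSmoothBoundary {d : ℕ} (U : Set (Euc d)) : Prop :=
  ∀ z ∈ frontier U, ∃ O : Set (Euc d), IsOpen O ∧ z ∈ O ∧
    ∃ ψ : Euc d → ℝ, ContDiff ℝ ((⊤ : ℕ∞) : WithTop ℕ∞) ψ ∧ fderiv ℝ ψ z ≠ 0 ∧
      U ∩ O = {x ∈ O | ψ x < 0}

/-- The admissible spatial domains `Ω` in dimension `d`. -/
inductive Domain (d : ℕ) : Type
  | torus : Domain d
  | space : Domain d
  | bounded (U : Set (Euc d)) (isOpen : IsOpen U) (isBounded : Bornology.IsBounded U)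
      (smooth : HasSmoothBoundary U) : Domain d

namespace Domain

variable {d : ℕ}

/-- The set of points of the domain, as a type. -/
def Carrier : Domain d → Type
  | torus => Torus d
  | space => Euc d
  | bounded U _ _ _ => ↥U

instance instMetricSpaceCarrier : (D : Domain d) → MetricSpace D.Carrier
  | torus => inferInstanceAs (MetricSpace (Torus d))
  | space => inferInstanceAs (MetricSpace (Euc d))
  | bounded U _ _ _ => inferInstanceAs (MetricSpace ↥U)

instance instMeasurableSpaceCarrier : (D : Domain d) → MeasurableSpace D.Carrier
  | torus => inferInstanceAs (MeasurableSpace (Torus d))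
  | space => inferInstanceAs (MeasurableSpace (Euc d))
  | bounded U _ _ _ => inferInstanceAs (MeasurableSpace ↥U)

instance instBorelSpaceCarrier (D : Domain d) : BorelSpace D.Carrier := by
  cases D with
  | torus => exact inferInstanceAs (BorelSpace (Torus d))
  | space => exact inferInstanceAs (BorelSpace (Euc d))
  | bounded U _ _ _ => exact inferInstanceAs (BorelSpace ↥U)

/-- Lebesgue measure (of total mass one on the torus). -/
def lebesgue : (D : Domain d) → Measure D.Carrier
  | torus => (volume : Measure (Fin d → UnitAddCircle)).map (WithLp.toLp 2)
  | space => (volume : Measure (Euc d))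
  | bounded U _ _ _ => (volume : Measure (Euc d)).comap (Subtype.val : ↥U → Euc d)

instance instMeasureSpaceCarrier (D : Domain d) : MeasureSpace D.Carrier where
  volume := D.lebesgue

end Domain

/-! ### Heat semigroups -/

/-- The heat kernel of `∂ₜ = Δ` on `ℝ^d`. -/
def gaussianHeatKernel {d : ℕ} (t : ℝ) (x y : Euc d) : ℝ :=
  (4 * Real.pi * t) ^ (-(d : ℝ) / 2) * Real.exp (-(‖x - y‖ ^ 2) / (4 * t))

/-- The heat kernel of the unit circle, as a Fourier series. -/
def circleHeatKernel (t : ℝ) (u : UnitAddCircle) : ℝ :=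
  ∑' n : ℤ, Real.exp (-(4 * Real.pi ^ 2 * (n : ℝ) ^ 2 * t)) * (fourier n u).re

/-- The heat kernel of the torus, the product of the kernels of its factors. -/
def torusHeatKernel {d : ℕ} (t : ℝ) (x y : Torus d) : ℝ :=
  ∏ i, circleHeatKernel t (x i - y i)

/-- `p` is the heat kernel of `∂ₜ = Δ` on `U` with Neumann boundary conditions: for every `x ∈ U`,
`p t x` is a probability density on `U` which converges weakly to `δ_x` as `t → 0` and which, away
from `t = 0`, is a weak `L²H¹` solution of the Neumann problem: the test functions do not have
to vanish on the boundary, so the weak form contains the boundary condition.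
Only values at positive times and at points of `U` matter, and there `p` is unique. -/
structure IsNeumannHeatKernel {d : ℕ} (U : Set (Euc d)) (p : ℝ → Euc d → Euc d → ℝ) : Prop where
  continuousOn : ContinuousOn (fun q : ℝ × Euc d × Euc d => p q.1 q.2.1 q.2.2) (Ioi 0 ×ˢ U ×ˢ U)
  nonneg : ∀ t : ℝ, 0 < t → ∀ x ∈ U, ∀ y ∈ U, 0 ≤ p t x y
  mass : ∀ t : ℝ, 0 < t → ∀ x ∈ U, ∫ y in U, p t x y = 1
  contDiffOn : ∀ t : ℝ, 0 < t → ∀ x ∈ U, ContDiffOn ℝ 1 (p t x) U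
  sq_integrable : ∀ x ∈ U, ∀ s t : ℝ, 0 < s → s ≤ t →
    IntegrableOn (fun q : ℝ × Euc d => p q.1 x q.2 ^ 2 + ‖gradient (p q.1 x) q.2‖ ^ 2)
      (Ioc s t ×ˢ U)
  weak_form : ∀ x ∈ U, ∀ s t : ℝ, 0 < s → s ≤ t → ∀ φ : Euc d → ℝ,
    ContDiff ℝ ((⊤ : ℕ∞) : WithTop ℕ∞) φ → HasCompactSupport φ →
      (∫ y in U, p t x y * φ y) - ∫ y in U, p s x y * φ y =
        -∫ r in s..t, ∫ y in U, inner ℝ (gradient (p r x) y) (gradient φ y)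
  initial : ∀ x ∈ U, ∀ φ : Euc d → ℝ,
    ContDiff ℝ ((⊤ : ℕ∞) : WithTop ℕ∞) φ → HasCompactSupport φ →
      Tendsto (fun t => ∫ y in U, p t x y * φ y) (𝓝[>] 0) (𝓝 (φ x))

open Classical in
/-- The Neumann heat kernel of `U`. It exists and is unique for bounded open sets with smooth
boundary; the value `0` in the absence of a kernel is never used for those. -/
def neumannHeatKernel {d : ℕ} (U : Set (Euc d)) : ℝ → Euc d → Euc d → ℝ :=
  if h : ∃ p, IsNeumannHeatKernel U p then h.choose else 0

/-- The heat kernel of `Ω` (with Neumann boundary conditions if `Ω` has a boundary). -/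
def Domain.heatKernel {d : ℕ} : (D : Domain d) → ℝ → D.Carrier → D.Carrier → ℝ
  | .torus => fun t x y => torusHeatKernel (d := d) t x y
  | .space => fun t x y => gaussianHeatKernel (d := d) t x y
  | .bounded U _ _ _ => fun t (x : ↥U) (y : ↥U) => neumannHeatKernel U t x y

/-- The heat kernel of the product `Ω²`. -/
def Domain.heatKernelSq {d : ℕ} (D : Domain d) (t : ℝ) (z z' : D.Carrier × D.Carrier) : ℝ :=
  D.heatKernel t z.1 z'.1 * D.heatKernel t z.2 z'.2

/-- The density in `s` of the `1/2`-stable subordinator at time `t`, which has the Laplace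
transform `∫₀^∞ e^{-λ s} (density) ds = e^{-t √λ}`. -/
def halfStableDensity (t s : ℝ) : ℝ :=
  t / (2 * √Real.pi) * s ^ (-(3 / 2 : ℝ)) * Real.exp (-(t ^ 2) / (4 * s))

/-- The kernel of the `1/2`-fractional heat semigroup `e^{-t (-Δ)^{1/2}}` on `Ω²`, by
subordination of the heat semigroup on `Ω²`. -/
def Domain.halfHeatKernelSq {d : ℕ} (D : Domain d) (t : ℝ) (z z' : D.Carrier × D.Carrier) : ℝ :=
  ∫ s in Ioi 0, halfStableDensity t s * D.heatKernelSq s z z'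

/-- The kernel on `Ω²` used for the regularisation: the heat kernel if `d ≥ 2`, the
`1/2`-fractional heat kernel if `d = 1`. -/
def Domain.regKernel {d : ℕ} (D : Domain d) (ε : ℝ) (z z' : D.Carrier × D.Carrier) : ℝ :=
  if d = 1 then D.halfHeatKernelSq ε z z' else D.heatKernelSq ε z z'

/-- The regularised potential `(P_ε W)(x, y)`. -/
def Domain.regularise {d : ℕ} (D : Domain d) (ε : ℝ) (W : D.Carrier → D.Carrier → ℝ)
    (x y : D.Carrier) : ℝ :=
  ∫ z : D.Carrier × D.Carrier, D.regKernel ε (x, y) z * W z.1 z.2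

/-! ### Quadratic forms and assumptions on the interaction potential -/

section Generic

variable {X : Type*} [MetricSpace X] [MeasureSpace X]

/-- `∫∫ F(x, y) dη(x) dη(y)` for the signed measure `η = μ - ν`. -/
def quadForm (F : X → X → ℝ) (μ ν : Measure X) : ℝ :=
  (∫ z, F z.1 z.2 ∂(μ.prod μ)) - (∫ z, F z.1 z.2 ∂(μ.prod ν))
    - (∫ z, F z.1 z.2 ∂(ν.prod μ)) + ∫ z, F z.1 z.2 ∂(ν.prod ν)

/-- The `L^∞` norm of the Lebesgue density of `ρ`. -/
def densityNorm (ρ : Measure X) : ℝ≥0∞ := essSup (ρ.rnDeriv volume) volume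

/-- `ρ` has an essentially bounded density with respect to Lebesgue measure. -/
def HasBoundedDensity (ρ : Measure X) : Prop := ρ ≪ volume ∧ densityNorm ρ < ∞

end Generic

/-- Basic assumptions on the interaction potential: symmetry, local integrability, lower
semicontinuity, well-definedness of `P_ε W`, and repulsiveness (H-stability). A finite signed
measure `η` with `η(Ω) = 0` is written as `μ - ν` with finite measures of equal mass. -/
structure IsRepulsive {d : ℕ} (D : Domain d) (W : D.Carrier → D.Carrier → ℝ) : Prop where
  symm : ∀ x y, W x y = W y x
  locallyIntegrable : LocallyIntegrable (fun z : D.Carrier × D.Carrier => W z.1 z.2)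
  lowerSemicontinuous : LowerSemicontinuous (fun z : D.Carrier × D.Carrier => W z.1 z.2)
  wellDefined : ∀ ε : ℝ, 0 < ε → ∀ x y : D.Carrier,
    Integrable (fun z : D.Carrier × D.Carrier => D.regKernel ε (x, y) z * W z.1 z.2)
  hStable : ∀ ε : ℝ, 0 < ε → ∀ μ ν : Measure D.Carrier, IsFiniteMeasure μ → IsFiniteMeasure ν →
    μ univ = ν univ →
    Integrable (fun z : D.Carrier × D.Carrier => D.regularise ε W z.1 z.2)
      ((μ + ν).prod (μ + ν)) →
    0 ≤ quadForm (D.regularise ε W) μ ν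

/-- Growth and regularity assumptions on the interaction potential. -/
structure IsLogRegular {d : ℕ} (D : Domain d) (W : D.Carrier → D.Carrier → ℝ) : Prop where
  log_bound : ∃ C₀ : ℝ, ∀ x : D.Carrier, ∀ ε ∈ Ioo (0 : ℝ) 1,
    |D.regularise ε W x x| ≤ C₀ * (|Real.log ε| + 1)
  besov : ∀ p : ℝ, 1 ≤ p → ∃ C : ℝ≥0∞ → ℝ, ∀ ρ : Measure D.Carrier, IsProbabilityMeasure ρ →
    HasBoundedDensity ρ → ∃ κ : ℝ, 0 < κ ∧ ∀ ε : ℝ, 0 < ε → ∀ x : D.Carrier,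
      ∫⁻ y, ENNReal.ofReal (|D.regularise ε W x y - W x y| ^ p) ∂ρ
        ≤ ENNReal.ofReal (C (densityNorm ρ) * ε ^ κ)
  superharmonic : ∃ α : ℝ, 0 < α ∧ ∃ ε₀ : ℝ, 0 < ε₀ ∧ ∃ K : ℝ,
    ∀ ε ∈ Ioo (0 : ℝ) ε₀, ∀ x y : D.Carrier, x ≠ y → -K * ε ^ α ≤ W x y - D.regularise ε W x y

section Generic

variable {X : Type*} [MetricSpace X] [MeasureSpace X]

/-! ### Mean-field energy -/

/-- Membership in `𝒫₂`: Borel probability measures with finite second moment. -/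
def IsP2 (ρ : Measure X) : Prop :=
  IsProbabilityMeasure ρ ∧ ∀ x₀ : X, ∫⁻ x, edist x x₀ ^ 2 ∂ρ < ∞

/-- All three terms of the mean-field energy of `ρ` are finite. -/
def HasFiniteEnergy (V : X → ℝ) (W : X → X → ℝ) (ρ : Measure X) : Prop :=
  ρ ≪ volume ∧
  Integrable (fun x => (ρ.rnDeriv volume x).toReal * Real.log (ρ.rnDeriv volume x).toReal) ∧
  Integrable V ρ ∧
  Integrable (fun z : X × X => W z.1 z.2) (ρ.prod ρ)

open Classical in
/-- `E[ρ] = ∫ ρ log ρ dx + ∫ V dρ + ½ ∫∫ W dρ dρ`, and `+∞` if one of the terms is not finite. -/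
def energy (V : X → ℝ) (W : X → X → ℝ) (ρ : Measure X) : EReal :=
  if HasFiniteEnergy V W ρ then
    (((∫ x, (ρ.rnDeriv volume x).toReal * Real.log (ρ.rnDeriv volume x).toReal)
      + (∫ x, V x ∂ρ) + (1 / 2) * ∫ z, W z.1 z.2 ∂(ρ.prod ρ) : ℝ) : EReal)
  else ⊤

/-- `μ` is the unique minimiser of the mean-field energy over `𝒫₂`. -/
def IsUniqueMinimiser (V : X → ℝ) (W : X → X → ℝ) (μ : Measure X) : Prop :=
  IsP2 μ ∧ energy V W μ < ⊤ ∧ ∀ ρ : Measure X, IsP2 ρ → ρ ≠ μ → energy V W μ < energy V W ρ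

/-! ### Gibbs measure -/

/-- `H_N(x) = (1 / 2N) ∑_{i ≠ j} W(x_i, x_j) + ∑_i V(x_i)`. -/
def hamiltonian (V : X → ℝ) (W : X → X → ℝ) {N : ℕ} (x : Fin N → X) : ℝ :=
  1 / (2 * (N : ℝ)) * (∑ i, ∑ j, if i ≠ j then W (x i) (x j) else 0) + ∑ i, V (x i)

/-- `Z̃_N = ∫ exp(-H_N) dx`. -/
def gibbsNormalisation (V : X → ℝ) (W : X → X → ℝ) (N : ℕ) : ℝ≥0∞ :=
  ∫⁻ x : Fin N → X, ENNReal.ofReal (Real.exp (-hamiltonian V W x))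

/-- The Gibbs measure `M_N = Z̃_N⁻¹ exp(-H_N) dx`. -/
def gibbsMeasure (V : X → ℝ) (W : X → X → ℝ) (N : ℕ) : Measure (Fin N → X) :=
  (gibbsNormalisation V W N)⁻¹ •
    (volume : Measure (Fin N → X)).withDensity
      (fun x => ENNReal.ofReal (Real.exp (-hamiltonian V W x)))

/-- The renormalised energy `½ ∫∫_{Ω² ∖ Δ} W dη dη` of the fluctuation
`η = N^{-1/2} (∑_i δ_{x_i} - N μ)`. -/
def fluctuationEnergy (W : X → X → ℝ) (μ : Measure X) {N : ℕ} (x : Fin N → X) : ℝ :=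
  1 / 2 * ((N : ℝ)⁻¹ *
    quadForm (fun a b => (diagonal X)ᶜ.indicator (fun z => W z.1 z.2) (a, b))
      (∑ i, Measure.dirac (x i)) ((N : ℝ≥0∞) • μ))

/-- `Z_N`, the partition function relative to `μ^{⊗N}`. -/
def relPartition (W : X → X → ℝ) (μ : Measure X) (N : ℕ) : ℝ≥0∞ :=
  ∫⁻ x : Fin N → X, ENNReal.ofReal (Real.exp (-fluctuationEnergy W μ x))
    ∂(Measure.pi fun _ => μ)

end Generic

/-! ### Averaged relative entropy, Wasserstein distance, Talagrand inequality -/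

/-- The averaged relative entropy `(1/N) ∫ log(dP/dQ) dP` (`+∞` if `P` is not absolutely
continuous with respect to `Q`) of probability measures on an `N`-fold product. -/
def avgEntropy {X : Type*} [MeasurableSpace X] {N : ℕ} (P Q : Measure (Fin N → X)) : ℝ≥0∞ :=
  klDiv P Q / (N : ℝ≥0∞)

/-- The optimal transport cost from `P` to `Q` for the cost `c`. -/
def transportCost {Y : Type*} [MeasurableSpace Y] (c : Y → Y → ℝ≥0∞) (P Q : Measure Y) : ℝ≥0∞ :=
  ⨅ (π : Measure (Y × Y)) (_ : π.map Prod.fst = P) (_ : π.map Prod.snd = Q),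
    ∫⁻ z, c z.1 z.2 ∂π

/-- The squared Wasserstein distance `d₂²` on `𝒫(Ω)`. -/
def wassersteinSq {X : Type*} [MetricSpace X] [MeasurableSpace X] (P Q : Measure X) : ℝ≥0∞ :=
  transportCost (fun x y => edist x y ^ 2) P Q

/-- The squared Wasserstein distance `d₂²` on `𝒫(Ω^N)`, for the Euclidean product distance
`(∑_i dist(x_i, y_i)²)^{1/2}` on `Ω^N`. -/
def wassersteinSqN {X : Type*} [MetricSpace X] [MeasurableSpace X] {N : ℕ}
    (P Q : Measure (Fin N → X)) : ℝ≥0∞ :=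
  transportCost (fun x y => ∑ i, edist (x i) (y i) ^ 2) P Q

/-- `μ` satisfies a (quadratic) Talagrand transport-entropy inequality. -/
def Talagrand {X : Type*} [MetricSpace X] [MeasureSpace X] (μ : Measure X) : Prop :=
  ∃ K : ℝ≥0, ∀ ν : Measure X, IsP2 ν → wassersteinSq ν μ ≤ K * klDiv ν μ

end MeanField

end

open MeanField

open ProbabilityTheory

namespace MeanField

/-! ### Exponential moments of centred two-body statistics -/

section CentredKernel

variable {X : Type*} [MeasurableSpace X]

/-! Write `μ` for the minimiser and `I` for the renormalised energy of the fluctuation `η`.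
Everything rests on the bound of `∫ exp(-2 I) dμ^{⊗N}` by a constant independent of `N`
(`IsRegularApprox.lintegral_exp_le`).

To obtain it, compare `W` with `G = P_ε W` for one fixed small `ε`, not depending on `N`. As `η` has
total mass zero, H-stability makes the full `G`-energy of `η` nonnegative; deleting the diagonal
costs only `N⁻¹ ∑ G(x_i, x_i)`, which is bounded. The remainder `R = W - G` has small `L¹(μ)` and
`L²(μ)` sections and is bounded below off the diagonal by a small negative constant. Removing its
marginal averages gives `-2 I ≤ N⁻¹ ∑_{i<j} h(x_i, x_j) + const`, where `h` is centred in each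
variable, has small `L²` sections and is bounded above, though possibly not below
(`IsRegularApprox.neg_two_fluctuationEnergy_le`). Such a degenerate two-body sum has bounded
exponential moments: integrate out one particle at a time and use `e^t ≤ 1 + t + t²`, valid for all
`t ≤ 1`. Centring kills the linear term, and the second-order term is absorbed by a quadratic
functional of the remaining particles whose coefficient grows by `4 / N²` per step
(`IsCentredKernel.lintegral_exp_pairSum_aux`).

The link with the Gibbs measure is the Euler–Lagrange equation `log ρ + V + ∫ W(·, y) dμ(y) = E[μ] +
½ ∫∫ W dμ dμ`, where `ρ` is the density of `μ`. It turns `H_N` into `I + N E[μ] - ∑ log ρ(x_i)`, so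
that `exp(-H_N) dx = exp(-N E[μ]) exp(-I) dμ^{⊗N}`. This needs `ρ > 0` almost everywhere, which
holds because mass `t` put where `ρ = 0` changes the entropy by a term `t log t` that beats all the
`O(t)` terms.

With `P = μ^{⊗N}`, `M` the Gibbs measure and `w = ∫∫ W dμ dμ`, one has `∫ I dP = -w/2`. Hence the
entropy of `P` with respect to `M` is `log Z - w/2`, bounded because `Z` is; its nonnegativity
bounds `Z` from below; and the entropy of `M` with respect to `P` is `∫ -I dM - log Z ≤ Z⁻¹ ∫ exp(-2
I) dP - log Z`. Neither bound grows with `N`, so dividing by `N` gives `C / N`.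

Finally the Talagrand inequality tensorises with the same constant (`IsTransportEntropy.prod`), and
the entropy bound for `M` becomes a Wasserstein bound. Working with densities bounded above and
below, and gluing only countably many couplings, avoids a measurable selection of optimal plans. -/

theorem exp_le_one_add_add_sq {t : ℝ} (ht : t ≤ 1) : Real.exp t ≤ 1 + t + t ^ 2 := by
  rcases le_or_gt (-1) t with h | h
  · have := Real.abs_exp_sub_one_sub_id_le (abs_le.2 ⟨h, ht⟩)
    linarith [(abs_le.1 this).2]
  · have : Real.exp t ≤ 1 := Real.exp_le_one_iff.2 (by linarith)
    nlinarith

theorem integrable_mul_of_sq {μ : Measure X} {f g : X → ℝ} (hf : AEStronglyMeasurable f μ)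
    (hg : AEStronglyMeasurable g μ) (hf2 : Integrable (fun x => f x ^ 2) μ)
    (hg2 : Integrable (fun x => g x ^ 2) μ) : Integrable (fun x => f x * g x) μ :=
  ((memLp_two_iff_integrable_sq hf).2 hf2).integrable_mul ((memLp_two_iff_integrable_sq hg).2 hg2)

theorem integrable_of_sq {μ : Measure X} [IsFiniteMeasure μ] {f : X → ℝ}
    (hf : AEStronglyMeasurable f μ) (hf2 : Integrable (fun x => f x ^ 2) μ) : Integrable f μ :=
  ((memLp_two_iff_integrable_sq hf).2 hf2).integrable (by norm_num)

theorem integrable_add_sq {μ : Measure X} {f g : X → ℝ} (hf : AEStronglyMeasurable f μ)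
    (hg : AEStronglyMeasurable g μ) (hf2 : Integrable (fun x => f x ^ 2) μ)
    (hg2 : Integrable (fun x => g x ^ 2) μ) : Integrable (fun x => (f x + g x) ^ 2) μ := by
  refine ((hf2.add hg2).add ((integrable_mul_of_sq hf hg hf2 hg2).const_mul 2)).congr ?_
  filter_upwards with x
  simp only [Pi.add_apply]
  ring

theorem integral_add_sq {μ : Measure X} {f g : X → ℝ} (hf : AEStronglyMeasurable f μ)
    (hg : AEStronglyMeasurable g μ) (hf2 : Integrable (fun x => f x ^ 2) μ)
    (hg2 : Integrable (fun x => g x ^ 2) μ) :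
    ∫ x, (f x + g x) ^ 2 ∂μ
      = (∫ x, f x ^ 2 ∂μ) + 2 * (∫ x, f x * g x ∂μ) + ∫ x, g x ^ 2 ∂μ := by
  have hfg := integrable_mul_of_sq hf hg hf2 hg2
  rw [← integral_const_mul, ← integral_add hf2 (hfg.const_mul 2),
    ← integral_add (f := fun x => f x ^ 2 + 2 * (f x * g x)) (hf2.add (hfg.const_mul 2)) hg2]
  refine integral_congr_ae ?_
  filter_upwards with x
  ring

/-- Cauchy–Schwarz: the polynomial `t ↦ ∫ (f + t g)²` is nonnegative, so its discriminant is not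
positive. -/
theorem integral_mul_sq_le {μ : Measure X} {f g : X → ℝ} (hf : AEStronglyMeasurable f μ)
    (hg : AEStronglyMeasurable g μ) (hf2 : Integrable (fun x => f x ^ 2) μ)
    (hg2 : Integrable (fun x => g x ^ 2) μ) :
    (∫ x, f x * g x ∂μ) ^ 2 ≤ (∫ x, f x ^ 2 ∂μ) * ∫ x, g x ^ 2 ∂μ := by
  have key : ∀ t : ℝ, 0 ≤ (∫ x, g x ^ 2 ∂μ) * (t * t) + (2 * ∫ x, f x * g x ∂μ) * t
      + ∫ x, f x ^ 2 ∂μ := by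
    intro t
    have h := integral_add_sq hf (hg.const_mul t) hf2
      ((hg2.const_mul (t ^ 2)).congr (by filter_upwards with x; ring))
    have h0 : 0 ≤ ∫ x, (f x + t * g x) ^ 2 ∂μ := integral_nonneg fun x => sq_nonneg _
    have h1 : ∫ x, f x * (t * g x) ∂μ = t * ∫ x, f x * g x ∂μ := by
      rw [← integral_const_mul]; congr 1; ext x; ring
    have h2 : ∫ x, (t * g x) ^ 2 ∂μ = t ^ 2 * ∫ x, g x ^ 2 ∂μ := by
      rw [← integral_const_mul]; congr 1; ext x; ring
    rw [h, h1, h2] at h0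
    linarith
  have := discrim_le_zero key
  rw [discrim] at this
  nlinarith

/-- A symmetric kernel which is centred in each variable, bounded above by `δ`, and whose
sections have squared `L²` norm at most `s`. -/
structure IsCentredKernel (μ : Measure X) (h : X → X → ℝ) (s δ : ℝ) : Prop where
  measurable : Measurable fun z : X × X => h z.1 z.2
  symm : ∀ x y, h x y = h y x
  le : ∀ x y, h x y ≤ δ
  integrable_sq : ∀ x, Integrable (fun y => h x y ^ 2) μ
  sq_le : ∀ x, ∫ y, h x y ^ 2 ∂μ ≤ s
  mean : ∀ x, ∫ y, h x y ∂μ = 0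

variable {μ : Measure X} {h : X → X → ℝ} {s δ : ℝ}

theorem IsCentredKernel.measurable_right (H : IsCentredKernel μ h s δ) (x : X) :
    Measurable (fun y => h y x) :=
  H.measurable.comp (measurable_id.prodMk measurable_const)

theorem IsCentredKernel.integrable_sq_right (H : IsCentredKernel μ h s δ) (x : X) :
    Integrable (fun y => h y x ^ 2) μ := by
  simpa only [H.symm x] using H.integrable_sq x

theorem IsCentredKernel.sq_le_right (H : IsCentredKernel μ h s δ) (x : X) :
    ∫ y, h y x ^ 2 ∂μ ≤ s := by
  simpa only [H.symm x] using H.sq_le x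

theorem IsCentredKernel.nonneg (H : IsCentredKernel μ h s δ) [Nonempty X] : 0 ≤ s :=
  (integral_nonneg fun _ => sq_nonneg _).trans (H.sq_le (Classical.arbitrary X))

variable [IsProbabilityMeasure μ]

/-- Integrating out one particle. -/
theorem IsCentredKernel.lintegral_exp_le (H : IsCentredKernel μ h s δ) (hs : s ≤ 1 / 64)
    {n : ℝ} (hn : 1 ≤ n) {a : ℝ} (ha0 : 0 ≤ a) (ha : a ≤ 4 / n) {v : X → ℝ}
    (hv : Measurable v) (hv2 : Integrable (fun x => v x ^ 2) μ) (hv0 : ∫ x, v x ∂μ = 0)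
    (hvδ : ∀ x, v x ≤ n * (1 / 2)) (hvq : ∫ x, v x ^ 2 ∂μ ≤ n ^ 2 * s) :
    ∫⁻ x, ENNReal.ofReal (Real.exp (1 / n * v x + a * ∫ y, (h y x + v y) ^ 2 ∂μ)) ∂μ
      ≤ ENNReal.ofReal (Real.exp (a * s + (a + 4 / n ^ 2) * ∫ y, v y ^ 2 ∂μ)) := by
  have : Nonempty X := by
    by_contra hX
    rw [not_nonempty_iff] at hX
    exact IsProbabilityMeasure.ne_zero μ (Measure.eq_zero_of_isEmpty μ)
  have hs0 := H.nonneg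
  have hn0 : 0 < n := by linarith
  set q := ∫ y, v y ^ 2 ∂μ with hq
  have hq0 : 0 ≤ q := integral_nonneg fun _ => sq_nonneg _
  -- `u` is the cross term produced by expanding the square `(h y x + v y)²`.
  set u : X → ℝ := fun x => ∫ y, h y x * v y ∂μ with hu
  have hum : StronglyMeasurable u := by
    have : Measurable fun z : X × X => h z.2 z.1 * v z.2 :=
      (H.measurable.comp measurable_swap).mul (hv.comp measurable_snd)
    exact this.stronglyMeasurable.integral_prod_right (ν := μ)
  have hu2 : ∀ x, u x ^ 2 ≤ s * q := fun x =>
    (integral_mul_sq_le (H.measurable_right x).aestronglyMeasurable hv.aestronglyMeasurable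
      (H.integrable_sq_right x) hv2).trans
      (mul_le_mul_of_nonneg_right (H.sq_le_right x) hq0)
  have hu2i : Integrable (fun x => u x ^ 2) μ := by
    refine Integrable.of_bound (hum.pow 2).aestronglyMeasurable (s * q) ?_
    filter_upwards with x
    rw [Real.norm_eq_abs, abs_of_nonneg (sq_nonneg _)]
    exact hu2 x
  -- By Fubini: integrating in `x` first meets the centring of `h`. The integrability of the product
  -- comes from `|h v| ≤ (h² + v²) / 2`.
  have hu0 : ∫ x, u x ∂μ = 0 := by
    have hint : Integrable (fun z : X × X => h z.2 z.1 * v z.2) (μ.prod μ) := by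
      have hm : Measurable fun z : X × X => h z.2 z.1 * v z.2 :=
        (H.measurable.comp measurable_swap).mul (hv.comp measurable_snd)
      refine (integrable_prod_iff hm.aestronglyMeasurable).2 ⟨?_, ?_⟩
      · filter_upwards with x
        exact integrable_mul_of_sq (H.measurable_right x).aestronglyMeasurable
          hv.aestronglyMeasurable (H.integrable_sq_right x) hv2
      · refine Integrable.of_bound
          (hm.norm.stronglyMeasurable.integral_prod_right (ν := μ)).aestronglyMeasurable
          ((s + q) / 2) ?_
        filter_upwards with x
        rw [Real.norm_eq_abs, abs_of_nonneg (integral_nonneg fun _ => norm_nonneg _)]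
        have : ∫ y, ‖h y x * v y‖ ∂μ ≤ ∫ y, (h y x ^ 2 + v y ^ 2) / 2 ∂μ := by
          refine integral_mono (integrable_mul_of_sq (H.measurable_right x).aestronglyMeasurable
            hv.aestronglyMeasurable (H.integrable_sq_right x) hv2).norm
            (((H.integrable_sq_right x).add hv2).div_const 2) fun y => ?_
          simp only [Real.norm_eq_abs]
          rw [abs_le]
          constructor <;> nlinarith [sq_nonneg (h y x - v y), sq_nonneg (h y x + v y)]
        rw [integral_div, integral_add (H.integrable_sq_right x) hv2] at this
        have := H.sq_le_right x
        linarith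
    have := integral_integral_swap (f := fun x y => h y x * v y) (μ := μ) (ν := μ) hint
    simp only [hu]
    rw [this]
    simp only [integral_mul_const, H.mean, zero_mul, integral_zero]
  set T : X → ℝ := fun x => 1 / n * v x + 2 * a * u x with hT
  have hvi := integrable_of_sq hv.aestronglyMeasurable hv2
  have hui := integrable_of_sq hum.aestronglyMeasurable hu2i
  have hTi : Integrable T μ := (hvi.const_mul _).add (hui.const_mul _)
  have hT0 : ∫ x, T x ∂μ = 0 := by
    rw [integral_add (hvi.const_mul _) (hui.const_mul _), integral_const_mul,
      integral_const_mul, hv0, hu0]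
    simp
  have hvn2 : Integrable (fun x => (1 / n * v x) ^ 2) μ :=
    (hv2.const_mul ((1 / n) ^ 2)).congr (by filter_upwards with x; ring)
  have han2 : Integrable (fun x => (2 * a * u x) ^ 2) μ :=
    (hu2i.const_mul ((2 * a) ^ 2)).congr (by filter_upwards with x; ring)
  have hTi2 : Integrable (fun x => T x ^ 2) μ :=
    integrable_add_sq (hvi.const_mul _).aestronglyMeasurable
      (hui.const_mul _).aestronglyMeasurable hvn2 han2
  have han : a * n ≤ 4 := by rwa [le_div_iff₀ hn0] at ha
  -- Of the factor `4`, half is `2 (v / n)²`; the other half bounds `8 a² s q` through `a n ≤ 4` and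
  -- `s ≤ 1/64`.
  have hT2 : ∫ x, T x ^ 2 ∂μ ≤ 4 / n ^ 2 * q := by
    have h1 : ∫ x, T x ^ 2 ∂μ ≤ ∫ x, (2 * (1 / n) ^ 2) * v x ^ 2 + 8 * a ^ 2 * (s * q) ∂μ := by
      refine integral_mono hTi2 ((hv2.const_mul _).add (integrable_const _)) fun x => ?_
      simp only [hT]
      have := mul_le_mul_of_nonneg_left (hu2 x) (by positivity : 0 ≤ 8 * a ^ 2)
      nlinarith [sq_nonneg (1 / n * v x - 2 * a * u x)]
    rw [integral_add (hv2.const_mul _) (integrable_const _), integral_const_mul] at h1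
    simp only [integral_const, probReal_univ, smul_eq_mul, one_mul] at h1
    refine h1.trans ?_
    rw [← hq]
    have h2 : a ^ 2 * n ^ 2 ≤ 16 := by nlinarith [mul_nonneg ha0 hn0.le]
    have h3 : 8 * a ^ 2 * (s * q) ≤ 2 / n ^ 2 * q := by
      have : 8 * a ^ 2 * s ≤ 2 / n ^ 2 := by
        rw [le_div_iff₀ (by positivity)]
        nlinarith [mul_nonneg (sq_nonneg a) (sq_nonneg n)]
      nlinarith [mul_le_mul_of_nonneg_right this hq0]
    have h4 : 2 * (1 / n) ^ 2 * q + 2 / n ^ 2 * q = 4 / n ^ 2 * q := by field_simp; ring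
    linarith
  -- `v / n ≤ 1/2`, and `2 a u ≤ 8 s ≤ 1/8` since `u ≤ n s`. Only an upper bound is needed, so `h`
  -- may be unbounded below.
  have hT1 : ∀ x, T x ≤ 1 := by
    intro x
    have h1 : 1 / n * v x ≤ 1 / 2 := by
      have := mul_le_mul_of_nonneg_left (hvδ x) (by positivity : 0 ≤ 1 / n)
      have h' : 1 / n * (n * (1 / 2)) = 1 / 2 := by field_simp
      linarith
    have h2 : u x ≤ n * s := by
      refine abs_le_of_sq_le_sq' ?_ (by positivity) |>.2
      have := mul_le_mul_of_nonneg_left hvq hs0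
      nlinarith [hu2 x]
    have h3 : a * u x ≤ a * (n * s) := mul_le_mul_of_nonneg_left h2 ha0
    simp only [hT]
    nlinarith
  have hpt : ∀ x, 1 / n * v x + a * ∫ y, (h y x + v y) ^ 2 ∂μ ≤ T x + (a * s + a * q) := by
    intro x
    rw [integral_add_sq (H.measurable_right x).aestronglyMeasurable hv.aestronglyMeasurable
      (H.integrable_sq_right x) hv2]
    have := mul_le_mul_of_nonneg_left (H.sq_le_right x) ha0
    simp only [hT, hu]
    nlinarith
  calc ∫⁻ x, ENNReal.ofReal (Real.exp (1 / n * v x + a * ∫ y, (h y x + v y) ^ 2 ∂μ)) ∂μ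
      ≤ ∫⁻ x, ENNReal.ofReal ((1 + T x + T x ^ 2) * Real.exp (a * s + a * q)) ∂μ := by
        refine lintegral_mono fun x => ENNReal.ofReal_le_ofReal ?_
        refine (Real.exp_le_exp.2 (hpt x)).trans ?_
        rw [Real.exp_add]
        exact mul_le_mul_of_nonneg_right (exp_le_one_add_add_sq (hT1 x)) (Real.exp_pos _).le
    _ = ENNReal.ofReal (∫ x, (1 + T x + T x ^ 2) * Real.exp (a * s + a * q) ∂μ) := by
        rw [ofReal_integral_eq_lintegral_ofReal]
        · exact (((integrable_const 1).add hTi).add hTi2).mul_const _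
        · filter_upwards with x
          have := (Real.exp_pos (T x)).le.trans (exp_le_one_add_add_sq (hT1 x))
          exact mul_nonneg this (Real.exp_pos _).le
    _ ≤ _ := by
        refine ENNReal.ofReal_le_ofReal ?_
        rw [integral_mul_const,
          integral_add (f := fun x => 1 + T x) ((integrable_const 1).add hTi) hTi2,
          integral_add (integrable_const 1) hTi, hT0]
        simp only [integral_const, probReal_univ, smul_eq_mul, one_mul, add_zero]
        have h1 : 1 + ∫ x, T x ^ 2 ∂μ ≤ Real.exp (4 / n ^ 2 * q) := by
          have := Real.add_one_le_exp (4 / n ^ 2 * q)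
          linarith
        refine (mul_le_mul_of_nonneg_right h1 (Real.exp_pos _).le).trans ?_
        rw [← Real.exp_add]
        exact Real.exp_le_exp.2 (by linarith)

/-- The sum of `h` over the pairs of distinct particles. -/
noncomputable def pairSum (h : X → X → ℝ) : (n : ℕ) → (Fin n → X) → ℝ
  | 0, _ => 0
  | n + 1, x => (∑ j, h (x 0) (Fin.tail x j)) + pairSum h n (Fin.tail x)

theorem pairSum_eq (hsymm : ∀ x y, h x y = h y x) (n : ℕ) (x : Fin n → X) :
    2 * pairSum h n x = ∑ i, ∑ j, if i ≠ j then h (x i) (x j) else 0 := by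
  induction n with
  | zero => simp [pairSum]
  | succ n ih =>
    simp only [Fin.sum_univ_succ, pairSum, mul_add, ih, Fin.tail]
    have e1 : ∀ j : Fin n, ((0 : Fin (n + 1)) ≠ j.succ) = True := fun j =>
      eq_true (Fin.succ_ne_zero j).symm
    have e2 : ∀ j : Fin n, ((j.succ : Fin (n + 1)) ≠ 0) = True := fun j =>
      eq_true (Fin.succ_ne_zero j)
    simp only [e1, e2, ne_eq, not_true_eq_false, if_true, if_false, Fin.succ_inj,
      Finset.sum_add_distrib, zero_add]
    have : ∑ j : Fin n, h (x j.succ) (x 0) = ∑ j : Fin n, h (x 0) (x j.succ) :=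
      Finset.sum_congr rfl fun j _ => hsymm _ _
    rw [this]
    ring

theorem IsCentredKernel.measurable_pairSum (H : IsCentredKernel μ h s δ) (n : ℕ) :
    Measurable (pairSum h n) := by
  induction n with
  | zero => exact measurable_const
  | succ n ih =>
    have ht : Measurable (Fin.tail : (Fin (n + 1) → X) → Fin n → X) :=
      measurable_pi_lambda _ fun i => measurable_pi_apply _
    refine Measurable.add (Finset.measurable_sum _ fun j _ => ?_) (ih.comp ht)
    have hm : Measurable fun x : Fin (n + 1) → X => (x 0, x j.succ) :=
      (measurable_pi_apply 0).prodMk (measurable_pi_apply j.succ)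
    exact H.measurable.comp hm

/-- The field `∑ j, h y (x j)` created by `n` particles satisfies what the one-particle integration
requires of `v`. -/
theorem IsCentredKernel.sum_section (H : IsCentredKernel μ h s δ) (hδ : δ ≤ 1 / 2) (n : ℕ)
    (x : Fin n → X) :
    Measurable (fun y => ∑ j, h y (x j)) ∧ Integrable (fun y => (∑ j, h y (x j)) ^ 2) μ ∧
      ∫ y, ∑ j, h y (x j) ∂μ = 0 ∧ (∀ y, ∑ j, h y (x j) ≤ n * (1 / 2)) ∧
      ∫ y, (∑ j, h y (x j)) ^ 2 ∂μ ≤ (n : ℝ) ^ 2 * s := by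
  have hm : Measurable (fun y => ∑ j, h y (x j)) :=
    Finset.measurable_sum _ fun j _ => H.measurable_right _
  have hpt : ∀ y, (∑ j, h y (x j)) ^ 2 ≤ n * ∑ j, h y (x j) ^ 2 := fun y => by
    simpa using sq_sum_le_card_mul_sum_sq (s := Finset.univ) (f := fun j => h y (x j))
  have hi : Integrable (fun y => n * ∑ j, h y (x j) ^ 2) μ :=
    (integrable_finsetSum _ fun j _ => H.integrable_sq_right (x j)).const_mul _
  have hi2 : Integrable (fun y => (∑ j, h y (x j)) ^ 2) μ := by
    refine hi.mono (hm.pow_const 2).aestronglyMeasurable ?_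
    filter_upwards with y
    rw [Real.norm_eq_abs, Real.norm_eq_abs, abs_of_nonneg (sq_nonneg _)]
    exact (hpt y).trans (le_abs_self _)
  refine ⟨hm, hi2, ?_, ?_, ?_⟩
  · rw [integral_finsetSum]
    · refine Finset.sum_eq_zero fun j _ => ?_
      simpa only [H.symm (x j)] using H.mean (x j)
    · exact fun j _ => integrable_of_sq (H.measurable_right _).aestronglyMeasurable
        (H.integrable_sq_right _)
  · intro y
    calc ∑ j, h y (x j) ≤ ∑ _j : Fin n, (1 / 2 : ℝ) :=
          Finset.sum_le_sum fun j _ => (H.le _ _).trans hδ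
      _ = n * (1 / 2) := by simp
  · calc ∫ y, (∑ j, h y (x j)) ^ 2 ∂μ ≤ ∫ y, n * ∑ j, h y (x j) ^ 2 ∂μ :=
          integral_mono hi2 hi hpt
      _ = n * ∑ j, ∫ y, h y (x j) ^ 2 ∂μ := by
          rw [integral_const_mul, integral_finsetSum]
          exact fun j _ => H.integrable_sq_right (x j)
      _ ≤ n * ∑ _j : Fin n, s := by
          gcongr with j
          exact H.sq_le_right (x j)
      _ = (n : ℝ) ^ 2 * s := by simp; ring

/-- The induction must carry a weight on the squared norm of the field of the first `m` particles.
One integration raises the weight by `4 / N²` and costs a factor `exp(4 s / N)`, so the weight `4 (N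
- m) / N²` is exactly what the `N - m` particles already integrated out have produced. It never
exceeds `4 / N`. -/
theorem IsCentredKernel.lintegral_exp_pairSum_aux (H : IsCentredKernel μ h s δ)
    (hs : s ≤ 1 / 64) (hδ : δ ≤ 1 / 2) {N : ℕ} (hN : 1 ≤ N) (m : ℕ) (hm : m ≤ N) :
    ∫⁻ x : Fin m → X, ENNReal.ofReal (Real.exp (1 / (N : ℝ) * pairSum h m x
        + 4 * ((N : ℝ) - m) / (N : ℝ) ^ 2 * ∫ y, (∑ j, h y (x j)) ^ 2 ∂μ))
        ∂(Measure.pi fun _ => μ)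
      ≤ ENNReal.ofReal (Real.exp (m * (4 * s / N))) := by
  have : Nonempty X := by
    by_contra hX
    rw [not_nonempty_iff] at hX
    exact IsProbabilityMeasure.ne_zero μ (Measure.eq_zero_of_isEmpty μ)
  have hs0 := H.nonneg
  have hN1 : (1 : ℝ) ≤ N := by exact_mod_cast hN
  have hN0 : (0 : ℝ) < N := by linarith
  induction m with
  | zero => simp [pairSum]
  | succ m ih =>
    have hmN : (m : ℝ) + 1 ≤ N := by exact_mod_cast hm
    set a : ℝ := 4 * ((N : ℝ) - (m + 1 : ℕ)) / (N : ℝ) ^ 2 with ha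
    have ha0 : 0 ≤ a := by
      rw [ha]; push_cast
      exact div_nonneg (by linarith) (by positivity)
    have ha4 : a ≤ 4 / N := by
      rw [ha, div_le_div_iff₀ (by positivity) hN0]
      push_cast
      nlinarith
    have hstep : a + 4 / (N : ℝ) ^ 2 = 4 * ((N : ℝ) - m) / (N : ℝ) ^ 2 := by
      rw [ha]; push_cast; field_simp; ring
    have hsq : Measurable fun z : (Fin (m + 1) → X) => ∫ y, (∑ j, h y (z j)) ^ 2 ∂μ := by
      have : Measurable fun p : (Fin (m + 1) → X) × X => (∑ j, h p.2 (p.1 j)) ^ 2 :=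
        (Finset.measurable_sum _ fun j _ => H.measurable.comp
          (measurable_snd.prodMk ((measurable_pi_apply j).comp measurable_fst))).pow_const 2
      exact (this.stronglyMeasurable.integral_prod_right (ν := μ)).measurable
    have hmeas : Measurable fun x : Fin (m + 1) → X => ENNReal.ofReal (Real.exp
        (1 / (N : ℝ) * pairSum h (m + 1) x + a * ∫ y, (∑ j, h y (x j)) ^ 2 ∂μ)) :=
      ENNReal.measurable_ofReal.comp (Real.measurable_exp.comp
        (((H.measurable_pairSum _).const_mul _).add (hsq.const_mul _)))
    have hmp := (measurePreserving_piFinSuccAbove (fun _ : Fin (m + 1) => μ) 0).symm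
    rw [← hmp.lintegral_comp hmeas]
    have hmeas' :=
      hmeas.comp (MeasurableEquiv.piFinSuccAbove (fun _ => X) (0 : Fin (m + 1))).symm.measurable
    refine (lintegral_prod_symm' _ hmeas').le.trans ?_
    have hb : ∀ x' : Fin m → X,
        ∫⁻ x0, ENNReal.ofReal (Real.exp (1 / (N : ℝ) * pairSum h (m + 1)
          ((MeasurableEquiv.piFinSuccAbove (fun _ => X) (0 : Fin (m + 1))).symm (x0, x'))
          + a * ∫ y, (∑ j, h y
            ((MeasurableEquiv.piFinSuccAbove (fun _ => X) (0 : Fin (m + 1))).symm (x0, x') j))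
              ^ 2 ∂μ)) ∂μ
        ≤ ENNReal.ofReal (Real.exp (4 * s / N)) * ENNReal.ofReal (Real.exp
          (1 / (N : ℝ) * pairSum h m x'
            + 4 * ((N : ℝ) - m) / (N : ℝ) ^ 2 * ∫ y, (∑ j, h y (x' j)) ^ 2 ∂μ)) := by
      intro x'
      obtain ⟨v1, v2, v3, v4, v5⟩ := H.sum_section hδ m x'
      have hmN' : (m : ℝ) ≤ N := by linarith
      have := H.lintegral_exp_le hs hN1 ha0 ha4 v1 v2 v3
        (fun y => (v4 y).trans (by linarith))
        (v5.trans (mul_le_mul_of_nonneg_right (by gcongr) hs0))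
      have e : ∀ x0, (MeasurableEquiv.piFinSuccAbove (fun _ => X) (0 : Fin (m + 1))).symm (x0, x')
          = (Fin.cons x0 x' : Fin (m + 1) → X) := fun x0 => by
        simp [MeasurableEquiv.piFinSuccAbove, Fin.insertNthEquiv]
      -- Isolating particle `0` splits the pair sum into its interaction with the others, which is
      -- `v`, and the pair sum of the others, which is constant in the integration.
      simp only [e, pairSum, Fin.tail_cons, Fin.cons_zero, Fin.sum_univ_succ, Fin.cons_succ]
      rw [← ENNReal.ofReal_mul (Real.exp_pos _).le, ← Real.exp_add]
      have e2 : ∀ x0, ENNReal.ofReal (Real.exp (1 / (N : ℝ) * (∑ j, h x0 (x' j) + pairSum h m x')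
          + a * ∫ y, (h y x0 + ∑ j, h y (x' j)) ^ 2 ∂μ))
          = ENNReal.ofReal (Real.exp (1 / (N : ℝ) * pairSum h m x')) *
            ENNReal.ofReal (Real.exp (1 / (N : ℝ) * ∑ j, h x0 (x' j)
          + a * ∫ y, (h y x0 + ∑ j, h y (x' j)) ^ 2 ∂μ)) := fun x0 => by
        rw [← ENNReal.ofReal_mul (Real.exp_pos _).le, ← Real.exp_add]
        congr 2
        ring
      simp only [e2]
      rw [lintegral_const_mul' _ _ ENNReal.ofReal_ne_top]
      refine (mul_le_mul_right this _).trans ?_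
      rw [← ENNReal.ofReal_mul (Real.exp_pos _).le, ← Real.exp_add, hstep]
      refine ENNReal.ofReal_le_ofReal (Real.exp_le_exp.2 ?_)
      have : a * s ≤ 4 * s / N := by
        have := mul_le_mul_of_nonneg_right ha4 hs0
        have e : 4 / (N : ℝ) * s = 4 * s / N := by ring
        linarith
      linarith
    refine (lintegral_mono hb).trans ?_
    rw [lintegral_const_mul' _ _ ENNReal.ofReal_ne_top]
    refine (mul_le_mul_right (ih (by omega)) _).trans ?_
    rw [← ENNReal.ofReal_mul (Real.exp_pos _).le, ← Real.exp_add]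
    refine ENNReal.ofReal_le_ofReal (Real.exp_le_exp.2 ?_)
    push_cast
    linarith

theorem IsCentredKernel.lintegral_exp_pairSum (H : IsCentredKernel μ h s δ)
    (hs : s ≤ 1 / 64) (hδ : δ ≤ 1 / 2) {N : ℕ} (hN : 1 ≤ N) :
    ∫⁻ x : Fin N → X, ENNReal.ofReal (Real.exp (1 / (N : ℝ) * pairSum h N x))
        ∂(Measure.pi fun _ => μ) ≤ ENNReal.ofReal (Real.exp (4 * s)) := by
  have hN0 : (N : ℝ) ≠ 0 := by positivity
  -- For `m = N` the quadratic weight vanishes and the `N` factors `exp(4 s / N)` multiply to `exp(4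
  -- s)`.
  have := H.lintegral_exp_pairSum_aux hs hδ hN N le_rfl
  have e : (N : ℝ) * (4 * s / N) = 4 * s := by field_simp
  simpa [e] using this

end CentredKernel


/-! ### The renormalised energy of the fluctuations -/

section Fluctuation

theorem integrable_dirac_sum_prod {X : Type*} [MeasurableSpace X] [MeasurableSingletonClass X]
    {ρ : Measure X} [SFinite ρ] {F : X → X → ℝ} (hF : Measurable fun z : X × X => F z.1 z.2)
    (hi : ∀ x, Integrable (F x) ρ) {n : ℕ} (x : Fin n → X) :
    Integrable (fun z : X × X => F z.1 z.2) ((∑ i, Measure.dirac (x i)).prod ρ) := by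
  refine (integrable_prod_iff hF.aestronglyMeasurable).2 ⟨ae_of_all _ hi, ?_⟩
  rw [integrable_finsetSum_measure]
  intro i _
  exact integrable_dirac (by simp)

theorem integral_dirac_sum_prod {X : Type*} [MeasurableSpace X] [MeasurableSingletonClass X]
    {ρ : Measure X} [SFinite ρ] {F : X → X → ℝ} (hF : Measurable fun z : X × X => F z.1 z.2)
    (hi : ∀ x, Integrable (F x) ρ) {n : ℕ} (x : Fin n → X) :
    ∫ z, F z.1 z.2 ∂((∑ i, Measure.dirac (x i)).prod ρ) = ∑ i, ∫ y, F (x i) y ∂ρ := by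
  rw [integral_prod _ (integrable_dirac_sum_prod hF hi x), integral_finsetSum_measure]
  · simp
  · exact fun i _ => integrable_dirac (by simp)

theorem integrable_dirac_sum {X : Type*} [MeasurableSpace X] [MeasurableSingletonClass X]
    (f : X → ℝ) {n : ℕ} (x : Fin n → X) : Integrable f (∑ i, Measure.dirac (x i)) := by
  rw [integrable_finsetSum_measure]
  exact fun i _ => integrable_dirac (by simp)

theorem integral_dirac_sum {X : Type*} [MeasurableSpace X] [MeasurableSingletonClass X]
    (f : X → ℝ) {n : ℕ} (x : Fin n → X) :
    ∫ y, f y ∂(∑ i, Measure.dirac (x i)) = ∑ i, f (x i) := by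
  rw [integral_finsetSum_measure]
  · simp
  · exact fun i _ => integrable_dirac (by simp)

/-- A measurable symmetric interaction all whose sections and which itself are integrable. -/
structure IsIntegrableKernel {X : Type*} [MeasurableSpace X] (F : X → X → ℝ) (μ : Measure X) :
    Prop where
  measurable : Measurable fun z : X × X => F z.1 z.2
  symm : ∀ x y, F x y = F y x
  integrable : Integrable (fun z : X × X => F z.1 z.2) (μ.prod μ)
  integrable_section : ∀ x, Integrable (F x) μ

section

variable {X : Type*} [MeasurableSpace X] [MeasurableSingletonClass X]
  {μ : Measure X} [IsProbabilityMeasure μ] {F : X → X → ℝ}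

theorem integrable_prod_swap_of_symm {F : X → X → ℝ} (hs : ∀ x y, F x y = F y x)
    {ρ σ : Measure X} [SFinite ρ] [SFinite σ]
    (h : Integrable (fun z : X × X => F z.1 z.2) (ρ.prod σ)) :
    Integrable (fun z : X × X => F z.1 z.2) (σ.prod ρ) := by
  refine h.swap.congr ?_
  filter_upwards with z
  simpa using hs _ _

theorem integral_prod_swap_of_symm {F : X → X → ℝ} (hs : ∀ x y, F x y = F y x)
    (ρ σ : Measure X) [SFinite ρ] [SFinite σ] :
    ∫ z, F z.1 z.2 ∂(σ.prod ρ) = ∫ z, F z.1 z.2 ∂(ρ.prod σ) := by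
  rw [← integral_prod_swap]
  refine integral_congr_ae ?_
  filter_upwards with z
  simpa using hs _ _

theorem IsIntegrableKernel.integrable_empirical (h : IsIntegrableKernel F μ) {n : ℕ}
    (x : Fin n → X) (c : ℝ≥0∞) (hc : c ≠ ∞) :
    Integrable (fun z : X × X => F z.1 z.2)
      (((∑ i, Measure.dirac (x i)) + c • μ).prod ((∑ i, Measure.dirac (x i)) + c • μ)) := by
  have : IsFiniteMeasure (c • μ) := ⟨by
    simp [hc.lt_top]⟩
  have h1 := integrable_dirac_sum_prod h.measurable
    (fun y => (h.integrable_section y).smul_measure hc) x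
  rw [Measure.prod_add, Measure.add_prod, Measure.add_prod, integrable_add_measure,
    integrable_add_measure, integrable_add_measure]
  refine ⟨⟨integrable_dirac_sum_prod h.measurable (fun y => integrable_dirac_sum _ x) x,
    integrable_prod_swap_of_symm h.symm h1⟩, h1, ?_⟩
  rw [Measure.prod_smul_right, Measure.prod_smul_left]
  exact (h.integrable.smul_measure hc).smul_measure hc

theorem IsIntegrableKernel.quadForm_eq (h : IsIntegrableKernel F μ) {n : ℕ} (x : Fin n → X) :
    (∫ z, F z.1 z.2 ∂((∑ i, Measure.dirac (x i)).prod (∑ i, Measure.dirac (x i))))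
      - (∫ z, F z.1 z.2 ∂((∑ i, Measure.dirac (x i)).prod ((n : ℝ≥0∞) • μ)))
      - (∫ z, F z.1 z.2 ∂(((n : ℝ≥0∞) • μ).prod (∑ i, Measure.dirac (x i))))
      + (∫ z, F z.1 z.2 ∂(((n : ℝ≥0∞) • μ).prod ((n : ℝ≥0∞) • μ)))
      = (∑ i, ∑ j, F (x i) (x j)) - 2 * n * (∑ i, ∫ y, F (x i) y ∂μ)
        + (n : ℝ) ^ 2 * ∫ z, F z.1 z.2 ∂(μ.prod μ) := by
  have hc : (n : ℝ≥0∞) ≠ ∞ := ENNReal.natCast_ne_top n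
  have : IsFiniteMeasure ((n : ℝ≥0∞) • μ) := ⟨by
    simpa using hc.lt_top⟩
  rw [integral_prod_swap_of_symm h.symm (∑ i, Measure.dirac (x i)) ((n : ℝ≥0∞) • μ),
    integral_dirac_sum_prod h.measurable (fun y => integrable_dirac_sum _ x) x,
    integral_dirac_sum_prod h.measurable (fun y => (h.integrable_section y).smul_measure hc) x,
    Measure.prod_smul_right, Measure.prod_smul_left]
  simp only [integral_dirac_sum, integral_smul_measure, ENNReal.toReal_natCast, smul_eq_mul,
    ← Finset.mul_sum]
  ring

end

/-! ### Removing the diagonal, and comparison of `W` with a regular approximation. -/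

variable {X : Type*} [MetricSpace X] [MeasureSpace X] [BorelSpace X]
  [SecondCountableTopology X] {μ : Measure X} [IsProbabilityMeasure μ] [NullSingletonClass μ]
  {W G : X → X → ℝ} {δ C₀ : ℝ}

/-- The kernel `F`, put to zero on the diagonal. -/
noncomputable def offDiag {X : Type*} (F : X → X → ℝ) (x y : X) : ℝ :=
  (diagonal X)ᶜ.indicator (fun z => F z.1 z.2) (x, y)

theorem offDiag_of_ne {X : Type*} {F : X → X → ℝ} {x y : X} (h : x ≠ y) :
    offDiag F x y = F x y := by
  simp [offDiag, h]

theorem offDiag_self {X : Type*} {F : X → X → ℝ} (x : X) : offDiag F x x = 0 := by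
  simp [offDiag]

omit [MeasureSpace X] [BorelSpace X] [SecondCountableTopology X] in
theorem measurable_offDiag [MeasurableSpace X] [BorelSpace X] [SecondCountableTopology X]
    {F : X → X → ℝ} (hF : Measurable fun z : X × X => F z.1 z.2) :
    Measurable fun z : X × X => offDiag F z.1 z.2 :=
  hF.indicator isClosed_diagonal.measurableSet.compl

theorem offDiag_section_ae (F : X → X → ℝ) (x : X) : offDiag F x =ᵐ[μ] F x := by
  have : ∀ᵐ y ∂μ, y ≠ x := by
    rw [ae_iff]
    simp
  filter_upwards [this] with y hy
  exact offDiag_of_ne hy.symm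

theorem offDiag_ae {F : X → X → ℝ} (hF : Measurable fun z : X × X => F z.1 z.2) :
    (fun z : X × X => offDiag F z.1 z.2) =ᵐ[μ.prod μ] fun z => F z.1 z.2 := by
  refine Measure.ae_prod_iff_ae_ae (p := fun z : X × X => offDiag F z.1 z.2 = F z.1 z.2)
    (measurableSet_eq_fun (measurable_offDiag hF) hF) |>.2 ?_
  filter_upwards with x
  exact offDiag_section_ae F x

theorem IsIntegrableKernel.offDiag (h : IsIntegrableKernel W μ) :
    IsIntegrableKernel (offDiag W) μ where
  measurable := measurable_offDiag h.measurable
  symm x y := by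
    rcases eq_or_ne x y with rfl | hxy
    · rfl
    · rw [offDiag_of_ne hxy, offDiag_of_ne hxy.symm, h.symm]
  integrable := h.integrable.congr (offDiag_ae h.measurable).symm
  integrable_section x := (h.integrable_section x).congr (offDiag_section_ae W x).symm

/-- Since `μ` has no atoms, setting the kernel to zero on the diagonal is invisible to every
integral involving `μ`; it only affects the double sum over the Dirac masses. -/
theorem IsIntegrableKernel.fluctuationEnergy_eq (h : IsIntegrableKernel W μ) {n : ℕ}
    (x : Fin n → X) :
    fluctuationEnergy W μ x = 1 / 2 * ((n : ℝ)⁻¹ * ((∑ i, ∑ j, MeanField.offDiag W (x i) (x j))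
        - 2 * n * (∑ i, ∫ y, W (x i) y ∂μ) + (n : ℝ) ^ 2 * ∫ z, W z.1 z.2 ∂(μ.prod μ))) := by
  have := h.offDiag.quadForm_eq x
  rw [integral_congr_ae (offDiag_ae (μ := μ) h.measurable)] at this
  simp only [integral_congr_ae (offDiag_section_ae (μ := μ) W _)] at this
  rw [fluctuationEnergy, quadForm]
  congr 2

/-- `G` is a regular approximation of `W` from below: it is conditionally positive
definite, bounded on the diagonal, and close to `W`. -/
structure IsRegularApprox (W G : X → X → ℝ) (μ : Measure X) (δ C₀ : ℝ) : Prop where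
  measurable : Measurable fun z : X × X => G z.1 z.2
  symm : ∀ x y, G x y = G y x
  nonneg : ∀ ρ σ : Measure X, IsFiniteMeasure ρ → IsFiniteMeasure σ → ρ univ = σ univ →
    Integrable (fun z : X × X => G z.1 z.2) ((ρ + σ).prod (ρ + σ)) → 0 ≤ quadForm G ρ σ
  diag : ∀ x, |G x x| ≤ C₀
  lintegral_abs_le : ∀ x, ∫⁻ y, ENNReal.ofReal |G x y - W x y| ∂μ ≤ ENNReal.ofReal δ
  lintegral_sq_le : ∀ x, ∫⁻ y, ENNReal.ofReal ((G x y - W x y) ^ 2) ∂μ ≤ ENNReal.ofReal δ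
  lower : ∀ x y, x ≠ y → -δ ≤ W x y - G x y

/-- `G x x + G y y - 2 G x y` is the `G`-energy of `δ_x - δ_y`, a squared seminorm. The inequality
is the parallelogram law, obtained by testing positivity on `δ_x + δ_y - 2 δ_z`. -/
theorem IsRegularApprox.triangle (h : IsRegularApprox W G μ δ C₀) (x y z : X) :
    G x x + G y y - 2 * G x y
      ≤ 2 * (G x x + G z z - 2 * G x z) + 2 * (G z z + G y y - 2 * G z y) := by
  have h1 := h.nonneg (∑ i, Measure.dirac (![x, y] i)) (∑ i, Measure.dirac (![z, z] i))
    inferInstance inferInstance (by simp) (by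
      have e : (∑ i, Measure.dirac (![x, y] i)) + (∑ i, Measure.dirac (![z, z] i))
          = ∑ i, Measure.dirac (![x, y, z, z] i) := by
        simp [Fin.sum_univ_succ, add_assoc]
      rw [e]
      exact integrable_dirac_sum_prod h.measurable (fun y => integrable_dirac_sum _ _) _)
  rw [quadForm, integral_dirac_sum_prod h.measurable (fun y => integrable_dirac_sum _ _),
    integral_dirac_sum_prod h.measurable (fun y => integrable_dirac_sum _ _),
    integral_dirac_sum_prod h.measurable (fun y => integrable_dirac_sum _ _),
    integral_dirac_sum_prod h.measurable (fun y => integrable_dirac_sum _ _)] at h1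
  simp only [integral_dirac_sum] at h1
  simp [Fin.sum_univ_succ] at h1
  have := h.symm x y
  have := h.symm x z
  have := h.symm y z
  linarith

theorem IsRegularApprox.integrable_diff (h : IsRegularApprox W G μ δ C₀)
    (hW : Measurable fun z : X × X => W z.1 z.2) (x : X) :
    Integrable (fun y => G x y - W x y) μ := by
  have hm : Measurable fun y => G x y - W x y :=
    (h.measurable.sub hW).comp (measurable_const.prodMk measurable_id)
  refine ⟨hm.aestronglyMeasurable, ?_⟩
  rw [hasFiniteIntegral_iff_norm]
  simp only [Real.norm_eq_abs]
  exact (h.lintegral_abs_le x).trans_lt ENNReal.ofReal_lt_top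

theorem IsRegularApprox.integrable_diff_sq (h : IsRegularApprox W G μ δ C₀)
    (hW : Measurable fun z : X × X => W z.1 z.2) (x : X) :
    Integrable (fun y => (G x y - W x y) ^ 2) μ := by
  have hm : Measurable fun y => (G x y - W x y) ^ 2 :=
    ((h.measurable.sub hW).comp (measurable_const.prodMk measurable_id)).pow_const 2
  refine ⟨hm.aestronglyMeasurable, ?_⟩
  rw [hasFiniteIntegral_iff_norm]
  simp only [Real.norm_eq_abs, abs_sq]
  exact (h.lintegral_sq_le x).trans_lt ENNReal.ofReal_lt_top

/-- Finite energy makes almost every section of `W` integrable, but the empirical measure needs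
every section. One good section `z` suffices: the triangle inequality through `z` controls `G x ·`
by `G z ·` and the bounded diagonal, for each `x`, and `W x ·` then follows since `G - W` has
integrable sections. -/
theorem IsRegularApprox.isIntegrableKernel (h : IsRegularApprox W G μ δ C₀)
    (hW : Measurable fun z : X × X => W z.1 z.2) (hs : ∀ x y, W x y = W y x)
    (hi : Integrable (fun z : X × X => W z.1 z.2) (μ.prod μ)) :
    IsIntegrableKernel W μ ∧ IsIntegrableKernel G μ := by
  have hsec : ∀ x, Integrable (G x) μ := by
    obtain ⟨z, hz⟩ : ∃ z, Integrable (W z) μ := hi.prod_right_ae.exists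
    have hz' : Integrable (G z) μ :=
      (hz.add (h.integrable_diff hW z)).congr (by filter_upwards with y; simp)
    intro x
    have hm : Measurable (G x) := h.measurable.comp (measurable_const.prodMk measurable_id)
    refine Integrable.mono' (g := fun y => C₀ + (|G x x| + 2 * |G x z| + 4 * C₀ + 2 * |G z y|))
      (by fun_prop) hm.aestronglyMeasurable ?_
    filter_upwards with y
    -- The first inequality bounds `G x y` from below. The second, with `z = y`, reduces to
    -- nonnegativity of the squared seminorm and bounds it from above.
    have t1 := h.triangle x y z
    have t2 := h.triangle x y y
    have a1 := abs_le.1 (h.diag x)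
    have a2 := abs_le.1 (h.diag y)
    have a3 := abs_le.1 (h.diag z)
    have b1 := neg_abs_le (G x z)
    have b2 := neg_abs_le (G z y)
    have b3 := le_abs_self (G x z)
    have b4 := le_abs_self (G z y)
    have b5 := abs_nonneg (G x z)
    have b6 := abs_nonneg (G z y)
    have b7 := le_abs_self (G x x)
    have b8 := neg_abs_le (G x x)
    rw [Real.norm_eq_abs, abs_le]
    constructor <;> linarith
  have hWsec : ∀ x, Integrable (W x) μ := fun x =>
    ((hsec x).sub (h.integrable_diff hW x)).congr (by filter_upwards with y; simp)
  refine ⟨⟨hW, hs, hi, hWsec⟩, ⟨h.measurable, h.symm, ?_, hsec⟩⟩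
  have hd : Integrable (fun z : X × X => G z.1 z.2 - W z.1 z.2) (μ.prod μ) := by
    have hm : Measurable fun z : X × X => G z.1 z.2 - W z.1 z.2 := h.measurable.sub hW
    refine ⟨hm.aestronglyMeasurable, ?_⟩
    rw [hasFiniteIntegral_iff_norm, lintegral_prod _ hm.norm.ennreal_ofReal.aemeasurable]
    refine (lintegral_mono (g := fun _ => ENNReal.ofReal δ) fun x => ?_).trans_lt (by simp)
    simpa only [Real.norm_eq_abs] using h.lintegral_abs_le x
  exact (hi.add hd).congr (by filter_upwards with z; simp)

/-- The doubly centred kernel `-2 (R(x,y) - ∫ R(x,·) - ∫ R(·,y) + ∫∫ R)` of the remainder `R`. -/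
noncomputable def centred (R : X → X → ℝ) (μ : Measure X) (x y : X) : ℝ :=
  -2 * (R x y - (∫ z, R x z ∂μ) - (∫ z, R y z ∂μ) + ∫ z', ∫ z, R z' z ∂μ ∂μ)

/-- The off-diagonal remainder `W - G`. -/
noncomputable def remainder (W G : X → X → ℝ) : X → X → ℝ :=
  offDiag fun x y => W x y - G x y

theorem IsRegularApprox.integrable_remainder (h : IsRegularApprox W G μ δ C₀)
    (hW : Measurable fun z : X × X => W z.1 z.2) (x : X) :
    Integrable (remainder W G x) μ ∧ Integrable (fun y => remainder W G x y ^ 2) μ ∧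
      ∫ y, remainder W G x y ^ 2 ∂μ ≤ max δ 0 ∧ |∫ y, remainder W G x y ∂μ| ≤ max δ 0 := by
  have ae : remainder W G x =ᵐ[μ] fun y => W x y - G x y := offDiag_section_ae _ x
  have ae2 : (fun y => remainder W G x y ^ 2) =ᵐ[μ] fun y => (G x y - W x y) ^ 2 := by
    filter_upwards [ae] with y hy
    rw [hy]; ring
  have e := ENNReal.toReal_mono ENNReal.ofReal_ne_top (h.lintegral_abs_le x)
  have e2 := ENNReal.toReal_mono ENNReal.ofReal_ne_top (h.lintegral_sq_le x)
  rw [← integral_eq_lintegral_of_nonneg_ae (ae_of_all _ fun _ => abs_nonneg _)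
    (h.integrable_diff hW x).abs.aestronglyMeasurable, ENNReal.toReal_ofReal'] at e
  rw [← integral_eq_lintegral_of_nonneg_ae (ae_of_all _ fun _ => sq_nonneg _)
    (h.integrable_diff_sq hW x).aestronglyMeasurable, ENNReal.toReal_ofReal'] at e2
  refine ⟨(h.integrable_diff hW x).neg.congr ?_, (h.integrable_diff_sq hW x).congr ae2.symm,
    ?_, ?_⟩
  · filter_upwards [ae] with y hy
    rw [hy]; simp
  · rwa [integral_congr_ae ae2]
  · rw [integral_congr_ae ae]
    refine (abs_integral_le_integral_abs).trans ?_
    simpa only [abs_sub_comm] using e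

/-- The factor `-2` turns the lower bound `R ≥ -δ` into the upper bound `8 δ ≤ 1/2`; the `L²` bound
is `16 δ + 48 δ² ≤ 1/64`. On the diagonal `R = 0`, so the lower bound persists there. -/
theorem IsRegularApprox.isCentredKernel (h : IsRegularApprox W G μ δ C₀)
    (hW : Measurable fun z : X × X => W z.1 z.2) (hs : ∀ x y, W x y = W y x) (hδ : 0 ≤ δ)
    (hδ1 : δ ≤ 1 / 4096) :
    IsCentredKernel μ (centred (remainder W G) μ) (1 / 64) (1 / 2) := by
  set R := remainder W G with hR
  have hRm : Measurable fun z : X × X => R z.1 z.2 := measurable_offDiag (hW.sub h.measurable)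
  have hRs : ∀ x y, R x y = R y x := fun x y => by
    rcases eq_or_ne x y with rfl | hxy
    · rfl
    · rw [hR, remainder, offDiag_of_ne hxy, offDiag_of_ne hxy.symm, hs, h.symm]
  set R1 : X → ℝ := fun x => ∫ z, R x z ∂μ with hR1
  have hR1m : Measurable R1 := (hRm.stronglyMeasurable.integral_prod_right (ν := μ)).measurable
  set R0 : ℝ := ∫ z, R1 z ∂μ with hR0
  have key := h.integrable_remainder hW
  simp only [max_eq_left hδ, ← hR] at key
  have hR1b : ∀ x, |R1 x| ≤ δ := fun x => (key x).2.2.2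
  have hR1i : Integrable R1 μ := Integrable.of_bound hR1m.aestronglyMeasurable δ
    (ae_of_all _ hR1b)
  have hR0b : |R0| ≤ δ := by
    refine abs_integral_le_integral_abs.trans ?_
    calc ∫ a, |R1 a| ∂μ ≤ ∫ _a, δ ∂μ := integral_mono hR1i.abs (integrable_const _) hR1b
      _ = δ := by simp
  have hc : ∀ x y, centred R μ x y = -2 * (R x y - R1 x - R1 y + R0) := fun x y => rfl
  have hcm : Measurable fun z : X × X => centred R μ z.1 z.2 :=
    (((hRm.sub (hR1m.comp measurable_fst)).sub (hR1m.comp measurable_snd)).add_const _).const_mul _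
  have hsq : ∀ x y, centred R μ x y ^ 2 ≤ 16 * R x y ^ 2 + 48 * δ ^ 2 := by
    intro x y
    rw [hc]
    have a1 : R1 x ^ 2 ≤ δ ^ 2 :=
      sq_le_sq' (by linarith [(abs_le.1 (hR1b x)).1]) (abs_le.1 (hR1b x)).2
    have a2 : R1 y ^ 2 ≤ δ ^ 2 :=
      sq_le_sq' (by linarith [(abs_le.1 (hR1b y)).1]) (abs_le.1 (hR1b y)).2
    have a3 : R0 ^ 2 ≤ δ ^ 2 := sq_le_sq' (by linarith [(abs_le.1 hR0b).1]) (abs_le.1 hR0b).2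
    nlinarith [sq_nonneg (R x y + R1 x), sq_nonneg (R x y + R1 y), sq_nonneg (R x y - R0),
      sq_nonneg (R1 x - R1 y), sq_nonneg (R1 x + R0), sq_nonneg (R1 y + R0)]
  have hbi : ∀ x, Integrable (fun y => 16 * R x y ^ 2 + 48 * δ ^ 2) μ := fun x =>
    ((key x).2.1.const_mul 16).add (integrable_const _)
  have hsqi : ∀ x, Integrable (fun y => centred R μ x y ^ 2) μ := by
    intro x
    refine (hbi x).mono' ((hcm.comp (measurable_const.prodMk measurable_id)).pow_const 2
      ).aestronglyMeasurable ?_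
    filter_upwards with y
    rw [Real.norm_eq_abs, abs_sq]
    exact hsq x y
  refine ⟨hcm, fun x y => ?_, fun x y => ?_, hsqi, fun x => ?_, fun x => ?_⟩
  · rw [hc, hc, hRs]; ring
  · have hl : -δ ≤ R x y := by
      rcases eq_or_ne x y with rfl | hxy
      · rw [hR, remainder, offDiag_self]; linarith
      · rw [hR, remainder, offDiag_of_ne hxy]; exact h.lower x y hxy
    rw [hc]
    linarith [(abs_le.1 (hR1b x)).2, (abs_le.1 (hR1b y)).2, (abs_le.1 hR0b).1]
  · calc ∫ y, centred R μ x y ^ 2 ∂μ ≤ ∫ y, (16 * R x y ^ 2 + 48 * δ ^ 2) ∂μ :=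
          integral_mono (hsqi x) (hbi x) (hsq x)
      _ = 16 * (∫ y, R x y ^ 2 ∂μ) + 48 * δ ^ 2 := by
          rw [integral_add ((key x).2.1.const_mul 16) (integrable_const _), integral_const_mul]
          simp
      _ ≤ 1 / 64 := by
          have := (key x).2.2.1
          nlinarith
  · simp only [hc]
    rw [integral_const_mul, integral_add (f := fun y => R x y - R1 x - R1 y)
      (((key x).1.sub (integrable_const _)).sub hR1i) (integrable_const _),
      integral_sub (f := fun y => R x y - R1 x) ((key x).1.sub (integrable_const _)) hR1i,
      integral_sub (key x).1 (integrable_const _)]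
    simp [hR0, hR1]

/-- The energy splits into a `G`-part, a deleted `G`-diagonal and an `R`-part. The first has a
favourable sign, the second gives `C₀`, and the third is the centred pair sum up to marginal terms.
Injectivity lets "off the diagonal of `X²`" be read as `i ≠ j`. -/
theorem IsRegularApprox.neg_two_fluctuationEnergy_le (h : IsRegularApprox W G μ δ C₀)
    (hW : Measurable fun z : X × X => W z.1 z.2) (hs : ∀ x y, W x y = W y x)
    (hi : Integrable (fun z : X × X => W z.1 z.2) (μ.prod μ)) (hδ : 0 ≤ δ) {N : ℕ} (hN : 1 ≤ N)
    {x : Fin N → X} (hx : Function.Injective x) :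
    -2 * fluctuationEnergy W μ x
      ≤ 1 / (N : ℝ) * pairSum (centred (remainder W G) μ) N x + (C₀ + 3 * δ) := by
  obtain ⟨kW, kG⟩ := h.isIntegrableKernel hW hs hi
  have hN0 : (0 : ℝ) < N := by exact_mod_cast hN
  set R := remainder W G with hR
  set R1 : X → ℝ := fun x => ∫ z, R x z ∂μ with hR1
  set R0 : ℝ := ∫ z, R1 z ∂μ with hR0
  have key := h.integrable_remainder hW
  simp only [max_eq_left hδ] at key
  have hR1b : ∀ x, |R1 x| ≤ δ := fun x => (key x).2.2.2
  have hR0b : |R0| ≤ δ := by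
    have := norm_integral_le_of_norm_le_const (μ := μ) (f := R1) (C := δ) (ae_of_all _ hR1b)
    simpa using this
  have hRs : ∀ x y, R x y = R y x := fun x y => by
    rcases eq_or_ne x y with rfl | hxy
    · rfl
    · rw [hR, remainder, offDiag_of_ne hxy, offDiag_of_ne hxy.symm, hs, h.symm]
  have hcs : ∀ x y, centred R μ x y = centred R μ y x := fun x y => by
    rw [centred, centred, hRs]; ring
  set G1 : X → ℝ := fun x => ∫ z, G x z ∂μ with hG1
  have hW1 : ∀ x, ∫ y, W x y ∂μ = R1 x + G1 x := fun x => by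
    have e : R1 x = ∫ y, W x y - G x y ∂μ :=
      integral_congr_ae (offDiag_section_ae (μ := μ) (fun x y => W x y - G x y) x)
    rw [e, integral_sub (kW.integrable_section x) (kG.integrable_section x)]
    ring
  have hR1i : Integrable R1 μ := by
    have hRm : Measurable fun z : X × X => R z.1 z.2 := measurable_offDiag (hW.sub h.measurable)
    exact Integrable.of_bound
      (hRm.stronglyMeasurable.integral_prod_right (ν := μ)).aestronglyMeasurable δ
      (ae_of_all _ hR1b)
  have hG1i : Integrable G1 μ := kG.integrable.integral_prod_left
  have hW0 : ∫ z, W z.1 z.2 ∂(μ.prod μ) = R0 + ∫ z, G z.1 z.2 ∂(μ.prod μ) := by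
    rw [integral_prod _ hi, integral_prod _ kG.integrable]
    simp only [hW1]
    rw [integral_add hR1i hG1i]
  -- H-stability for `∑ δ_{x_i} - N μ`, with the diagonal included.
  have hq := h.nonneg (∑ i, Measure.dirac (x i)) ((N : ℝ≥0∞) • μ) inferInstance
    ⟨by simp⟩ (by simp)
    (kG.integrable_empirical x _ (ENNReal.natCast_ne_top N))
  rw [quadForm, kG.quadForm_eq x] at hq
  rw [kW.fluctuationEnergy_eq x, hW0]
  simp only [hW1, Finset.sum_add_distrib]
  have hcard : ∀ f : Fin N → ℝ, ∑ i, ∑ j, (if i ≠ j then f i else 0) = (N - 1) * ∑ i, f i := by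
    intro f
    rw [Finset.mul_sum]
    refine Finset.sum_congr rfl fun i _ => ?_
    have : ∀ j, (if i ≠ j then f i else 0) = f i - if i = j then f i else 0 := fun j => by
      split_ifs <;> simp_all
    simp only [this, Finset.sum_sub_distrib, Finset.sum_const, Finset.card_univ,
      Fintype.card_fin, nsmul_eq_mul, Finset.sum_ite_eq, Finset.mem_univ, if_true]
    ring
  have hcard' : ∀ f : Fin N → ℝ, ∑ i, ∑ j, (if i ≠ j then f j else 0) = (N - 1) * ∑ i, f i := by
    intro f
    rw [Finset.sum_comm, ← hcard f]
    simp only [ne_comm]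
  have hoff : ∀ F : X → X → ℝ, ∑ i, ∑ j, MeanField.offDiag F (x i) (x j)
      = ∑ i, ∑ j, if i ≠ j then F (x i) (x j) else 0 := fun F => by
    refine Finset.sum_congr rfl fun i _ => Finset.sum_congr rfl fun j _ => ?_
    split_ifs with hij
    · exact offDiag_of_ne (hx.ne hij)
    · rw [not_not.1 hij, offDiag_self]
  have hWRG : ∑ i, ∑ j, MeanField.offDiag W (x i) (x j)
      = (∑ i, ∑ j, R (x i) (x j)) + (∑ i, ∑ j, G (x i) (x j)) - ∑ i, G (x i) (x i) := by
    rw [← Finset.sum_add_distrib, ← Finset.sum_sub_distrib]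
    refine Finset.sum_congr rfl fun i _ => ?_
    have : G (x i) (x i) = ∑ j, if i = j then G (x i) (x j) else 0 := by simp
    rw [← Finset.sum_add_distrib, this, ← Finset.sum_sub_distrib]
    refine Finset.sum_congr rfl fun j _ => ?_
    rcases eq_or_ne i j with rfl | hij
    · simp [hR, remainder, offDiag_self]
    · rw [hR, remainder, offDiag_of_ne (hx.ne hij), offDiag_of_ne (hx.ne hij)]
      simp [hij]
  have hpair : 2 * pairSum (centred R μ) N x
      = -2 * ((∑ i, ∑ j, R (x i) (x j)) - 2 * (N - 1) * (∑ i, R1 (x i)) + N * (N - 1) * R0) := by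
    rw [pairSum_eq hcs]
    have e : ∀ i j, (if i ≠ j then centred R μ (x i) (x j) else 0)
        = -2 * (R (x i) (x j) - (if i ≠ j then R1 (x i) else 0) - (if i ≠ j then R1 (x j) else 0)
          + if i ≠ j then R0 else 0) := fun i j => by
      rcases eq_or_ne i j with rfl | hij
      · simp [hR, remainder, offDiag_self]
      · simp only [hij, ne_eq, not_false_eq_true, if_true]; rfl
    simp only [e, ← Finset.mul_sum, Finset.sum_add_distrib, Finset.sum_sub_distrib]
    rw [hcard (fun i => R1 (x i)), hcard' (fun i => R1 (x i)), hcard (fun _ => R0)]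
    simp only [Finset.sum_const, Finset.card_univ, Fintype.card_fin, nsmul_eq_mul]
    ring
  have hdiag : ∑ i, G (x i) (x i) ≤ N * C₀ := by
    calc ∑ i, G (x i) (x i) ≤ ∑ _i : Fin N, C₀ :=
          Finset.sum_le_sum fun i _ => (abs_le.1 (h.diag _)).2
      _ = N * C₀ := by simp
  have hR1s : ∑ i, R1 (x i) ≤ N * δ := by
    calc ∑ i, R1 (x i) ≤ ∑ _i : Fin N, δ :=
          Finset.sum_le_sum fun i _ => (abs_le.1 (hR1b _)).2
      _ = N * δ := by simp
  have hp : pairSum (centred R μ) N x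
      = -((∑ i, ∑ j, R (x i) (x j)) - 2 * (N - 1) * (∑ i, R1 (x i)) + N * (N - 1) * R0) := by
    linarith
  rw [hWRG, hp]
  have hR0' : -R0 ≤ δ := by linarith [(abs_le.1 hR0b).1]
  -- Origin of `3 δ`: the energy weighs `R1` by `2 N` and `R0` by `N²`, centring the `N (N - 1)`
  -- ordered pairs uses only `2 (N - 1)` and `N (N - 1)`. The excess is `2 ∑ R1 - N R0 ≤ 3 N δ`.
  have hfin : -((∑ i, ∑ j, R (x i) (x j)) + (∑ i, ∑ j, G (x i) (x j)) - (∑ i, G (x i) (x i))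
      - 2 * N * (∑ i, R1 (x i) + ∑ i, G1 (x i)) + (N : ℝ) ^ 2 * (R0 + ∫ z, G z.1 z.2 ∂(μ.prod μ)))
      ≤ -((∑ i, ∑ j, R (x i) (x j)) - 2 * (N - 1) * (∑ i, R1 (x i)) + N * (N - 1) * R0)
        + N * (C₀ + 3 * δ) := by
    nlinarith [mul_le_mul_of_nonneg_left hR0' hN0.le]
  have := mul_le_mul_of_nonneg_left hfin (inv_nonneg.2 hN0.le)
  have e3 : (N : ℝ)⁻¹ * (N * (C₀ + 3 * δ)) = C₀ + 3 * δ := by field_simp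
  rw [mul_add _ _ ((N : ℝ) * (C₀ + 3 * δ)), e3] at this
  rw [one_div (N : ℝ)]
  linarith

-- The renormalised energy omits the diagonal of `X²` while the Hamiltonian omits equal indices; the
-- two conventions agree at configurations without coincidences.
omit [MeasureSpace X] [BorelSpace X] [SecondCountableTopology X] in
theorem ae_injective_pi [MeasurableSpace X] [BorelSpace X] [SecondCountableTopology X]
    (ν : Measure X) [SigmaFinite ν] [NullSingletonClass ν] (N : ℕ) :
    ∀ᵐ x : Fin N → X ∂(Measure.pi fun _ => ν), Function.Injective x := by
  have key : ∀ i j : Fin N, i ≠ j → ∀ᵐ x : Fin N → X ∂(Measure.pi fun _ => ν), x i ≠ x j := by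
    intro i j hij
    cases N with
    | zero => exact i.elim0
    | succ n =>
      obtain ⟨k, rfl⟩ := Fin.exists_succAbove_eq hij.symm
      have hm : MeasurableSet {p : X × (Fin n → X) | p.1 = p.2 k} :=
        measurableSet_eq_fun measurable_fst ((measurable_pi_apply k).comp measurable_snd)
      have h0 : (ν.prod (Measure.pi fun _ : Fin n => ν)) {p | p.1 = p.2 k} = 0 := by
        rw [Measure.prod_apply_symm hm]
        simp [Set.preimage]
      have := (measurePreserving_piFinSuccAbove (fun _ : Fin (n + 1) => ν) i).measure_preimage
        hm.nullMeasurableSet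
      rw [h0] at this
      rw [ae_iff]
      simpa [Set.preimage, MeasurableEquiv.piFinSuccAbove, Fin.insertNthEquiv, Fin.removeNth]
        using this
  have : ∀ᵐ x : Fin N → X ∂(Measure.pi fun _ => ν), ∀ i j : Fin N, i ≠ j → x i ≠ x j := by
    refine ae_all_iff.2 fun i => ae_all_iff.2 fun j => ?_
    by_cases hij : i = j
    · simp [hij]
    · filter_upwards [key i j hij] with x hx _ using hx
  filter_upwards [this] with x hx i j hij
  by_contra hne
  exact hx i j hne hij

/-- Uniform bound of the square-exponential moment of the renormalised energy. -/
theorem IsRegularApprox.lintegral_exp_le (h : IsRegularApprox W G μ δ C₀)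
    (hW : Measurable fun z : X × X => W z.1 z.2) (hs : ∀ x y, W x y = W y x)
    (hi : Integrable (fun z : X × X => W z.1 z.2) (μ.prod μ)) (hδ : 0 ≤ δ)
    (hδ1 : δ ≤ 1 / 4096) {N : ℕ} (hN : 1 ≤ N) :
    ∫⁻ x : Fin N → X, ENNReal.ofReal (Real.exp (-2 * fluctuationEnergy W μ x))
        ∂(Measure.pi fun _ => μ) ≤ ENNReal.ofReal (Real.exp (1 / 16 + (C₀ + 3 * δ))) := by
  have hk := h.isCentredKernel hW hs hδ hδ1
  -- With `s = 1/64` the bound `exp(4 s)` is the `1/16` of the statement.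
  have h1 := hk.lintegral_exp_pairSum le_rfl le_rfl hN
  calc ∫⁻ x : Fin N → X, ENNReal.ofReal (Real.exp (-2 * fluctuationEnergy W μ x))
        ∂(Measure.pi fun _ => μ)
      ≤ ∫⁻ x : Fin N → X, ENNReal.ofReal (Real.exp (C₀ + 3 * δ)) * ENNReal.ofReal (Real.exp
          (1 / (N : ℝ) * pairSum (centred (remainder W G) μ) N x))
        ∂(Measure.pi fun _ => μ) := by
        refine lintegral_mono_ae ?_
        filter_upwards [ae_injective_pi μ N] with x hx
        rw [← ENNReal.ofReal_mul (Real.exp_pos _).le, ← Real.exp_add, add_comm (C₀ + 3 * δ)]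
        exact ENNReal.ofReal_le_ofReal (Real.exp_le_exp.2
          (h.neg_two_fluctuationEnergy_le hW hs hi hδ hN hx))
    _ ≤ _ := by
        rw [lintegral_const_mul' _ _ ENNReal.ofReal_ne_top]
        refine (mul_le_mul_right h1 _).trans ?_
        rw [← ENNReal.ofReal_mul (Real.exp_pos _).le, ← Real.exp_add]
        refine ENNReal.ofReal_le_ofReal (Real.exp_le_exp.2 ?_)
        linarith

/-- The renormalised energy is bounded below for each number of particles. -/
theorem IsRegularApprox.neg_fluctuationEnergy_le (h : IsRegularApprox W G μ δ C₀)
    (hW : Measurable fun z : X × X => W z.1 z.2) (hs : ∀ x y, W x y = W y x)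
    (hi : Integrable (fun z : X × X => W z.1 z.2) (μ.prod μ)) (hδ : 0 ≤ δ)
    (hδ1 : δ ≤ 1 / 4096) {N : ℕ} (hN : 1 ≤ N) :
    ∃ B : ℝ, ∀ᵐ x : Fin N → X ∂(Measure.pi fun _ => μ), -fluctuationEnergy W μ x ≤ B := by
  have hk := h.isCentredKernel hW hs hδ hδ1
  have hN0 : (0 : ℝ) < N := by exact_mod_cast hN
  -- This bound grows with `N`. It only serves to make the density of the Gibbs measure bounded for
  -- each `N`, and does not enter the final constants.
  refine ⟨(1 / (N : ℝ) * (N * N) + (C₀ + 3 * δ)) / 2, ?_⟩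
  filter_upwards [ae_injective_pi μ N] with x hx
  have h1 := h.neg_two_fluctuationEnergy_le hW hs hi hδ hN hx
  have h2 : pairSum (centred (remainder W G) μ) N x ≤ N * N := by
    have h3 := pairSum_eq hk.symm N x
    have h4 : (∑ i, ∑ j, if i ≠ j then centred (remainder W G) μ (x i) (x j) else 0)
        ≤ ∑ _i : Fin N, ∑ _j : Fin N, (1 : ℝ) := by
      refine Finset.sum_le_sum fun i _ => Finset.sum_le_sum fun j _ => ?_
      split_ifs
      · exact (hk.le _ _).trans (by norm_num)
      · norm_num
    simp only [Finset.sum_const, Finset.card_univ, Fintype.card_fin, nsmul_eq_mul, mul_one] at h4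
    nlinarith
  have h5 := mul_le_mul_of_nonneg_left h2 (by positivity : 0 ≤ 1 / (N : ℝ))
  linarith

theorem IsIntegrableKernel.measurable_fluctuationEnergy (h : IsIntegrableKernel W μ) (N : ℕ) :
    Measurable fun x : Fin N → X => fluctuationEnergy W μ x := by
  simp only [h.fluctuationEnergy_eq]
  have h1 : Measurable fun x => ∫ y, W x y ∂μ :=
    (h.measurable.stronglyMeasurable.integral_prod_right (ν := μ)).measurable
  have h2 : ∀ i j : Fin N, Measurable fun x : Fin N → X => MeanField.offDiag W (x i) (x j) :=
    fun i j => by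
      have hm : Measurable fun x : Fin N → X => (x i, x j) :=
        (measurable_pi_apply i).prodMk (measurable_pi_apply j)
      exact h.offDiag.measurable.comp hm
  have h3 : ∀ i : Fin N, Measurable fun x : Fin N → X => ∫ y, W (x i) y ∂μ := fun i =>
    h1.comp (measurable_pi_apply i)
  have h4 : Measurable fun x : Fin N → X => ∑ i, ∑ j, MeanField.offDiag W (x i) (x j) :=
    Finset.measurable_sum _ fun i _ => Finset.measurable_sum _ fun j _ => h2 i j
  have h5 : Measurable fun x : Fin N → X => ∑ i, ∫ y, W (x i) y ∂μ :=
    Finset.measurable_sum _ fun i _ => h3 i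
  exact ((((h4.sub (h5.const_mul _)).add_const _).const_mul _).const_mul _)

end Fluctuation


/-! ### The Euler–Lagrange equation of the minimiser -/

section EulerLagrange

variable {X : Type*} [MetricSpace X] [MeasureSpace X] [BorelSpace X]
  [SecondCountableTopology X] [SigmaFinite (volume : Measure X)]
  {μ : Measure X} {V : X → ℝ} {W : X → X → ℝ}

/-- The value of the energy of a measure all of whose energy terms are finite. -/
noncomputable def energyValue (V : X → ℝ) (W : X → X → ℝ) (ρ : Measure X) : ℝ :=
  (∫ x, (ρ.rnDeriv volume x).toReal * Real.log (ρ.rnDeriv volume x).toReal)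
    + (∫ x, V x ∂ρ) + (1 / 2) * ∫ z, W z.1 z.2 ∂(ρ.prod ρ)

theorem energy_eq_energyValue {ρ : Measure X} (h : HasFiniteEnergy V W ρ) :
    energy V W ρ = energyValue V W ρ := if_pos h

theorem IsUniqueMinimiser.hasFiniteEnergy (h : IsUniqueMinimiser V W μ) :
    HasFiniteEnergy V W μ := by
  by_contra hf
  have := h.2.1
  rw [energy, if_neg hf] at this
  exact lt_irrefl _ this

theorem IsUniqueMinimiser.energyValue_le (h : IsUniqueMinimiser V W μ) {ρ : Measure X}
    (hρ : IsP2 ρ) (hf : HasFiniteEnergy V W ρ) : energyValue V W μ ≤ energyValue V W ρ := by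
  rcases eq_or_ne ρ μ with rfl | hne
  · exact le_rfl
  · have := (h.2.2 ρ hρ hne).le
    rw [energy_eq_energyValue hf, energy_eq_energyValue h.hasFiniteEnergy] at this
    exact_mod_cast this

theorem rnDeriv_withDensity_toReal {f : X → ℝ} (hf : Measurable f) (h0 : ∀ x, 0 ≤ f x) :
    (fun x => (((volume : Measure X).withDensity fun x => ENNReal.ofReal (f x)).rnDeriv
      volume x).toReal) =ᵐ[volume] f := by
  filter_upwards [Measure.rnDeriv_withDensity volume hf.ennreal_ofReal] with x hx
  rw [hx, ENNReal.toReal_ofReal (h0 x)]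

theorem withDensity_toReal_rnDeriv [IsFiniteMeasure μ] (h : μ ≪ volume) :
    (volume : Measure X).withDensity (fun x => ENNReal.ofReal (μ.rnDeriv volume x).toReal) = μ := by
  rw [← Measure.withDensity_rnDeriv_eq μ volume h]
  refine withDensity_congr_ae ?_
  rw [Measure.withDensity_rnDeriv_eq μ volume h]
  filter_upwards [Measure.rnDeriv_lt_top μ volume] with x hx
  rw [ENNReal.ofReal_toReal hx.ne]

omit [SigmaFinite (volume : Measure X)] in
theorem integrable_integral_mix {ρ σ : Measure X} [IsFiniteMeasure ρ] [IsFiniteMeasure σ]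
    (hs : ∀ x y, W x y = W y x)
    (h1 : Integrable (fun z : X × X => W z.1 z.2) (ρ.prod ρ))
    (h2 : Integrable (fun z : X × X => W z.1 z.2) (ρ.prod σ))
    (h3 : Integrable (fun z : X × X => W z.1 z.2) (σ.prod σ)) {a b : ℝ} (ha : 0 ≤ a)
    (hb : 0 ≤ b) :
    Integrable (fun z : X × X => W z.1 z.2) ((ENNReal.ofReal a • ρ + ENNReal.ofReal b • σ).prod
      (ENNReal.ofReal a • ρ + ENNReal.ofReal b • σ)) ∧
    ∫ z, W z.1 z.2 ∂((ENNReal.ofReal a • ρ + ENNReal.ofReal b • σ).prod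
      (ENNReal.ofReal a • ρ + ENNReal.ofReal b • σ))
      = a ^ 2 * (∫ z, W z.1 z.2 ∂(ρ.prod ρ)) + 2 * a * b * (∫ z, W z.1 z.2 ∂(ρ.prod σ))
        + b ^ 2 * ∫ z, W z.1 z.2 ∂(σ.prod σ) := by
  have h2' := integrable_prod_swap_of_symm hs h2
  have e2 := integral_prod_swap_of_symm hs ρ σ
  have ka : ENNReal.ofReal a ≠ ∞ := ENNReal.ofReal_ne_top
  have kb : ENNReal.ofReal b ≠ ∞ := ENNReal.ofReal_ne_top
  have i1 := h1.smul_measure ka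
  have i2 := h2.smul_measure ka
  have i2' := h2'.smul_measure kb
  have i3 := h3.smul_measure kb
  have j1 := (i1.add_measure i2').smul_measure ka
  have j2 := (i2.add_measure i3).smul_measure kb
  simp only [Measure.prod_add, Measure.add_prod, Measure.prod_smul_left, Measure.prod_smul_right]
  refine ⟨j1.add_measure j2, ?_⟩
  rw [integral_add_measure j1 j2, integral_smul_measure, integral_smul_measure,
    integral_add_measure i1 i2', integral_add_measure i2 i3]
  simp only [integral_smul_measure, ENNReal.toReal_ofReal ha, ENNReal.toReal_ofReal hb, e2,
    smul_eq_mul]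
  ring

theorem mul_log_one_sub_nonpos {t : ℝ} (h0 : 0 < t) (h1 : t < 1) :
    (1 - t) * Real.log (1 - t) ≤ 0 :=
  mul_nonpos_of_nonneg_of_nonpos (by linarith) (Real.log_nonpos (by linarith) (by linarith))

/-- Mixing in a little mass on a small set where the density vanishes lowers the energy. -/
theorem IsUniqueMinimiser.volume_eq_zero_of_rnDeriv_eq_zero (h : IsUniqueMinimiser V W μ)
    (hV : Measurable V) (kW : IsIntegrableKernel W μ) {B : Set X} (hB : MeasurableSet B)
    (hBfin : volume B ≠ ∞) (hB0 : ∀ x ∈ B, μ.rnDeriv volume x = 0) {n : ℝ}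
    (hBV : ∀ x ∈ B, |V x| ≤ n) (hBW : ∀ x ∈ B, ∫ y, |W x y| ∂μ ≤ n)
    (hBi : IntegrableOn (fun z : X × X => W z.1 z.2) (B ×ˢ B))
    {x₁ : X} (hBb : B ⊆ Metric.ball x₁ 1) : volume B = 0 := by
  by_contra hpos
  have hμP := h.1.1
  obtain ⟨hac, hent, hVi, hWi⟩ := h.hasFiniteEnergy
  set ρ : X → ℝ := fun x => (μ.rnDeriv volume x).toReal with hρ
  have hρm : Measurable ρ := (Measure.measurable_rnDeriv _ _).ennreal_toReal
  have hρ0 : ∀ x, 0 ≤ ρ x := fun x => ENNReal.toReal_nonneg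
  set v : ℝ := volume.real B with hv
  have hv0 : 0 < v := ENNReal.toReal_pos hpos hBfin
  set f : X → ℝ := B.indicator fun _ => v⁻¹ with hf
  have hfm : Measurable f := measurable_const.indicator hB
  have hf0 : ∀ x, 0 ≤ f x := fun x => indicator_nonneg (fun _ _ => (inv_pos.2 hv0).le) x
  set ν : Measure X := ENNReal.ofReal v⁻¹ • volume.restrict B with hν
  have hvol : volume B = ENNReal.ofReal v := (ENNReal.ofReal_toReal hBfin).symm
  have hνP : IsProbabilityMeasure ν := ⟨by
    rw [hν, Measure.smul_apply, Measure.restrict_apply_univ, hvol, smul_eq_mul,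
      ← ENNReal.ofReal_mul (inv_pos.2 hv0).le, inv_mul_cancel₀ hv0.ne', ENNReal.ofReal_one]⟩
  have hνd : ν = volume.withDensity fun x => ENNReal.ofReal (f x) := by
    have : (fun x => ENNReal.ofReal (f x)) = B.indicator fun _ => ENNReal.ofReal v⁻¹ := by
      ext x
      by_cases hx : x ∈ B <;> simp [hf, hx]
    rw [this, withDensity_indicator hB, withDensity_const]
  have hνB : ∀ᵐ x ∂ν, x ∈ B := Measure.ae_smul_measure (ae_restrict_mem hB) _
  have hVν : Integrable V ν := by
    refine Integrable.of_bound hV.aestronglyMeasurable n ?_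
    filter_upwards [hνB] with x hx using hBV x hx
  have hWm := kW.measurable
  have hWνμ : Integrable (fun z : X × X => W z.1 z.2) (ν.prod μ) := by
    refine (integrable_prod_iff hWm.aestronglyMeasurable).2
      ⟨ae_of_all _ fun x => kW.integrable_section x, ?_⟩
    refine Integrable.of_bound
      (hWm.norm.stronglyMeasurable.integral_prod_right (ν := μ)).aestronglyMeasurable n ?_
    filter_upwards [hνB] with x hx
    rw [Real.norm_of_nonneg (integral_nonneg fun _ => norm_nonneg _)]
    exact hBW x hx
  have hWνν : Integrable (fun z : X × X => W z.1 z.2) (ν.prod ν) := by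
    rw [hν, Measure.prod_smul_left, Measure.prod_smul_right, Measure.prod_restrict]
    exact (Integrable.smul_measure hBi ENNReal.ofReal_ne_top).smul_measure ENNReal.ofReal_ne_top
  have hWμν := integrable_prod_swap_of_symm kW.symm hWνμ
  set Ent := ∫ x, ρ x * Real.log (ρ x) with hEnt
  set wμμ := ∫ z, W z.1 z.2 ∂(μ.prod μ)
  set wμν := ∫ z, W z.1 z.2 ∂(μ.prod ν)
  set wνν := ∫ z, W z.1 z.2 ∂(ν.prod ν)
  set vμ := ∫ x, V x ∂μ
  set vν := ∫ x, V x ∂ν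
  -- Minimality against `(1 - t) μ + t ν`, with `ν` uniform on `B`. The densities have disjoint
  -- supports, so the entropies separate; the contribution `(1 - t) log (1 - t) ≤ 0` is dropped.
  have key : ∀ t : ℝ, 0 < t → t < 1 → 0 ≤ -t * Ent + (t * Real.log t + t * Real.log v⁻¹)
      + t * (vν - vμ) + 1 / 2 * (((1 - t) ^ 2 - 1) * wμμ + 2 * (1 - t) * t * wμν
        + t ^ 2 * wνν) := by
    intro t ht0 ht1
    have ht1' : 0 ≤ 1 - t := by linarith
    set σ : Measure X := ENNReal.ofReal (1 - t) • μ + ENNReal.ofReal t • ν with hσ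
    have hσP : IsProbabilityMeasure σ := ⟨by
      simp only [hσ, Measure.add_apply, Measure.smul_apply, measure_univ, smul_eq_mul, mul_one]
      rw [← ENNReal.ofReal_add ht1' ht0.le]
      simp⟩
    have hg0 : ∀ x, 0 ≤ (1 - t) * ρ x + t * f x := fun x =>
      add_nonneg (mul_nonneg ht1' (hρ0 x)) (mul_nonneg ht0.le (hf0 x))
    have hgm : Measurable fun x => (1 - t) * ρ x + t * f x :=
      (hρm.const_mul _).add (hfm.const_mul _)
    have hσd : σ = volume.withDensity fun x => ENNReal.ofReal ((1 - t) * ρ x + t * f x) := by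
      have e : (fun x => ENNReal.ofReal ((1 - t) * ρ x + t * f x))
          = (ENNReal.ofReal (1 - t) • fun x => ENNReal.ofReal (ρ x))
            + (ENNReal.ofReal t • fun x => ENNReal.ofReal (f x)) := by
        ext x
        simp only [Pi.add_apply, Pi.smul_apply, smul_eq_mul]
        rw [ENNReal.ofReal_add (mul_nonneg ht1' (hρ0 x)) (mul_nonneg ht0.le (hf0 x)),
          ENNReal.ofReal_mul ht1', ENNReal.ofReal_mul ht0.le]
      rw [e, withDensity_add_left (hρm.ennreal_ofReal.const_smul _),
        withDensity_smul _ hρm.ennreal_ofReal, withDensity_smul _ hfm.ennreal_ofReal,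
        ← hνd, withDensity_toReal_rnDeriv hac]
    have hσrn := rnDeriv_withDensity_toReal hgm hg0
    rw [← hσd] at hσrn
    have hpt : (fun x => (σ.rnDeriv volume x).toReal * Real.log (σ.rnDeriv volume x).toReal)
        =ᵐ[volume] fun x => (1 - t) * (ρ x * Real.log (ρ x)) + (1 - t) * Real.log (1 - t) * ρ x
          + B.indicator (fun _ => t * v⁻¹ * Real.log (t * v⁻¹)) x := by
      filter_upwards [hσrn] with x hx
      rw [hx]
      by_cases hxB : x ∈ B
      · have : ρ x = 0 := by simp [hρ, hB0 x hxB]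
        simp [this, hf, hxB]
      · simp only [hf, hxB, not_false_eq_true, indicator_of_notMem, mul_zero, add_zero]
        rcases (hρ0 x).eq_or_lt with h0 | h0
        · simp [← h0]
        · rw [Real.log_mul (by linarith) h0.ne']
          ring
    have hρi : Integrable ρ := Measure.integrable_toReal_rnDeriv
    have hρ1 : ∫ x, ρ x = 1 := by
      simp only [hρ]
      rw [Measure.integral_toReal_rnDeriv hac]
      simp
    have hindi : Integrable (B.indicator (fun _ => t * v⁻¹ * Real.log (t * v⁻¹)) : X → ℝ) :=
      (integrable_indicator_iff hB).2 (integrableOn_const hBfin)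
    have hmix := integrable_integral_mix kW.symm hWi hWμν hWνν ht1' ht0.le
    have hVσ : Integrable V σ :=
      (hVi.smul_measure ENNReal.ofReal_ne_top).add_measure (hVν.smul_measure ENNReal.ofReal_ne_top)
    have hfin : HasFiniteEnergy V W σ := by
      refine ⟨hσd ▸ withDensity_absolutelyContinuous _ _, ?_, hVσ, hmix.1⟩
      exact Integrable.congr (((hent.const_mul _).add (hρi.const_mul _)).add hindi) hpt.symm
    have hP2 : IsP2 σ := by
      refine ⟨hσP, fun x₀ => ?_⟩
      rw [hσ, lintegral_add_measure, lintegral_smul_measure, lintegral_smul_measure]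
      refine ENNReal.add_lt_top.2 ⟨ENNReal.mul_lt_top ENNReal.ofReal_lt_top (h.1.2 x₀),
        ENNReal.mul_lt_top ENNReal.ofReal_lt_top ?_⟩
      calc ∫⁻ x, edist x x₀ ^ 2 ∂ν ≤ ∫⁻ _x, (1 + edist x₁ x₀) ^ 2 ∂ν := by
            refine lintegral_mono_ae ?_
            filter_upwards [hνB] with x hx
            have h1 : edist x x₁ ≤ 1 := by
              have := hBb hx
              rw [Metric.mem_ball] at this
              rw [edist_dist]
              exact ENNReal.ofReal_le_one.2 this.le
            gcongr
            exact (edist_triangle x x₁ x₀).trans (by gcongr)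
        _ < ∞ := by
            simp only [lintegral_const, measure_univ, mul_one]
            exact ENNReal.pow_lt_top (ENNReal.add_lt_top.2 ⟨ENNReal.one_lt_top, edist_lt_top _ _⟩)
    have hle := h.energyValue_le hP2 hfin
    rw [energyValue, energyValue, integral_congr_ae hpt, hmix.2,
      integral_add (f := fun x => (1 - t) * (ρ x * Real.log (ρ x))
        + (1 - t) * Real.log (1 - t) * ρ x) ((hent.const_mul _).add (hρi.const_mul _)) hindi,
      integral_add (hent.const_mul _) (hρi.const_mul _), integral_const_mul, integral_const_mul,
      hρ1, integral_indicator hB, setIntegral_const, hσ,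
      integral_add_measure (hVi.smul_measure ENNReal.ofReal_ne_top)
        (hVν.smul_measure ENNReal.ofReal_ne_top), integral_smul_measure, integral_smul_measure,
      ENNReal.toReal_ofReal ht1', ENNReal.toReal_ofReal ht0.le, Real.log_mul ht0.ne'
      (inv_pos.2 hv0).ne'] at hle
    simp only [smul_eq_mul, mul_one] at hle
    have e1 : volume.real B * (t * v⁻¹ * (Real.log t + Real.log v⁻¹))
        = t * Real.log t + t * Real.log v⁻¹ := by
      rw [← hv]; field_simp
    rw [e1] at hle
    have := mul_log_one_sub_nonpos ht0 ht1
    change Ent + vμ + 1 / 2 * wμμ ≤ (1 - t) * Ent + (1 - t) * Real.log (1 - t)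
      + (t * Real.log t + t * Real.log v⁻¹) + ((1 - t) * vμ + t * vν)
      + 1 / 2 * ((1 - t) ^ 2 * wμμ + 2 * (1 - t) * t * wμν + t ^ 2 * wνν) at hle
    linarith
  -- `M` dominates the sum of all terms of order `t` or higher after division by `t`. With `log t =
  -- -M - 1` the total is at most `-1`, a contradiction.
  set M : ℝ := |Ent| + |Real.log v⁻¹| + |vν - vμ| + |wμμ| + |wμν| + |wνν| with hM
  have hM0 : 0 ≤ M := by positivity
  set t := Real.exp (-M - 1) with ht
  have ht0 : 0 < t := Real.exp_pos _
  have ht1 : t < 1 :=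
    (Real.exp_lt_exp.2 (by linarith : -M - 1 < 0)).trans_eq Real.exp_zero
  have hk := key t ht0 ht1
  have hlog : Real.log t = -M - 1 := Real.log_exp _
  rw [hlog] at hk
  have hk' : 0 ≤ t * (-Ent + (-M - 1) + Real.log v⁻¹ + (vν - vμ)
      + 1 / 2 * ((t - 2) * wμμ + 2 * (1 - t) * wμν + t * wνν)) := by linarith
  have hk2 := nonneg_of_mul_nonneg_right hk' ht0
  have b1 : (t - 2) * wμμ ≤ 2 * |wμμ| := by
    refine (le_abs_self _).trans ?_
    rw [abs_mul]
    exact mul_le_mul_of_nonneg_right (abs_le.2 ⟨by linarith, by linarith⟩) (abs_nonneg _)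
  have b2 : (1 - t) * wμν ≤ 1 * |wμν| := by
    refine (le_abs_self _).trans ?_
    rw [abs_mul]
    exact mul_le_mul_of_nonneg_right (abs_le.2 ⟨by linarith, by linarith⟩) (abs_nonneg _)
  have b3 : t * wνν ≤ 1 * |wνν| := by
    refine (le_abs_self _).trans ?_
    rw [abs_mul]
    exact mul_le_mul_of_nonneg_right (abs_le.2 ⟨by linarith, by linarith⟩) (abs_nonneg _)
  linarith [neg_abs_le Ent, le_abs_self (Real.log v⁻¹), le_abs_self (vν - vμ), abs_nonneg wνν]

/-- The minimiser charges every set of positive Lebesgue measure. -/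
theorem IsUniqueMinimiser.volume_absolutelyContinuous [IsLocallyFiniteMeasure (volume : Measure X)]
    (h : IsUniqueMinimiser V W μ)
    (hV : Measurable V) (kW : IsIntegrableKernel W μ)
    (hWl : LocallyIntegrable fun z : X × X => W z.1 z.2) : volume ≪ μ := by
  have hμP := h.1.1
  have hac := h.hasFiniteEnergy.1
  set A : Set X := {x | μ.rnDeriv volume x = 0} with hA
  have hAm : MeasurableSet A := (Measure.measurable_rnDeriv _ _) (measurableSet_singleton 0)
  have hGm : Measurable fun x => ∫ y, |W x y| ∂μ :=
    (kW.measurable.norm.stronglyMeasurable.integral_prod_right (ν := μ)).measurable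
  set S : ℕ → Set X := fun n => A ∩ {x | |V x| ≤ n} ∩ {x | ∫ y, |W x y| ∂μ ≤ n} with hS
  have hSm : ∀ n, MeasurableSet (S n) := fun n =>
    (hAm.inter (measurableSet_le hV.norm measurable_const)).inter
      (measurableSet_le hGm measurable_const)
  have hA0 : volume A = 0 := by
    have hcov : A ⊆ ⋃ n, S n := by
      intro x hx
      obtain ⟨n, hn⟩ := exists_nat_ge (max |V x| (∫ y, |W x y| ∂μ))
      exact mem_iUnion.2 ⟨n, ⟨hx, (le_max_left _ _).trans hn⟩, (le_max_right _ _).trans hn⟩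
    refine measure_mono_null hcov (measure_iUnion_null fun n => ?_)
    refine measure_null_of_locally_null _ fun x _ => ?_
    -- Near each point there is a small open set of finite volume, inside a unit ball, with `W`
    -- integrable on its square. Together with the truncation levels `n` this supplies admissible
    -- sets `B`, and locally null sets are null.
    obtain ⟨T, hT, hTi⟩ := hWl (x, x)
    rw [nhds_prod_eq, mem_prod_same_iff] at hT
    obtain ⟨U, hU, hUT⟩ := hT
    obtain ⟨U', hU', hU'fin⟩ := (volume : Measure X).finiteAt_nhds x
    obtain ⟨O, hO, hOo, hxO⟩ := mem_nhds_iff.1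
      (inter_mem (inter_mem hU hU') (Metric.ball_mem_nhds x one_pos))
    refine ⟨S n ∩ O, inter_mem self_mem_nhdsWithin
      (mem_nhdsWithin_of_mem_nhds (hOo.mem_nhds hxO)), ?_⟩
    refine h.volume_eq_zero_of_rnDeriv_eq_zero hV kW ((hSm n).inter hOo.measurableSet)
      (measure_mono (fun y hy => (hO hy.2).1.2) |>.trans_lt hU'fin).ne
      (fun y hy => hy.1.1.1) (fun y hy => hy.1.1.2) (fun y hy => hy.1.2)
      (hTi.mono_set fun z hz => hUT ⟨(hO hz.1.2).1.1, (hO hz.2.2).1.1⟩) (x₁ := x)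
      (fun y hy => (hO hy.2).2)
  rw [← Measure.withDensity_rnDeriv_eq μ volume hac]
  refine withDensity_absolutelyContinuous' (Measure.measurable_rnDeriv _ _).aemeasurable ?_
  exact measure_eq_zero_iff_ae_notMem.1 hA0

theorem mul_log_one_add_bounds {u : ℝ} (hu : |u| ≤ 1 / 2) :
    |(1 + u) * Real.log (1 + u)| ≤ 1 ∧ (1 + u) * Real.log (1 + u) ≤ u + u ^ 2 := by
  obtain ⟨h1, h2⟩ := abs_le.1 hu
  have h0 : 0 < 1 + u := by linarith
  have h3 : Real.log (1 + u) ≤ u := by linarith [Real.log_le_sub_one_of_pos h0]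
  have h4 := Real.one_sub_inv_le_log_of_pos h0
  have h5 : (1 + u) * Real.log (1 + u) ≤ u + u ^ 2 := by nlinarith
  have h6 : u ≤ (1 + u) * Real.log (1 + u) := by
    have := mul_le_mul_of_nonneg_left h4 h0.le
    have e : (1 + u) * (1 - (1 + u)⁻¹) = u := by field_simp; ring
    linarith
  refine ⟨abs_le.2 ⟨by linarith, by nlinarith⟩, h5⟩

theorem eq_zero_of_forall_le_sq {L C : ℝ} (h : ∀ t : ℝ, |t| ≤ 1 / 2 → 0 ≤ t * L + C * t ^ 2) :
    L = 0 := by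
  have hC : 0 ≤ C := by
    have h1 := h (1 / 2) (by norm_num [abs_of_pos])
    have h2 := h (-(1 / 2)) (by norm_num [abs_of_pos])
    linarith
  by_contra hL
  -- The test value `t = -L / (2 s)` satisfies `|t| ≤ 1/2` because `|L| ≤ s`, and gives `L² (C - 2
  -- s) / (4 s²)`, negative when `L ≠ 0` since `C < 2 s`.
  set s := |L| + C + 1 with hs
  have hs0 : 0 < s := by positivity
  have hs1 : |L| < 2 * s := by linarith [abs_nonneg L]
  have := h (-(L / (2 * s))) (by
    rw [abs_neg, abs_div, abs_of_pos (by linarith : 0 < 2 * s),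
      div_le_div_iff₀ (by linarith) two_pos]
    linarith [abs_nonneg L])
  have hL2 : 0 < L ^ 2 := by positivity
  have e : -(L / (2 * s)) * L + C * (-(L / (2 * s))) ^ 2
      = L ^ 2 * (C - 2 * s) / (4 * s ^ 2) := by field_simp; ring
  rw [e] at this
  have hneg : L ^ 2 * (C - 2 * s) / (4 * s ^ 2) < 0 := by
    refine div_neg_of_neg_of_pos (mul_neg_of_pos_of_neg hL2 ?_) (by positivity)
    linarith [abs_nonneg L]
  linarith

/-- The first variation of the energy vanishes at the minimiser. -/
theorem IsUniqueMinimiser.integral_firstVariation_eq_zero (h : IsUniqueMinimiser V W μ)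
    (kW : IsIntegrableKernel W μ) {φ : X → ℝ} (hφ : Measurable φ) (hφ1 : ∀ x, |φ x| ≤ 1)
    (hφ0 : ∫ x, φ x ∂μ = 0) :
    ∫ x, φ x * (llr μ volume x + V x + ∫ y, W x y ∂μ) ∂μ = 0 := by
  have hμP := h.1.1
  obtain ⟨hac, hent, hVi, hWi⟩ := h.hasFiniteEnergy
  have hlli : Integrable (llr μ volume) μ := (integrable_rnDeriv_mul_log_iff hac).1 hent
  have hW1i : Integrable (fun x => ∫ y, W x y ∂μ) μ := hWi.integral_prod_left
  have bdd : ∀ {f : X → ℝ}, Integrable f μ → Integrable (fun x => φ x * f x) μ := fun hf =>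
    hf.bdd_mul hφ.aestronglyMeasurable (c := 1) (ae_of_all _ hφ1)
  have hφi : Integrable φ μ := Integrable.of_bound hφ.aestronglyMeasurable 1 (ae_of_all _ hφ1)
  -- Bound on the second-order terms for the competitor `(1 + t φ) μ`: `1` from `(1 + u) log (1 + u)
  -- ≤ u + u²`, and half the integral of `|W|` from `t² φ(x) φ(y) W`. Both signs of `t` are allowed,
  -- which forces the linear coefficient to vanish.
  set C : ℝ := 1 + 1 / 2 * ∫ z, |W z.1 z.2| ∂(μ.prod μ) with hC
  refine eq_zero_of_forall_le_sq (C := C) fun t ht => ?_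
  have hu : ∀ x, |t * φ x| ≤ 1 / 2 := fun x => by
    rw [abs_mul]
    nlinarith [hφ1 x, abs_nonneg (φ x), abs_nonneg t]
  have hg0 : ∀ x, 0 < 1 + t * φ x := fun x => by linarith [(abs_le.1 (hu x)).1]
  have hg2 : ∀ x, 1 + t * φ x ≤ 2 := fun x => by linarith [(abs_le.1 (hu x)).2]
  have hgm : Measurable fun x => 1 + t * φ x := (hφ.const_mul t).const_add 1
  set σ : Measure X := μ.withDensity fun x => ENNReal.ofReal (1 + t * φ x) with hσ
  have hint : ∀ f : X → ℝ, ∫ x, f x ∂σ = ∫ x, (1 + t * φ x) * f x ∂μ := fun f => by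
    rw [hσ, integral_withDensity_eq_integral_toReal_smul hgm.ennreal_ofReal
      (ae_of_all _ fun _ => ENNReal.ofReal_lt_top)]
    simp only [ENNReal.toReal_ofReal (hg0 _).le, smul_eq_mul]
  have hgi : Integrable (fun x => 1 + t * φ x) μ := (integrable_const _).add (hφi.const_mul t)
  have hσP : IsProbabilityMeasure σ := ⟨by
    rw [hσ, withDensity_apply _ MeasurableSet.univ, Measure.restrict_univ,
      ← ofReal_integral_eq_lintegral_ofReal hgi (ae_of_all _ fun x => (hg0 x).le),
      integral_add (integrable_const _) (hφi.const_mul t), integral_const_mul, hφ0]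
    simp⟩
  have hσle : σ ≤ (2 : ℝ≥0∞) • μ := by
    rw [hσ, ← withDensity_const]
    refine withDensity_mono (ae_of_all _ fun x => ?_)
    exact (ENNReal.ofReal_le_ofReal (hg2 x)).trans (by simp)
  have hiσ : ∀ {f : X → ℝ}, Integrable f μ → Integrable f σ := fun hf =>
    (hf.smul_measure ENNReal.ofNat_ne_top).mono_measure hσle
  set ρ : X → ℝ := fun x => (μ.rnDeriv volume x).toReal with hρ
  have hρm : Measurable ρ := (Measure.measurable_rnDeriv _ _).ennreal_toReal
  have hρ0 : ∀ x, 0 ≤ ρ x := fun x => ENNReal.toReal_nonneg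
  have hσd : σ = volume.withDensity fun x => ENNReal.ofReal (ρ x * (1 + t * φ x)) := by
    have e : (fun x => ENNReal.ofReal (ρ x * (1 + t * φ x)))
        = (fun x => ENNReal.ofReal (ρ x)) * fun x => ENNReal.ofReal (1 + t * φ x) := by
      ext x
      exact ENNReal.ofReal_mul (hρ0 x)
    rw [e, withDensity_mul _ hρm.ennreal_ofReal hgm.ennreal_ofReal, withDensity_toReal_rnDeriv hac]
  have hσrn := rnDeriv_withDensity_toReal (hρm.mul hgm) (fun x => mul_nonneg (hρ0 x) (hg0 x).le)
  simp only [Pi.mul_apply] at hσrn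
  rw [← hσd] at hσrn
  have hpt : (fun x => (σ.rnDeriv volume x).toReal * Real.log (σ.rnDeriv volume x).toReal)
      =ᵐ[volume] fun x => ρ x * ((1 + t * φ x) * llr μ volume x
        + (1 + t * φ x) * Real.log (1 + t * φ x)) := by
    filter_upwards [hσrn] with x hx
    rw [hx, llr_def]
    simp only [Pi.mul_apply]
    rcases (hρ0 x).eq_or_lt with h0 | h0
    · simp [← h0]
    · rw [Real.log_mul h0.ne' (hg0 x).ne']
      ring
  have hlogm : Measurable fun x => (1 + t * φ x) * Real.log (1 + t * φ x) :=
    hgm.mul (Real.measurable_log.comp hgm)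
  have hlogi : Integrable (fun x => (1 + t * φ x) * Real.log (1 + t * φ x)) μ :=
    Integrable.of_bound hlogm.aestronglyMeasurable 1
      (ae_of_all _ fun x => (mul_log_one_add_bounds (hu x)).1)
  have hgl : ∀ {f : X → ℝ}, Integrable f μ →
      Integrable (fun x => (1 + t * φ x) * f x) μ := fun {f} hf =>
    (hf.add ((bdd hf).const_mul t)).congr (ae_of_all _ fun x => by
      simp only [Pi.add_apply]; ring)
  have hgl' : ∀ {f : X → ℝ}, Integrable f μ →
      ∫ x, (1 + t * φ x) * f x ∂μ = (∫ x, f x ∂μ) + t * ∫ x, φ x * f x ∂μ := fun {f} hf => by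
    rw [← integral_const_mul, ← integral_add hf ((bdd hf).const_mul t)]
    refine integral_congr_ae (ae_of_all _ fun x => ?_)
    simp only
    ring
  have hsumi := (hgl hlli).add hlogi
  have hprod : σ.prod σ = (μ.prod μ).withDensity fun z =>
      ENNReal.ofReal (1 + t * φ z.1) * ENNReal.ofReal (1 + t * φ z.2) :=
    prod_withDensity hgm.ennreal_ofReal hgm.ennreal_ofReal
  have hσW : Integrable (fun z : X × X => W z.1 z.2) (σ.prod σ) := by
    refine (hWi.smul_measure (c := 4) ENNReal.ofNat_ne_top).mono_measure ?_
    rw [hprod, ← withDensity_const]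
    refine withDensity_mono (ae_of_all _ fun z => ?_)
    have h2 : ∀ x, ENNReal.ofReal (1 + t * φ x) ≤ 2 := fun x =>
      (ENNReal.ofReal_le_ofReal (hg2 x)).trans (by simp)
    calc _ ≤ (2 : ℝ≥0∞) * 2 := mul_le_mul' (h2 _) (h2 _)
      _ = 4 := by norm_num
  have hfin : HasFiniteEnergy V W σ := by
    refine ⟨hσd ▸ withDensity_absolutelyContinuous _ _, ?_, hiσ hVi, hσW⟩
    refine Integrable.congr ?_ hpt.symm
    exact (integrable_rnDeriv_smul_iff hac).2 hsumi
  have hP2 : IsP2 σ := by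
    refine ⟨hσP, fun x₀ => ?_⟩
    refine (lintegral_mono' hσle le_rfl).trans_lt ?_
    rw [lintegral_smul_measure]
    exact ENNReal.mul_lt_top ENNReal.ofNat_lt_top (h.1.2 x₀)
  have hle := h.energyValue_le hP2 hfin
  have hEntμ : ∫ x, ρ x * Real.log (ρ x) = ∫ x, llr μ volume x ∂μ := integral_rnDeriv_mul_log hac
  have hEntσ : ∫ x, (σ.rnDeriv volume x).toReal * Real.log (σ.rnDeriv volume x).toReal
      ≤ (∫ x, llr μ volume x ∂μ) + t * (∫ x, φ x * llr μ volume x ∂μ) + t ^ 2 := by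
    have e := integral_rnDeriv_smul hac (f := fun x => (1 + t * φ x) * llr μ volume x
        + (1 + t * φ x) * Real.log (1 + t * φ x))
    simp only [smul_eq_mul] at e
    rw [integral_congr_ae hpt, e, integral_add (hgl hlli) hlogi, hgl' hlli]
    have : ∫ x, (1 + t * φ x) * Real.log (1 + t * φ x) ∂μ ≤ ∫ x, t * φ x + t ^ 2 ∂μ := by
      refine integral_mono hlogi ((hφi.const_mul t).add (integrable_const _)) fun x => ?_
      refine (mul_log_one_add_bounds (hu x)).2.trans ?_
      have : (t * φ x) ^ 2 ≤ t ^ 2 := by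
        rw [mul_pow]
        have := (sq_le_one_iff_abs_le_one (φ x)).2 (hφ1 x)
        nlinarith [sq_nonneg t]
      linarith
    rw [integral_add (hφi.const_mul t) (integrable_const _), integral_const_mul, hφ0] at this
    simp at this
    linarith
  have hWσ : ∫ z, W z.1 z.2 ∂(σ.prod σ) ≤ (∫ z, W z.1 z.2 ∂(μ.prod μ))
      + 2 * t * (∫ x, φ x * ∫ y, W x y ∂μ ∂μ) + t ^ 2 * ∫ z, |W z.1 z.2| ∂(μ.prod μ) := by
    have hφ1i : Integrable (fun z : X × X => φ z.1 * W z.1 z.2) (μ.prod μ) :=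
      hWi.bdd_mul (hφ.comp measurable_fst).aestronglyMeasurable (c := 1)
        (ae_of_all _ fun z => hφ1 _)
    have e1 : ∫ z, φ z.1 * W z.1 z.2 ∂(μ.prod μ) = ∫ x, φ x * ∫ y, W x y ∂μ ∂μ := by
      rw [integral_prod _ hφ1i]
      simp only [integral_const_mul]
    have e2 : ∫ z, φ z.2 * W z.1 z.2 ∂(μ.prod μ) = ∫ x, φ x * ∫ y, W x y ∂μ ∂μ := by
      rw [← e1, ← integral_prod_swap]
      simp only [Prod.fst_swap, Prod.snd_swap]
      exact integral_congr_ae (ae_of_all _ fun z => by simp only [kW.symm z.2 z.1])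
    have hφ2i : Integrable (fun z : X × X => φ z.2 * W z.1 z.2) (μ.prod μ) :=
      hWi.bdd_mul (hφ.comp measurable_snd).aestronglyMeasurable (c := 1)
        (ae_of_all _ fun z => hφ1 _)
    have hb : Integrable (fun z : X × X => W z.1 z.2 + (t * (φ z.1 * W z.1 z.2)
        + t * (φ z.2 * W z.1 z.2)) + t ^ 2 * |W z.1 z.2|) (μ.prod μ) :=
      (hWi.add ((hφ1i.const_mul t).add (hφ2i.const_mul t))).add (hWi.abs.const_mul _)
    calc ∫ z, W z.1 z.2 ∂(σ.prod σ)
        = ∫ z, ((1 + t * φ z.1) * (1 + t * φ z.2)) * W z.1 z.2 ∂(μ.prod μ) := by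
          have hmm : Measurable fun z : X × X =>
              ENNReal.ofReal (1 + t * φ z.1) * ENNReal.ofReal (1 + t * φ z.2) :=
            (hgm.comp measurable_fst).ennreal_ofReal.mul (hgm.comp measurable_snd).ennreal_ofReal
          rw [hprod, integral_withDensity_eq_integral_toReal_smul hmm
            (ae_of_all _ fun z => ENNReal.mul_lt_top ENNReal.ofReal_lt_top ENNReal.ofReal_lt_top)]
          simp only [ENNReal.toReal_mul, ENNReal.toReal_ofReal (hg0 _).le, smul_eq_mul]
      _ ≤ ∫ z, W z.1 z.2 + (t * (φ z.1 * W z.1 z.2) + t * (φ z.2 * W z.1 z.2))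
            + t ^ 2 * |W z.1 z.2| ∂(μ.prod μ) := by
          refine integral_mono_ae ?_ hb (ae_of_all _ fun z => ?_)
          · refine hWi.bdd_mul ((hgm.comp measurable_fst).mul
              (hgm.comp measurable_snd)).aestronglyMeasurable (c := 4) (ae_of_all _ fun z => ?_)
            rw [Real.norm_eq_abs, abs_of_nonneg (mul_nonneg (hg0 _).le (hg0 _).le)]
            nlinarith [hg0 z.1, hg0 z.2, hg2 z.1, hg2 z.2]
          · have : φ z.1 * φ z.2 * W z.1 z.2 ≤ |W z.1 z.2| := by
              refine (le_abs_self _).trans ?_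
              rw [abs_mul, abs_mul]
              have := mul_le_one₀ (hφ1 z.1) (abs_nonneg _) (hφ1 z.2)
              nlinarith [abs_nonneg (W z.1 z.2)]
            have := mul_le_mul_of_nonneg_left this (sq_nonneg t)
            simp only
            linarith
      _ = _ := by
          rw [integral_add (f := fun z : X × X => W z.1 z.2 + (t * (φ z.1 * W z.1 z.2)
            + t * (φ z.2 * W z.1 z.2))) (hWi.add ((hφ1i.const_mul t).add (hφ2i.const_mul t)))
            (hWi.abs.const_mul _), integral_add (g := fun z : X × X => t * (φ z.1 * W z.1 z.2)
            + t * (φ z.2 * W z.1 z.2)) hWi ((hφ1i.const_mul t).add (hφ2i.const_mul t)),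
            integral_add (hφ1i.const_mul t) (hφ2i.const_mul t), integral_const_mul,
            integral_const_mul, integral_const_mul, e1, e2]
          ring
  have hfinal : ∫ x, φ x * (llr μ volume x + V x + ∫ y, W x y ∂μ) ∂μ
      = (∫ x, φ x * llr μ volume x ∂μ) + (∫ x, φ x * V x ∂μ)
        + ∫ x, φ x * ∫ y, W x y ∂μ ∂μ := by
    rw [← integral_add (bdd hlli) (bdd hVi), ← integral_add
      (f := fun x => φ x * llr μ volume x + φ x * V x) ((bdd hlli).add (bdd hVi)) (bdd hW1i)]
    simp only [mul_add]
  rw [energyValue, energyValue, hint, hgl' hVi] at hle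
  change (∫ x, ρ x * Real.log (ρ x)) + _ + _ ≤ _ at hle
  rw [hEntμ] at hle
  rw [hfinal, hC]
  linarith

/-- The Euler–Lagrange equation of the minimiser. -/
theorem IsUniqueMinimiser.eulerLagrange (h : IsUniqueMinimiser V W μ)
    (kW : IsIntegrableKernel W μ) :
    ∀ᵐ x ∂μ, llr μ volume x + V x + ∫ y, W x y ∂μ
      = (energy V W μ).toReal + 1 / 2 * ∫ z, W z.1 z.2 ∂(μ.prod μ) := by
  have hμP := h.1.1
  obtain ⟨hac, hent, hVi, hWi⟩ := h.hasFiniteEnergy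
  have hlli : Integrable (llr μ volume) μ := (integrable_rnDeriv_mul_log_iff hac).1 hent
  have hW1i : Integrable (fun x => ∫ y, W x y ∂μ) μ := hWi.integral_prod_left
  have hfi : Integrable (fun x => llr μ volume x + V x + ∫ y, W x y ∂μ) μ :=
    (hlli.add hVi).add hW1i
  have hmean : ∫ x, llr μ volume x + V x + ∫ y, W x y ∂μ ∂μ
      = (energy V W μ).toReal + 1 / 2 * ∫ z, W z.1 z.2 ∂(μ.prod μ) := by
    rw [integral_add (f := fun x => llr μ volume x + V x) (hlli.add hVi) hW1i,
      integral_add hlli hVi, energy_eq_energyValue h.hasFiniteEnergy, EReal.toReal_coe,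
      energyValue, integral_rnDeriv_mul_log hac, integral_prod _ hWi]
    ring
  rw [← hmean]
  refine Integrable.ae_eq_of_forall_setIntegral_eq _ (fun _ => _) hfi (integrable_const _)
    fun A hA _ => ?_
  have hA1 : μ.real A ≤ 1 := measureReal_le_one
  have hA0 : 0 ≤ μ.real A := measureReal_nonneg
  -- Testing with the centred indicator of `A` identifies the integral over `A` with `μ(A)` times
  -- the mean, for every `A`.
  have hv := h.integral_firstVariation_eq_zero kW (φ := fun x => A.indicator 1 x - μ.real A)
    ((measurable_one.indicator hA).sub_const _) (fun x => by
      by_cases hx : x ∈ A <;> simp only [hx, indicator_of_mem, not_false_eq_true,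
        indicator_of_notMem, Pi.one_apply, abs_le] <;> constructor <;> linarith) (by
      rw [integral_sub ((integrable_const _).indicator hA) (integrable_const _),
        integral_indicator_one hA]
      simp)
  have e : ∀ x, (A.indicator 1 x - μ.real A) * (llr μ volume x + V x + ∫ y, W x y ∂μ)
      = A.indicator (fun x => llr μ volume x + V x + ∫ y, W x y ∂μ) x
        - μ.real A * (llr μ volume x + V x + ∫ y, W x y ∂μ) := fun x => by
    by_cases hx : x ∈ A <;> simp [hx, sub_mul]
  simp only [e] at hv
  rw [integral_sub (hfi.indicator hA) (hfi.const_mul _), integral_indicator hA,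
    integral_const_mul] at hv
  rw [setIntegral_const, smul_eq_mul]
  linarith

end EulerLagrange


/-! ### The Gibbs measure relative to the minimiser -/

section Product

variable {X : Type*} [MeasurableSpace X]

theorem lintegral_pi_prod {n : ℕ} (ν : Fin n → Measure X) [∀ i, SigmaFinite (ν i)]
    {f : X → ℝ≥0∞} (hf : Measurable f) :
    ∫⁻ x : Fin n → X, ∏ i, f (x i) ∂(Measure.pi ν) = ∏ i, ∫⁻ x, f x ∂(ν i) := by
  induction n with
  | zero => simp
  | succ n ih =>
    have hm : ∀ n, Measurable fun x : Fin n → X => ∏ i, f (x i) := fun n =>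
      Finset.measurable_prod _ fun i _ => hf.comp (measurable_pi_apply i)
    have hmp := (measurePreserving_piFinSuccAbove ν 0).symm
    rw [← hmp.lintegral_comp (hm (n + 1)), Fin.prod_univ_succ]
    have e : ∀ p : X × (Fin n → X), ∏ i, f
        ((MeasurableEquiv.piFinSuccAbove (fun _ => X) (0 : Fin (n + 1))).symm p i)
        = f p.1 * ∏ i, f (p.2 i) := fun p => by
      simp [Fin.prod_univ_succ, MeasurableEquiv.piFinSuccAbove, Fin.insertNthEquiv]
    simp only [e]
    refine (lintegral_prod_mul hf.aemeasurable (hm n).aemeasurable).trans ?_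
    rw [ih]
    simp

theorem pi_withDensity {n : ℕ} (ν : Measure X) [SigmaFinite ν] {f : X → ℝ≥0∞}
    (hf : Measurable f) [SigmaFinite (ν.withDensity f)] :
    (Measure.pi fun _ : Fin n => ν.withDensity f)
      = (Measure.pi fun _ : Fin n => ν).withDensity fun x => ∏ i, f (x i) := by
  refine (Measure.pi_eq fun s hs => ?_)
  rw [withDensity_apply _ (MeasurableSet.univ_pi hs), Measure.restrict_pi_pi,
    lintegral_pi_prod _ hf]
  exact Finset.prod_congr rfl fun i _ => (withDensity_apply _ (hs i)).symm

theorem measurePreserving_eval_pair (μ : Measure X) [IsProbabilityMeasure μ] {n : ℕ}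
    {i j : Fin n} (hij : i ≠ j) :
    MeasurePreserving (fun x : Fin n → X => (x i, x j)) (Measure.pi fun _ => μ) (μ.prod μ) := by
  cases n with
  | zero => exact i.elim0
  | succ n =>
    obtain ⟨k, rfl⟩ := Fin.exists_succAbove_eq hij.symm
    exact ((MeasurePreserving.id μ).prod (measurePreserving_eval (fun _ : Fin n => μ) k)).comp
      (measurePreserving_piFinSuccAbove (fun _ : Fin (n + 1) => μ) i)

end Product

/-! ### The Gibbs measure as a density with respect to the product of the minimiser. -/

section Gibbs

variable {X : Type*} [MetricSpace X] [MeasureSpace X] [BorelSpace X]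
  [SecondCountableTopology X] {μ : Measure X} {V : X → ℝ} {W : X → X → ℝ}

/-- Each ordered pair `i ≠ j` contributes `w = ∫∫ W dμ dμ`, so the bracket averages to `N (N - 1) w
- 2 N² w + N² w = -N w`. -/
theorem IsIntegrableKernel.integral_fluctuationEnergy [IsProbabilityMeasure μ]
    [NullSingletonClass μ] (kW : IsIntegrableKernel W μ) {N : ℕ} (hN : 1 ≤ N) :
    Integrable (fun x : Fin N → X => fluctuationEnergy W μ x) (Measure.pi fun _ => μ) ∧
    ∫ x : Fin N → X, fluctuationEnergy W μ x ∂(Measure.pi fun _ => μ)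
      = -(1 / 2) * ∫ z, W z.1 z.2 ∂(μ.prod μ) := by
  set w := ∫ z, W z.1 z.2 ∂(μ.prod μ) with hw
  have hN0 : (N : ℝ) ≠ 0 := by positivity
  have kO := kW.offDiag
  have hw' : ∫ z, MeanField.offDiag W z.1 z.2 ∂(μ.prod μ) = w :=
    integral_congr_ae (offDiag_ae kW.measurable)
  have hij : ∀ i j : Fin N, Integrable (fun x : Fin N → X => MeanField.offDiag W (x i) (x j))
      (Measure.pi fun _ => μ) ∧
        ∫ x : Fin N → X, MeanField.offDiag W (x i) (x j) ∂(Measure.pi fun _ => μ)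
        = if i = j then 0 else w := by
    intro i j
    rcases eq_or_ne i j with rfl | h
    · simp [offDiag_self]
    · have hp := measurePreserving_eval_pair μ h
      refine ⟨(hp.integrable_comp kO.measurable.aestronglyMeasurable).2 kO.integrable, ?_⟩
      rw [if_neg h, ← hw', ← hp.map_eq,
        integral_map hp.measurable.aemeasurable kO.measurable.aestronglyMeasurable]
  have hW1 : Integrable (fun x => ∫ y, W x y ∂μ) μ := kW.integrable.integral_prod_left
  have hi : ∀ i : Fin N, Integrable (fun x : Fin N → X => ∫ y, W (x i) y ∂μ)
      (Measure.pi fun _ => μ) ∧ ∫ x : Fin N → X, ∫ y, W (x i) y ∂μ ∂(Measure.pi fun _ => μ)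
        = w := by
    intro i
    have hp := measurePreserving_eval (fun _ : Fin N => μ) i
    refine ⟨(hp.integrable_comp hW1.aestronglyMeasurable).2 hW1, ?_⟩
    rw [hw, integral_prod _ kW.integrable]
    exact integral_comp_eval (μ := fun _ : Fin N => μ) hW1.aestronglyMeasurable
  have s1 : Integrable (fun x : Fin N → X => ∑ i, ∑ j, MeanField.offDiag W (x i) (x j))
      (Measure.pi fun _ => μ) :=
    integrable_finsetSum _ fun i _ => integrable_finsetSum _ fun j _ => (hij i j).1
  have s2 : Integrable (fun x : Fin N → X => ∑ i, ∫ y, W (x i) y ∂μ) (Measure.pi fun _ => μ) :=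
    integrable_finsetSum _ fun i _ => (hi i).1
  have s3 : Integrable (fun x : Fin N → X => (∑ i, ∑ j, MeanField.offDiag W (x i) (x j))
      - 2 * N * ∑ i, ∫ y, W (x i) y ∂μ) (Measure.pi fun _ => μ) := s1.sub (s2.const_mul _)
  simp only [kW.fluctuationEnergy_eq, ← hw]
  refine ⟨((s3.add (integrable_const _)).const_mul _).const_mul _, ?_⟩
  rw [integral_const_mul, integral_const_mul, integral_add s3 (integrable_const _),
    integral_sub s1 (s2.const_mul _), integral_const_mul, integral_finsetSum _ fun i _ =>
      integrable_finsetSum _ fun j _ => (hij i j).1, integral_finsetSum _ fun i _ => (hi i).1]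
  have e1 : ∀ i : Fin N,
      ∫ x : Fin N → X, ∑ j, MeanField.offDiag W (x i) (x j) ∂(Measure.pi fun _ => μ)
      = N * w - w := by
    intro i
    rw [integral_finsetSum _ fun j _ => (hij i j).1]
    simp only [(hij i _).2]
    have : ∀ j, (if i = j then (0 : ℝ) else w) = w - if i = j then w else 0 := fun j => by
      split_ifs <;> simp
    simp [this, Finset.sum_sub_distrib]
  simp only [e1, (hi _).2, Finset.sum_const, Finset.card_univ, Fintype.card_fin, nsmul_eq_mul,
    integral_const, probReal_univ, smul_eq_mul, one_mul]
  field_simp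
  ring

variable [SigmaFinite (volume : Measure X)]

/-- The Euler–Lagrange equation expresses `∑ V(x_i)` through `∑ log ρ(x_i)` and `∑ ∫ W(x_i, y)
dμ(y)`; the latter is the linear term of the fluctuation energy and cancels. -/
theorem IsUniqueMinimiser.hamiltonian_ae [NullSingletonClass μ] (h : IsUniqueMinimiser V W μ)
    (kW : IsIntegrableKernel W μ) {N : ℕ} (hN : 1 ≤ N) :
    ∀ᵐ x : Fin N → X ∂(Measure.pi fun _ => μ), hamiltonian V W x
      = fluctuationEnergy W μ x + N * (energy V W μ).toReal - ∑ i, llr μ volume (x i) := by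
  have hμP := h.1.1
  have hEL : ∀ᵐ x : Fin N → X ∂(Measure.pi fun _ => μ), ∀ i, llr μ volume (x i) + V (x i)
      + ∫ y, W (x i) y ∂μ = (energy V W μ).toReal + 1 / 2 * ∫ z, W z.1 z.2 ∂(μ.prod μ) :=
    ae_all_iff.2 fun i => (Measure.tendsto_eval_ae_ae (μ := fun _ : Fin N => μ)).eventually
      (h.eulerLagrange kW)
  filter_upwards [hEL, ae_injective_pi μ N] with x hx hinj
  have hN0 : (N : ℝ) ≠ 0 := by positivity
  have hV : ∑ i, V (x i) = N * ((energy V W μ).toReal + 1 / 2 * ∫ z, W z.1 z.2 ∂(μ.prod μ))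
      - (∑ i, llr μ volume (x i)) - ∑ i, ∫ y, W (x i) y ∂μ := by
    have : ∀ i, V (x i) = ((energy V W μ).toReal + 1 / 2 * ∫ z, W z.1 z.2 ∂(μ.prod μ))
        - llr μ volume (x i) - ∫ y, W (x i) y ∂μ := fun i => by linarith [hx i]
    simp only [this, Finset.sum_sub_distrib, Finset.sum_const, Finset.card_univ,
      Fintype.card_fin, nsmul_eq_mul]
  have hoff : ∑ i, ∑ j, offDiag W (x i) (x j)
      = ∑ i, ∑ j, if i ≠ j then W (x i) (x j) else 0 := by
    refine Finset.sum_congr rfl fun i _ => Finset.sum_congr rfl fun j _ => ?_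
    split_ifs with hij
    · exact offDiag_of_ne (hinj.ne hij)
    · rw [not_not.1 hij, offDiag_self]
  rw [hamiltonian, kW.fluctuationEnergy_eq, hV, hoff]
  field_simp
  ring

theorem IsUniqueMinimiser.withDensity_hamiltonian [NullSingletonClass μ]
    (h : IsUniqueMinimiser V W μ) (kW : IsIntegrableKernel W μ) (hvol : volume ≪ μ)
    {N : ℕ} (hN : 1 ≤ N) :
    (volume : Measure (Fin N → X)).withDensity
        (fun x => ENNReal.ofReal (Real.exp (-hamiltonian V W x)))
      = ENNReal.ofReal (Real.exp (-(N * (energy V W μ).toReal))) •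
        (Measure.pi fun _ : Fin N => μ).withDensity
          (fun x => ENNReal.ofReal (Real.exp (-fluctuationEnergy W μ x))) := by
  have hμP := h.1.1
  have hac := h.hasFiniteEnergy.1
  set ρ := μ.rnDeriv volume with hρ
  have hρm : Measurable ρ := Measure.measurable_rnDeriv _ _
  have hμd : volume.withDensity ρ = μ := Measure.withDensity_rnDeriv_eq μ volume hac
  have : SigmaFinite ((volume : Measure X).withDensity ρ) := by rw [hμd]; infer_instance
  have hpi := pi_withDensity (n := N) (volume : Measure X) hρm
  rw [hμd] at hpi
  have hprodm : Measurable fun x : Fin N → X => ∏ i, ρ (x i) :=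
    Finset.measurable_prod _ fun i _ => hρm.comp (measurable_pi_apply i)
  have hρpos : ∀ᵐ x ∂(volume : Measure X), 0 < ρ x ∧ ρ x < ∞ := by
    filter_upwards [hvol.ae_le (Measure.rnDeriv_pos hac), Measure.rnDeriv_lt_top μ volume]
      with x h1 h2 using ⟨h1, h2⟩
  have hρpos' : ∀ᵐ x : Fin N → X ∂(Measure.pi fun _ => volume), ∀ i, 0 < ρ (x i) ∧ ρ (x i) < ∞ :=
    ae_all_iff.2 fun i => (Measure.tendsto_eval_ae_ae
      (μ := fun _ : Fin N => (volume : Measure X))).eventually hρpos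
  -- Positivity of the density upgrades identities valid `μ^{⊗N}`-almost everywhere to
  -- Lebesgue-almost everywhere, where the Gibbs density is defined.
  have hvolpi : (Measure.pi fun _ : Fin N => (volume : Measure X)) ≪ Measure.pi fun _ => μ := by
    rw [hpi]
    refine withDensity_absolutelyContinuous' hprodm.aemeasurable ?_
    filter_upwards [hρpos'] with x hx
    exact Finset.prod_ne_zero_iff.2 fun i _ => (hx i).1.ne'
  have hfm : Measurable fun x : Fin N → X =>
      ENNReal.ofReal (Real.exp (-fluctuationEnergy W μ x)) :=
    (kW.measurable_fluctuationEnergy N).neg.exp.ennreal_ofReal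
  have hgm : Measurable fun x : Fin N → X => (∏ i, ρ (x i))
      * ENNReal.ofReal (Real.exp (-fluctuationEnergy W μ x)) := hprodm.mul hfm
  have e : (Measure.pi fun _ : Fin N => μ).withDensity
          (fun x => ENNReal.ofReal (Real.exp (-fluctuationEnergy W μ x)))
      = (volume : Measure (Fin N → X)).withDensity fun x => (∏ i, ρ (x i))
          * ENNReal.ofReal (Real.exp (-fluctuationEnergy W μ x)) := by
    rw [hpi, volume_pi]
    exact (withDensity_mul _ hprodm hfm).symm
  rw [e, ← withDensity_smul _ hgm]
  refine withDensity_congr_ae ?_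
  rw [volume_pi]
  filter_upwards [hvolpi.ae_le (h.hamiltonian_ae kW hN), hρpos'] with x hx hpos
  have hprod : ∏ i, ρ (x i) = ENNReal.ofReal (Real.exp (∑ i, llr μ volume (x i))) := by
    rw [Real.exp_sum, ENNReal.ofReal_prod_of_nonneg fun i _ => (Real.exp_pos _).le]
    refine Finset.prod_congr rfl fun i _ => ?_
    rw [llr_def, Real.exp_log (ENNReal.toReal_pos (hpos i).1.ne' (hpos i).2.ne),
      ENNReal.ofReal_toReal (hpos i).2.ne]
  rw [hx, Pi.smul_apply, smul_eq_mul, hprod, ← ENNReal.ofReal_mul (Real.exp_pos _).le,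
    ← ENNReal.ofReal_mul (Real.exp_pos _).le, ← Real.exp_add, ← Real.exp_add]
  congr 2
  ring

theorem IsUniqueMinimiser.relPartition_eq [NullSingletonClass μ]
    (h : IsUniqueMinimiser V W μ) (kW : IsIntegrableKernel W μ) (hvol : volume ≪ μ)
    {N : ℕ} (hN : 1 ≤ N) :
    relPartition W μ N
      = ENNReal.ofReal (Real.exp (N * (energy V W μ).toReal)) * gibbsNormalisation V W N := by
  have e := congrArg (fun ν : Measure (Fin N → X) => ν univ)
    (h.withDensity_hamiltonian kW hvol hN)
  simp only [Measure.smul_apply, withDensity_apply _ MeasurableSet.univ, Measure.restrict_univ,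
    smul_eq_mul] at e
  rw [gibbsNormalisation, e, ← mul_assoc, ← ENNReal.ofReal_mul (Real.exp_pos _).le,
    ← Real.exp_add]
  simp [relPartition]

theorem IsUniqueMinimiser.gibbsMeasure_eq [NullSingletonClass μ]
    (h : IsUniqueMinimiser V W μ) (kW : IsIntegrableKernel W μ) (hvol : volume ≪ μ)
    {N : ℕ} (hN : 1 ≤ N) :
    gibbsMeasure V W N = (relPartition W μ N)⁻¹ •
        (Measure.pi fun _ : Fin N => μ).withDensity
          (fun x => ENNReal.ofReal (Real.exp (-fluctuationEnergy W μ x))) := by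
  rw [gibbsMeasure, h.withDensity_hamiltonian kW hvol hN, h.relPartition_eq kW hvol hN, smul_smul]
  congr 1
  rw [ENNReal.mul_inv (Or.inl (by simp [Real.exp_pos])) (Or.inl ENNReal.ofReal_ne_top), mul_comm,
    ← ENNReal.ofReal_inv_of_pos (Real.exp_pos _), ← Real.exp_neg]

end Gibbs

/-! ### Relative entropies between the tilted and the product measure, in both directions. -/

section Entropy

variable {X : Type*} [MetricSpace X] [MeasureSpace X] [BorelSpace X]
  [SecondCountableTopology X] {μ : Measure X} [IsProbabilityMeasure μ] [NullSingletonClass μ]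
  {W : X → X → ℝ} {B : ℝ} {N : ℕ}

theorem ofReal_exp_neg_le (t : ℝ) :
    ENNReal.ofReal (Real.exp (-t)) ≤ 1 + ENNReal.ofReal (Real.exp (-2 * t)) := by
  rw [← ENNReal.ofReal_one, ← ENNReal.ofReal_add zero_le_one (Real.exp_pos _).le]
  refine ENNReal.ofReal_le_ofReal ?_
  have : Real.exp (-2 * t) = Real.exp (-t) ^ 2 := by rw [← Real.exp_nat_mul]; congr 1; ring
  nlinarith [sq_nonneg (Real.exp (-t) - 1)]

theorem IsIntegrableKernel.relPartition_le (hB : ∫⁻ x : Fin N → X,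
      ENNReal.ofReal (Real.exp (-2 * fluctuationEnergy W μ x)) ∂(Measure.pi fun _ => μ)
        ≤ ENNReal.ofReal B) (hB0 : 0 ≤ B) :
    relPartition W μ N ≤ ENNReal.ofReal (1 + B) := by
  rw [ENNReal.ofReal_add zero_le_one hB0, ENNReal.ofReal_one]
  refine (lintegral_mono fun x => ofReal_exp_neg_le _).trans ?_
  rw [lintegral_add_left measurable_const]
  simp only [lintegral_const, measure_univ, mul_one]
  gcongr

theorem IsIntegrableKernel.integrable_exp (kW : IsIntegrableKernel W μ)
    (hB : ∫⁻ x : Fin N → X,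
      ENNReal.ofReal (Real.exp (-2 * fluctuationEnergy W μ x)) ∂(Measure.pi fun _ => μ)
        ≤ ENNReal.ofReal B) (hB0 : 0 ≤ B) :
    Integrable (fun x : Fin N → X => Real.exp (-fluctuationEnergy W μ x))
      (Measure.pi fun _ => μ) ∧
    Integrable (fun x : Fin N → X => Real.exp (-2 * fluctuationEnergy W μ x))
      (Measure.pi fun _ => μ) := by
  have hm := kW.measurable_fluctuationEnergy N
  constructor
  · refine ⟨hm.neg.exp.aestronglyMeasurable, ?_⟩
    rw [hasFiniteIntegral_iff_ofReal (ae_of_all _ fun _ => (Real.exp_pos _).le)]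
    exact (relPartition_le hB hB0).trans_lt ENNReal.ofReal_lt_top
  · refine ⟨(hm.const_mul _).exp.aestronglyMeasurable, ?_⟩
    rw [hasFiniteIntegral_iff_ofReal (ae_of_all _ fun _ => (Real.exp_pos _).le)]
    exact hB.trans_lt ENNReal.ofReal_lt_top

theorem IsIntegrableKernel.tilted_eq (kW : IsIntegrableKernel W μ)
    (hB : ∫⁻ x : Fin N → X,
      ENNReal.ofReal (Real.exp (-2 * fluctuationEnergy W μ x)) ∂(Measure.pi fun _ => μ)
        ≤ ENNReal.ofReal B) (hB0 : 0 ≤ B) :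
    (relPartition W μ N)⁻¹ • (Measure.pi fun _ : Fin N => μ).withDensity
          (fun x => ENNReal.ofReal (Real.exp (-fluctuationEnergy W μ x)))
      = (Measure.pi fun _ : Fin N => μ).tilted fun x => -fluctuationEnergy W μ x := by
  have hi := (kW.integrable_exp hB hB0).1
  have hZ : relPartition W μ N = ENNReal.ofReal
      (∫ x : Fin N → X, Real.exp (-fluctuationEnergy W μ x) ∂(Measure.pi fun _ => μ)) :=
    (ofReal_integral_eq_lintegral_ofReal hi (ae_of_all _ fun _ => (Real.exp_pos _).le)).symm
  have hpos := integral_exp_pos hi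
  have hfm : Measurable fun x : Fin N → X =>
      ENNReal.ofReal (Real.exp (-fluctuationEnergy W μ x)) :=
    (kW.measurable_fluctuationEnergy N).neg.exp.ennreal_ofReal
  rw [hZ, ← ENNReal.ofReal_inv_of_pos hpos, ← withDensity_smul _ hfm, Measure.tilted]
  congr 1
  ext x
  rw [Pi.smul_apply, smul_eq_mul, ← ENNReal.ofReal_mul (inv_pos.2 hpos).le, div_eq_inv_mul]

/-- With `Z = ∫ e^{-I} dP`, the first divergence equals `∫ I dP + log Z = -w/2 + log Z`, and `log Z
≤ Z - 1 ≤ B`. Its nonnegativity yields `log Z ≥ w/2`, needed for the second one, where `-I ≤ e^{-I}`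
reduces `∫ -I dM` to `Z⁻¹ ∫ e^{-2I} dP`. -/
theorem IsIntegrableKernel.klDiv_le (kW : IsIntegrableKernel W μ) (hN : 1 ≤ N)
    (hB : ∫⁻ x : Fin N → X,
      ENNReal.ofReal (Real.exp (-2 * fluctuationEnergy W μ x)) ∂(Measure.pi fun _ => μ)
        ≤ ENNReal.ofReal B) (hB0 : 0 ≤ B) {w : ℝ} (hw : w = ∫ z, W z.1 z.2 ∂(μ.prod μ)) :
    klDiv (Measure.pi fun _ => μ)
      ((Measure.pi fun _ : Fin N => μ).tilted fun x => -fluctuationEnergy W μ x)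
        ≤ ENNReal.ofReal (B + |w|) ∧
    klDiv ((Measure.pi fun _ : Fin N => μ).tilted fun x => -fluctuationEnergy W μ x)
      (Measure.pi fun _ => μ) ≤ ENNReal.ofReal (B * Real.exp |w| + |w|) := by
  set P : Measure (Fin N → X) := Measure.pi fun _ : Fin N => μ with hP
  set I : (Fin N → X) → ℝ := fun x => fluctuationEnergy W μ x with hI
  obtain ⟨i1, i2⟩ := kW.integrable_exp hB hB0
  obtain ⟨iI, eI⟩ := kW.integral_fluctuationEnergy hN
  have hm := kW.measurable_fluctuationEnergy N
  set Z := ∫ x, Real.exp (-I x) ∂P with hZ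
  have hZpos : 0 < Z := integral_exp_pos i1
  have hZle : Z ≤ 1 + B := by
    have h1 := relPartition_le hB hB0
    have h2 := ofReal_integral_eq_lintegral_ofReal i1 (ae_of_all _ fun _ => (Real.exp_pos _).le)
    rw [relPartition, ← h2] at h1
    exact (ENNReal.ofReal_le_ofReal_iff (by linarith)).1 h1
  have i2B : ∫ x, Real.exp (-2 * I x) ∂P ≤ B := by
    have h2 := ofReal_integral_eq_lintegral_ofReal i2 (ae_of_all _ fun _ => (Real.exp_pos _).le)
    rw [← h2] at hB
    exact (ENNReal.ofReal_le_ofReal_iff hB0).1 hB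
  set M := P.tilted fun x => -I x with hM
  have hMP : IsProbabilityMeasure M := isProbabilityMeasure_tilted i1
  have hllr0 : Integrable (llr P P) P := (integrable_zero _ _ _).congr (llr_self P).symm
  have hllr0' : ∫ x, llr P P x ∂P = 0 := by
    rw [integral_congr_ae (llr_self P)]; simp
  have acPM : P ≪ M := absolutelyContinuous_tilted i1
  have acMP : M ≪ P := tilted_absolutelyContinuous _ _
  have hPM := integrable_llr_tilted_right (Measure.AbsolutelyContinuous.refl P) iI.neg hllr0 i1
  have ePM := integral_llr_tilted_right (Measure.AbsolutelyContinuous.refl P) iI.neg i1 hllr0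
  have hnonneg := integral_llr_add_sub_measure_univ_nonneg acPM hPM
  have ePM' : ∫ x, llr P M x ∂P = -(1 / 2) * w + Real.log Z := by
    rw [hM]
    refine ePM.trans ?_
    rw [hllr0']
    simp only [Pi.neg_apply, integral_neg]
    rw [eI, ← hw]
    ring
  have hlogZ : Real.log Z ≤ B := by linarith [Real.log_le_sub_one_of_pos hZpos]
  refine ⟨?_, ?_⟩
  · rw [klDiv_of_ac_of_integrable acPM hPM]
    refine ENNReal.ofReal_le_ofReal ?_
    simp only [probReal_univ]
    have := neg_abs_le w
    have := abs_nonneg w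
    rw [ePM']
    linarith
  · have hlogZ2 : w / 2 ≤ Real.log Z := by
      simp only [probReal_univ] at hnonneg
      rw [ePM'] at hnonneg
      linarith
    have hZlow : Real.exp (-|w|) ≤ Z := by
      rw [← Real.log_le_log_iff (Real.exp_pos _) hZpos, Real.log_exp]
      have := neg_abs_le w
      have := abs_nonneg w
      linarith
    have hae := llr_tilted_left (Measure.AbsolutelyContinuous.refl P) i1 hm.neg.aemeasurable
    have hae' : llr M P =ᵐ[M] fun x => -I x - Real.log Z := by
      filter_upwards [acMP.ae_le hae, acMP.ae_le (llr_self P)] with x h1 h2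
      refine h1.trans ?_
      rw [h2, Pi.zero_apply, add_zero]
    have iIM : Integrable (fun x => -I x) M := by
      rw [hM, integrable_tilted_iff i1]
      -- `|I| e^{-I}` is at most `1` where `I ≥ 0`, and at most `e^{-2I}` where `I ≤ 0`.
      refine Integrable.mono' (g := fun x => Real.exp (-2 * I x) + 1) (i2.add (integrable_const _))
        (hm.neg.exp.smul hm.neg).aestronglyMeasurable (ae_of_all _ fun x => ?_)
      rw [smul_eq_mul, norm_mul, Real.norm_of_nonneg (Real.exp_pos _).le, norm_neg,
        Real.norm_eq_abs]
      have e2 : Real.exp (-2 * I x) = Real.exp (-I x) ^ 2 := by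
        rw [← Real.exp_nat_mul]; congr 1; ring
      have hpos := Real.exp_pos (-I x)
      rcases le_total 0 (I x) with h0 | h0
      · rw [abs_of_nonneg h0]
        have h1 := Real.add_one_le_exp (I x)
        have h2 : Real.exp (-I x) * Real.exp (I x) = 1 := by rw [← Real.exp_add]; simp
        nlinarith
      · rw [abs_of_nonpos h0, e2]
        have h1 := Real.add_one_le_exp (-I x)
        nlinarith
    have hint : Integrable (llr M P) M := (iIM.sub (integrable_const _)).congr hae'.symm
    have heq : ∫ x, llr M P x ∂M = ∫ x, -I x ∂M - Real.log Z := by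
      rw [integral_congr_ae hae', integral_sub iIM (integrable_const _)]
      simp
    have hle : ∫ x, -I x ∂M ≤ B * Real.exp |w| := by
      have iexp : Integrable (fun x => Real.exp (-I x)) M := by
        rw [hM, integrable_tilted_iff i1]
        refine i2.congr (ae_of_all _ fun x => ?_)
        simp only [smul_eq_mul]
        rw [← Real.exp_add]
        congr 1
        ring
      calc ∫ x, -I x ∂M ≤ ∫ x, Real.exp (-I x) ∂M := by
            refine integral_mono iIM iexp fun x => ?_
            linarith [Real.add_one_le_exp (-I x)]
        _ = (∫ x, Real.exp (-2 * I x) ∂P) / Z := by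
            rw [hM, integral_exp_tilted]
            congr 2
            ext x
            simp only [Pi.add_apply]
            congr 1
            ring
        _ ≤ B / Real.exp (-|w|) :=
            div_le_div₀ hB0 i2B (Real.exp_pos _) hZlow
        _ = B * Real.exp |w| := by rw [Real.exp_neg, div_inv_eq_mul]
    rw [klDiv_of_ac_of_integrable acMP hint]
    refine ENNReal.ofReal_le_ofReal ?_
    simp only [probReal_univ]
    rw [heq]
    have := neg_abs_le w
    have := abs_nonneg w
    linarith

end Entropy


/-! ### Tensorisation of transport-entropy inequalities -/

section Transport

theorem transportCost_le {Y : Type*} [MeasurableSpace Y] {c : Y → Y → ℝ≥0∞} {P Q : Measure Y}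
    (π : Measure (Y × Y)) (h1 : π.map Prod.fst = P) (h2 : π.map Prod.snd = Q) :
    transportCost c P Q ≤ ∫⁻ z, c z.1 z.2 ∂π :=
  (iInf_le _ π).trans ((iInf_le _ h1).trans (iInf_le _ h2))

theorem exists_coupling_of_lt {Y : Type*} [MeasurableSpace Y] {c : Y → Y → ℝ≥0∞}
    {P Q : Measure Y} {b : ℝ≥0∞} (h : transportCost c P Q < b) :
    ∃ π : Measure (Y × Y), π.map Prod.fst = P ∧ π.map Prod.snd = Q ∧
      ∫⁻ z, c z.1 z.2 ∂π < b := by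
  simp only [transportCost, iInf_lt_iff] at h
  obtain ⟨π, h1, h2, h3⟩ := h
  exact ⟨π, h1, h2, h3⟩

/-- Uniform integrability of `w` over all measures dominated by `C • P`: the part where `w` is large
is small by domination, the rest by the small total mass. -/
theorem lintegral_le_of_measure_le {Y : Type*} [MeasurableSpace Y] {P : Measure Y}
    {w : Y → ℝ≥0∞} (hw : Measurable w) (hwP : ∫⁻ x, w x ∂P ≠ ∞) {C : ℝ≥0∞} (hC : C ≠ ∞)
    {η : ℝ≥0∞} (hη : η ≠ 0) :
    ∃ δ : ℝ≥0∞, 0 < δ ∧ ∀ α : Measure Y, α ≤ C • P → α univ ≤ δ → ∫⁻ x, w x ∂α ≤ η := by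
  have hη2 : η / 2 ≠ 0 := by simp [hη]
  have hC1 : C + 1 ≠ ∞ := ENNReal.add_ne_top.2 ⟨hC, ENNReal.one_ne_top⟩
  obtain ⟨δ₀, hδ₀, h₀⟩ := exists_pos_setLIntegral_lt_of_measure_lt hwP
    (ε := η / 2 / (C + 1)) (ENNReal.div_pos hη2 hC1).ne'
  -- The level `M + 1` is chosen so that Markov's inequality makes `{w ≥ M + 1}` of `P`-measure less
  -- than `δ₀`.
  obtain ⟨M, hM⟩ : ∃ M : ℕ, (∫⁻ x, w x ∂P) / ((M : ℝ≥0∞) + 1) < δ₀ := by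
    have : Tendsto (fun M : ℕ => (∫⁻ x, w x ∂P) / ((M + 1 : ℕ) : ℝ≥0∞)) atTop (𝓝 0) :=
      (ENNReal.Tendsto.const_div ENNReal.tendsto_nat_nhds_top (Or.inr hwP)).comp
        (tendsto_add_atTop_nat 1) |>.trans (by simp)
    obtain ⟨M, hM⟩ := (this.eventually (gt_mem_nhds hδ₀)).exists
    exact ⟨M, by simpa using hM⟩
  have hM0 : (M : ℝ≥0∞) + 1 ≠ 0 := by simp
  have hMt : (M : ℝ≥0∞) + 1 ≠ ∞ := by simp
  refine ⟨η / 2 / (M + 1), ENNReal.div_pos hη2 hMt, fun α hα hαδ => ?_⟩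
  set s : Set Y := {x | (M : ℝ≥0∞) + 1 ≤ w x} with hs
  have hsm : MeasurableSet s := measurableSet_le measurable_const hw
  have hPs : P s < δ₀ := (meas_ge_le_lintegral_div hw.aemeasurable hM0 hMt).trans_lt hM
  rw [← lintegral_add_compl w hsm]
  have h1 : ∫⁻ x in s, w x ∂α ≤ η / 2 := by
    calc ∫⁻ x in s, w x ∂α ≤ ∫⁻ x in s, w x ∂(C • P) :=
          lintegral_mono' (Measure.restrict_mono le_rfl hα) le_rfl
      _ = C * ∫⁻ x in s, w x ∂P := by
          rw [Measure.restrict_smul, lintegral_smul_measure, smul_eq_mul]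
      _ ≤ (C + 1) * (η / 2 / (C + 1)) := mul_le_mul' le_self_add (h₀ s hPs).le
      _ = η / 2 := ENNReal.mul_div_cancel (by simp) hC1
  have h2 : ∫⁻ x in sᶜ, w x ∂α ≤ η / 2 := by
    calc ∫⁻ x in sᶜ, w x ∂α ≤ ∫⁻ _x in sᶜ, ((M : ℝ≥0∞) + 1) ∂α :=
          setLIntegral_mono measurable_const fun x hx =>
            (not_le.1 (show ¬ (M : ℝ≥0∞) + 1 ≤ w x from hx)).le
      _ = ((M : ℝ≥0∞) + 1) * α sᶜ := setLIntegral_const _ _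
      _ ≤ ((M : ℝ≥0∞) + 1) * (η / 2 / (M + 1)) := by
          gcongr
          exact (measure_mono (subset_univ _)).trans hαδ
      _ = η / 2 := ENNReal.mul_div_cancel hM0 hMt
  calc _ ≤ η / 2 + η / 2 := add_le_add h1 h2
    _ = η := ENNReal.add_halves η

theorem map_fst_withDensity {Y Z : Type*} [MeasurableSpace Y] [MeasurableSpace Z]
    (π : Measure (Y × Z)) {r : Y → ℝ≥0∞} (hr : Measurable r) :
    (π.withDensity fun z => r z.1).map Prod.fst = (π.map Prod.fst).withDensity r := by
  ext s hs
  rw [Measure.map_apply measurable_fst hs, withDensity_apply _ (measurable_fst hs),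
    withDensity_apply _ hs, setLIntegral_map hs hr measurable_fst]

/-- The transport cost to a fixed measure is lower semicontinuous along densities. -/
theorem transportCost_le_add {Y : Type*} [MeasurableSpace Y] {P : Measure Y}
    [IsProbabilityMeasure P] {c : Y → Y → ℝ≥0∞} {w : Y → ℝ≥0∞} (hw : Measurable w)
    (hcw : ∀ x y, c x y ≤ 2 * (w x + w y)) (hwP : ∫⁻ x, w x ∂P ≠ ∞)
    {f : Y → ℝ≥0∞} (hf : Measurable f) {C : ℝ≥0∞} (hC : C ≠ ∞) (hfC : ∀ x, f x ≤ C)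
    (hf1 : ∫⁻ x, f x ∂P = 1) {η : ℝ≥0∞} (hη : η ≠ 0) :
    ∃ δ : ℝ≥0∞, 0 < δ ∧ ∀ g : Y → ℝ≥0∞, Measurable g → (∀ x, g x ≠ 0) → (∀ x, g x ≠ ∞) →
      ∫⁻ x, g x ∂P = 1 → ∫⁻ x, (f x - g x) ∂P ≤ δ →
        transportCost c (P.withDensity f) P ≤ transportCost c (P.withDensity g) P + η := by
  have hη4 : η / 4 ≠ 0 := by simp [hη]
  obtain ⟨δ, hδ, h⟩ := lintegral_le_of_measure_le hw hwP (C := C + 1)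
    (ENNReal.add_ne_top.2 ⟨hC, ENNReal.one_ne_top⟩) hη4
  refine ⟨δ, hδ, fun g hg hg0 hgt hg1 hfg => ?_⟩
  rw [← tsub_le_iff_right]
  refine le_iInf fun π => le_iInf fun hπ1 => le_iInf fun hπ2 => ?_
  rw [tsub_le_iff_right]
  -- From a coupling `π` of `g P` and `P`, keep the fraction `r` that transports the common mass
  -- `min f g`. The leftovers `α` on the left and `β` on the right have equal mass and are coupled
  -- by their normalised product.
  set r : Y → ℝ≥0∞ := fun x => min (f x) (g x) / g x with hr
  have hrm : Measurable r := (hf.min hg).div hg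
  have hr1 : ∀ x, r x ≤ 1 := fun x => ENNReal.div_le_of_le_mul (by simp)
  have hgr : ∀ x, g x * r x = min (f x) (g x) := fun x => ENNReal.mul_div_cancel (hg0 x) (hgt x)
  set π₁ := π.withDensity fun z => r z.1 with hπ₁
  set β := (π.withDensity fun z => 1 - r z.1).map Prod.snd with hβ
  set α := P.withDensity fun x => f x - g x with hα
  have hsplit : π₁ + π.withDensity (fun z => 1 - r z.1) = π := by
    have hrm1 : Measurable fun z : Y × Y => r z.1 := hrm.comp measurable_fst
    rw [hπ₁, ← withDensity_add_left hrm1]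
    have : ((fun z : Y × Y => r z.1) + fun z : Y × Y => 1 - r z.1) = 1 := by
      ext z
      simp only [Pi.add_apply, Pi.one_apply]
      exact add_tsub_cancel_of_le (hr1 _)
    rw [this, withDensity_one]
  have hfst : π₁.map Prod.fst = P.withDensity fun x => min (f x) (g x) := by
    rw [hπ₁, map_fst_withDensity π hrm, hπ1, ← withDensity_mul _ hg hrm]
    congr 1
    ext x
    exact hgr x
  have hsnd : π₁.map Prod.snd + β = P := by
    rw [hβ, ← Measure.map_add _ _ measurable_snd, hsplit, hπ2]
  have hαf : P.withDensity (fun x => min (f x) (g x)) + α = P.withDensity f := by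
    rw [hα, ← withDensity_add_left (hf.min hg)]
    congr 1
    ext x
    rcases le_total (f x) (g x) with hle | hle
    · simp [hle, tsub_eq_zero_of_le hle]
    · simp only [Pi.add_apply, min_eq_right hle]
      exact add_tsub_cancel_of_le hle
  have hαu : α univ = ∫⁻ x, (f x - g x) ∂P := by
    rw [hα, withDensity_apply _ MeasurableSet.univ, Measure.restrict_univ]
  have hm1 : π₁ univ = (P.withDensity fun x => min (f x) (g x)) univ := by
    rw [← hfst, Measure.map_apply measurable_fst MeasurableSet.univ, preimage_univ]
  have e1 : π₁ univ + α univ = 1 := by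
    rw [hm1, ← Measure.add_apply, hαf, withDensity_apply _ MeasurableSet.univ,
      Measure.restrict_univ, hf1]
  have e2 : π₁ univ + β univ = 1 := by
    have := congrArg (fun ν : Measure Y => ν univ) hsnd
    simp only [Measure.add_apply, Measure.map_apply measurable_snd MeasurableSet.univ,
      preimage_univ, measure_univ] at this
    exact this
  have hfin : π₁ univ ≠ ∞ := fun h => by rw [h] at e1; simp at e1
  have hαβ : α univ = β univ := (ENNReal.add_right_inj hfin).1 (e1.trans e2.symm)
  set τ := α univ with hτ
  have hτfin : τ ≠ ∞ := fun h => by rw [h] at e1; simp at e1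
  have : IsFiniteMeasure α := ⟨hτfin.lt_top⟩
  have : IsFiniteMeasure β := ⟨by rw [← hαβ]; exact hτfin.lt_top⟩
  -- When `τ = 0` the normalisation `τ⁻¹` is infinite, but then `ν = 0`.
  have hinv : ∀ ν : Measure Y, ν univ = τ → τ⁻¹ • (τ • ν) = ν := by
    intro ν hν
    rcases eq_or_ne τ 0 with h0 | h0
    · rw [h0] at hν
      rw [Measure.measure_univ_eq_zero.1 hν]
      simp
    · rw [smul_smul, ENNReal.inv_mul_cancel h0 hτfin, one_smul]
  have hαC : α ≤ (C + 1) • P := by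
    rw [hα, ← withDensity_const]
    exact withDensity_mono (ae_of_all _ fun x => tsub_le_self.trans ((hfC x).trans le_self_add))
  have hβC : β ≤ (C + 1) • P := by
    have h1 : β ≤ P := by
      rw [← hsnd]
      exact Measure.le_add_left le_rfl
    refine h1.trans ?_
    intro s
    rw [Measure.smul_apply, smul_eq_mul]
    exact le_mul_of_one_le_left zero_le le_add_self
  have hwα := h α hαC (hαu.le.trans hfg)
  have hwβ := h β hβC (hαβ.ge.trans (hαu.le.trans hfg))
  refine (transportCost_le (π₁ + τ⁻¹ • α.prod β) ?_ ?_).trans ?_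
  · rw [Measure.map_add _ _ measurable_fst, Measure.map_smul, Measure.map_fst_prod, hfst,
      ← hαβ, hinv α rfl, hαf]
  · rw [Measure.map_add _ _ measurable_snd, Measure.map_smul, Measure.map_snd_prod,
      ← hτ, hinv β hαβ.symm, hsnd]
  · rw [lintegral_add_measure, lintegral_smul_measure]
    have c1 : ∫⁻ z, c z.1 z.2 ∂π₁ ≤ ∫⁻ z, c z.1 z.2 ∂π :=
      lintegral_mono' (hsplit ▸ Measure.le_add_right le_rfl) le_rfl
    -- Both leftovers are dominated by `(C + 1) • P` and have mass at most `δ`, so each weight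
    -- integral is at most `η / 4`; the factor `2` of the cost bound and the two terms give `τ η`.
    have c2 : ∫⁻ z, c z.1 z.2 ∂(α.prod β) ≤ τ * η := by
      calc ∫⁻ z, c z.1 z.2 ∂(α.prod β) ≤ ∫⁻ z, 2 * (w z.1 + w z.2) ∂(α.prod β) :=
            lintegral_mono fun z => hcw _ _
        _ = 2 * (τ * (∫⁻ x, w x ∂α) + τ * ∫⁻ x, w x ∂β) := by
            have m1 : Measurable fun z : Y × Y => w z.1 := hw.comp measurable_fst
            have m3 : Measurable fun z : Y × Y => w z.2 := hw.comp measurable_snd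
            have m2 : Measurable fun z : Y × Y => w z.1 + w z.2 := m1.add m3
            rw [lintegral_const_mul _ m2, lintegral_add_left m1]
            have l1 : ∫⁻ z : Y × Y, w z.1 ∂(α.prod β) = τ * ∫⁻ x, w x ∂α := by
              rw [lintegral_prod _ m1.aemeasurable]
              simp only [lintegral_const, ← hαβ]
              rw [lintegral_mul_const _ hw, mul_comm]
            have l2 : ∫⁻ z : Y × Y, w z.2 ∂(α.prod β) = τ * ∫⁻ x, w x ∂β := by
              rw [lintegral_prod _ m3.aemeasurable]
              simp only [lintegral_const]
              rw [mul_comm]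
            rw [l1, l2]
        _ ≤ 2 * (τ * (η / 4) + τ * (η / 4)) := by gcongr
        _ = τ * η := by
            have : η = 4 * (η / 4) := (ENNReal.mul_div_cancel (by norm_num) (by norm_num)).symm
            conv_rhs => rw [this]
            ring
    have c3 : τ⁻¹ • ∫⁻ z, c z.1 z.2 ∂(α.prod β) ≤ η := by
      rw [smul_eq_mul]
      rcases eq_or_ne τ 0 with h0 | h0
      · rw [h0, zero_mul] at c2
        rw [nonpos_iff_eq_zero.1 c2, mul_zero]
        exact zero_le
      · calc τ⁻¹ * ∫⁻ z, c z.1 z.2 ∂(α.prod β) ≤ τ⁻¹ * (τ * η) := by gcongr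
          _ = η := by rw [← mul_assoc, ENNReal.inv_mul_cancel h0 hτfin, one_mul]
    exact add_le_add c1 c3

/-- `f` is a probability density with respect to `P` with values in `[c, C]`. -/
structure IsBoundedDensity {Y : Type*} [MeasurableSpace Y] (P : Measure Y) (f : Y → ℝ)
    (c C : ℝ) : Prop where
  measurable : Measurable f
  lower : ∀ x, c ≤ f x
  upper : ∀ x, f x ≤ C
  integral_eq : ∫ x, f x ∂P = 1

/-! ### Entropy of densities with two-sided bounds. -/

section

variable {Y : Type*} [MeasurableSpace Y] {P : Measure Y} [IsProbabilityMeasure P]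
  {f : Y → ℝ} {c C : ℝ}

theorem abs_mul_log_le {x C : ℝ} (h0 : 0 ≤ x) (hC : x ≤ C) : |x * Real.log x| ≤ 1 + C ^ 2 := by
  rcases h0.eq_or_lt with rfl | hpos
  · simp only [zero_mul, abs_zero]; positivity
  have h1 := Real.log_le_sub_one_of_pos hpos
  have h2 := Real.one_sub_inv_le_log_of_pos hpos
  have h3 : x * (1 - x⁻¹) = x - 1 := by field_simp
  have h4 := mul_le_mul_of_nonneg_left h2 h0
  have h5 := mul_le_mul_of_nonneg_left h1 h0
  rw [abs_le]
  constructor <;> nlinarith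

theorem sub_one_le_mul_log {x : ℝ} (h0 : 0 ≤ x) : x - 1 ≤ x * Real.log x := by
  rcases h0.eq_or_lt with rfl | hpos
  · simp
  have h2 := Real.one_sub_inv_le_log_of_pos hpos
  have h3 : x * (1 - x⁻¹) = x - 1 := by field_simp
  have h4 := mul_le_mul_of_nonneg_left h2 h0
  linarith

theorem IsBoundedDensity.nonneg (h : IsBoundedDensity P f c C) (hc : 0 ≤ c) (x : Y) : 0 ≤ f x :=
  hc.trans (h.lower x)

theorem IsBoundedDensity.integrable (h : IsBoundedDensity P f c C) (hc : 0 ≤ c) :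
    Integrable f P :=
  Integrable.of_bound h.measurable.aestronglyMeasurable C (ae_of_all _ fun x => by
    rw [Real.norm_of_nonneg (h.nonneg hc x)]; exact h.upper x)

theorem IsBoundedDensity.measurable_mul_log (h : IsBoundedDensity P f c C) :
    Measurable fun x => f x * Real.log (f x) :=
  h.measurable.mul (Real.measurable_log.comp h.measurable)

theorem IsBoundedDensity.integrable_mul_log (h : IsBoundedDensity P f c C) (hc : 0 ≤ c) :
    Integrable (fun x => f x * Real.log (f x)) P :=
  Integrable.of_bound h.measurable_mul_log.aestronglyMeasurable (1 + C ^ 2)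
    (ae_of_all _ fun x => abs_mul_log_le (h.nonneg hc x) (h.upper x))

theorem IsBoundedDensity.entropy_nonneg (h : IsBoundedDensity P f c C) (hc : 0 ≤ c) :
    0 ≤ ∫ x, f x * Real.log (f x) ∂P := by
  have : ∫ x, f x - 1 ∂P ≤ ∫ x, f x * Real.log (f x) ∂P :=
    integral_mono ((h.integrable hc).sub (integrable_const _)) (h.integrable_mul_log hc)
      fun x => sub_one_le_mul_log (h.nonneg hc x)
  rw [integral_sub (h.integrable hc) (integrable_const _), h.integral_eq] at this
  simpa using this

theorem IsBoundedDensity.lintegral_eq (h : IsBoundedDensity P f c C) (hc : 0 ≤ c) :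
    ∫⁻ x, ENNReal.ofReal (f x) ∂P = 1 := by
  rw [← ofReal_integral_eq_lintegral_ofReal (h.integrable hc) (ae_of_all _ (h.nonneg hc)),
    h.integral_eq, ENNReal.ofReal_one]

theorem IsBoundedDensity.isProbabilityMeasure (h : IsBoundedDensity P f c C) (hc : 0 ≤ c) :
    IsProbabilityMeasure (P.withDensity fun x => ENNReal.ofReal (f x)) :=
  ⟨by rw [withDensity_apply _ MeasurableSet.univ, Measure.restrict_univ, h.lintegral_eq hc]⟩

theorem IsBoundedDensity.klDiv_eq (h : IsBoundedDensity P f c C) (hc : 0 ≤ c) :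
    klDiv (P.withDensity fun x => ENNReal.ofReal (f x)) P
      = ENNReal.ofReal (∫ x, f x * Real.log (f x) ∂P) := by
  have hP := h.isProbabilityMeasure hc
  set Q := P.withDensity fun x => ENNReal.ofReal (f x) with hQ
  have hac : Q ≪ P := withDensity_absolutelyContinuous _ _
  have hrn : (fun x => (Q.rnDeriv P x).toReal * Real.log (Q.rnDeriv P x).toReal)
      =ᵐ[P] fun x => f x * Real.log (f x) := by
    filter_upwards [Measure.rnDeriv_withDensity P h.measurable.ennreal_ofReal] with x hx
    rw [hQ, hx, ENNReal.toReal_ofReal (h.nonneg hc x)]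
  have hint : Integrable (llr Q P) Q :=
    (integrable_rnDeriv_mul_log_iff hac).1 ((h.integrable_mul_log hc).congr hrn.symm)
  rw [klDiv_of_ac_of_integrable hac hint, ← integral_rnDeriv_mul_log hac, integral_congr_ae hrn]
  simp

end

/-- The transport-entropy inequality with constant `K` for bounded densities, for a cost
controlled by an integrable weight. -/
structure IsTransportEntropy {Y : Type*} [MeasurableSpace Y] (P : Measure Y)
    (cost : Y → Y → ℝ≥0∞) (w : Y → ℝ≥0∞) (K : ℝ≥0) : Prop where
  measurable_cost : Measurable fun z : Y × Y => cost z.1 z.2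
  measurable_weight : Measurable w
  cost_le : ∀ x y, cost x y ≤ 2 * (w x + w y)
  weight_ne_top : ∫⁻ x, w x ∂P ≠ ∞
  le : ∀ (f : Y → ℝ) (c C : ℝ), 0 < c → IsBoundedDensity P f c C →
    transportCost cost (P.withDensity fun x => ENNReal.ofReal (f x)) P
      ≤ K * ENNReal.ofReal (∫ x, f x * Real.log (f x) ∂P)

theorem ofReal_sub_ofReal_le (a b : ℝ) :
    ENNReal.ofReal a - ENNReal.ofReal b ≤ ENNReal.ofReal |a - b| := by
  rw [tsub_le_iff_right]
  rcases le_total b 0 with hb | hb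
  · rcases le_total a 0 with ha | ha
    · rw [ENNReal.ofReal_of_nonpos ha]; exact zero_le
    · refine (ENNReal.ofReal_le_ofReal ?_).trans le_self_add
      exact le_trans (by linarith) (le_abs_self _)
  · rw [← ENNReal.ofReal_add (abs_nonneg _) hb]
    exact ENNReal.ofReal_le_ofReal (by linarith [le_abs_self (a - b)])

/-- The inequality extends to densities which are not bounded away from zero. -/
theorem IsTransportEntropy.le_of_nonneg {Y : Type*} [MeasurableSpace Y] {P : Measure Y}
    [IsProbabilityMeasure P] {cost : Y → Y → ℝ≥0∞} {w : Y → ℝ≥0∞} {K : ℝ≥0}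
    (H : IsTransportEntropy P cost w K) {f : Y → ℝ} {C : ℝ} (hf : IsBoundedDensity P f 0 C) :
    transportCost cost (P.withDensity fun x => ENNReal.ofReal (f x)) P
      ≤ K * ENNReal.ofReal (∫ x, f x * Real.log (f x) ∂P) := by
  refine ENNReal.le_of_forall_pos_le_add fun η hη _ => ?_
  obtain ⟨δ, hδ, h⟩ := transportCost_le_add (c := cost) H.measurable_weight H.cost_le
    H.weight_ne_top hf.measurable.ennreal_ofReal (C := ENNReal.ofReal C) ENNReal.ofReal_ne_top
    (fun x => ENNReal.ofReal_le_ofReal (hf.upper x)) (hf.lintegral_eq le_rfl)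
    (η := η) (by simpa using hη.ne')
  obtain ⟨t, ht0, ht⟩ : ∃ t : ℝ, 0 < t ∧ ENNReal.ofReal (2 * t) ≤ δ := by
    obtain ⟨q, hq0, hq⟩ := ENNReal.lt_iff_exists_nnreal_btwn.1 hδ
    refine ⟨q / 2, by simpa using hq0, ?_⟩
    rw [mul_div_cancel₀ _ (two_ne_zero' ℝ), ENNReal.ofReal_coe_nnreal]
    exact hq.le
  have ht1 : 0 < 1 + t := by linarith
  -- Mixing with the constant density `1` gives a positive lower bound. Convexity of `x log x`,
  -- which vanishes at `1`, keeps the entropy from increasing, and the `L¹` error is at most `2 t`.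
  set g : Y → ℝ := fun x => (f x + t) / (1 + t) with hg
  have hfi := hf.integrable le_rfl
  have hgd : IsBoundedDensity P g (t / (1 + t)) ((C + t) / (1 + t)) := by
    refine ⟨(hf.measurable.add_const t).div_const _, fun x => ?_, fun x => ?_, ?_⟩
    · exact div_le_div_of_nonneg_right (by linarith [hf.lower x]) ht1.le
    · exact div_le_div_of_nonneg_right (by linarith [hf.upper x]) ht1.le
    · simp only [hg]
      rw [integral_div, integral_add hfi (integrable_const _), hf.integral_eq]
      simp [ht1.ne']
  have hg0 : 0 < t / (1 + t) := div_pos ht0 ht1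
  have hent : ∫ x, g x * Real.log (g x) ∂P ≤ ∫ x, f x * Real.log (f x) ∂P := by
    have hconv : ∀ x, g x * Real.log (g x) ≤ (1 + t)⁻¹ * (f x * Real.log (f x)) := by
      intro x
      have := Real.convexOn_mul_log.2 (hf.lower x) (zero_le_one (α := ℝ))
        (inv_pos.2 ht1).le (div_pos ht0 ht1).le (by field_simp)
      simp only [smul_eq_mul, Real.log_one, mul_zero, add_zero, mul_one] at this
      have e : (1 + t)⁻¹ * f x + t / (1 + t) = g x := by
        simp only [hg]; field_simp
      rwa [e] at this
    have h1 : ∫ x, g x * Real.log (g x) ∂P ≤ ∫ x, (1 + t)⁻¹ * (f x * Real.log (f x)) ∂P :=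
      integral_mono (hgd.integrable_mul_log hg0.le) ((hf.integrable_mul_log le_rfl).const_mul _)
        hconv
    rw [integral_const_mul] at h1
    refine h1.trans (mul_le_of_le_one_left (hf.entropy_nonneg le_rfl) ?_)
    exact inv_le_one_of_one_le₀ (by linarith)
  have hclose : ∫⁻ x, (ENNReal.ofReal (f x) - ENNReal.ofReal (g x)) ∂P ≤ δ := by
    have hpt : ∀ x, |f x - g x| ≤ t * (f x + 1) := fun x => by
      have e : f x - g x = t * ((f x - 1) / (1 + t)) := by
        simp only [hg]; field_simp; ring
      rw [e, abs_mul, abs_of_pos ht0]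
      gcongr
      rw [abs_div, abs_of_pos ht1, div_le_iff₀ ht1, abs_le]
      have := hf.lower x
      constructor <;> nlinarith
    calc ∫⁻ x, (ENNReal.ofReal (f x) - ENNReal.ofReal (g x)) ∂P
        ≤ ∫⁻ x, ENNReal.ofReal (t * (f x + 1)) ∂P := lintegral_mono fun x =>
          (ofReal_sub_ofReal_le _ _).trans (ENNReal.ofReal_le_ofReal (hpt x))
      _ = ENNReal.ofReal (2 * t) := by
          have hi2 : Integrable (fun x => t * (f x + 1)) P :=
            (hfi.add (integrable_const 1)).const_mul t
          rw [← ofReal_integral_eq_lintegral_ofReal hi2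
            (ae_of_all _ fun x => mul_nonneg ht0.le (by linarith [hf.lower x]))]
          rw [integral_const_mul, integral_add hfi (integrable_const _), hf.integral_eq,
            integral_const, probReal_univ]
          congr 1
          simp only [smul_eq_mul]
          ring
      _ ≤ δ := ht
  refine (h _ hgd.measurable.ennreal_ofReal (fun x => ?_) (fun x => ENNReal.ofReal_ne_top)
    (hgd.lintegral_eq hg0.le) hclose).trans ?_
  · simpa using hg0.trans_le (hgd.lower x)
  · gcongr
    exact (H.le g _ _ hg0 hgd).trans (by gcongr)

/-- A family of bounded densities depending measurably on a parameter can be approximated in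
`L¹` and in entropy by countably many of its members, selected measurably. -/
theorem exists_measurable_selection {Y X : Type*} [MeasurableSpace Y] [MeasurableSpace X]
    [MeasurableSpace.CountablyGenerated X] [Nonempty Y] {μ : Measure X} [IsProbabilityMeasure μ]
    {g : Y → X → ℝ} (hg : Measurable fun z : Y × X => g z.1 z.2) {c C : ℝ} (hc : 0 ≤ c)
    (hgd : ∀ y, IsBoundedDensity μ (g y) c C) {η : ℝ} (hη : 0 < η) :
    ∃ (p : ℕ → Y) (k : Y → ℕ), Measurable k ∧ ∀ y, ∫ x, |g y x - g (p (k y)) x| ∂μ < η ∧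
      ∫ x, g (p (k y)) x * Real.log (g (p (k y)) x) ∂μ
        < (∫ x, g y x * Real.log (g y x) ∂μ) + η := by
  set e : Y → ℝ := fun y => ∫ x, g y x * Real.log (g y x) ∂μ with he
  have hem : Measurable e := by
    have : Measurable fun z : Y × X => g z.1 z.2 * Real.log (g z.1 z.2) :=
      hg.mul (Real.measurable_log.comp hg)
    exact (this.stronglyMeasurable.integral_prod_right (ν := μ)).measurable
  have hmem : ∀ y, MemLp (g y) 1 μ := fun y => memLp_one_iff_integrable.2 ((hgd y).integrable hc)
  -- `L¹(μ) × ℝ` is separable since the σ-algebra of `X` is countably generated. A dense sequence in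
  -- the range of `φ` yields the parameters `p n`; `k y` is the first index that is close enough,
  -- measurable because both closeness conditions are.
  set φ : Y → Lp ℝ 1 μ × ℝ := fun y => ((hmem y).toLp, e y) with hφ
  have : Fact ((1 : ℝ≥0∞) ≤ 1) := ⟨le_rfl⟩
  have : Fact ((1 : ℝ≥0∞) ≠ ∞) := ⟨ENNReal.one_ne_top⟩
  have : Nonempty (range φ) := (range_nonempty φ).to_subtype
  have hdense := TopologicalSpace.denseRange_denseSeq (range φ)
  choose p hp using fun n => (TopologicalSpace.denseSeq (range φ) n).2
  have hex : ∀ y, ∃ n, ∫ x, |g y x - g (p n) x| ∂μ < η ∧ e (p n) < e y + η := by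
    intro y
    obtain ⟨n, hn⟩ := hdense.exists_dist_lt (⟨φ y, mem_range_self y⟩ : range φ) hη
    refine ⟨n, ?_⟩
    rw [Subtype.dist_eq, ← hp n, Prod.dist_eq, max_lt_iff] at hn
    refine ⟨?_, ?_⟩
    · have h1 := hn.1
      simp only [hφ] at h1
      rw [dist_eq_norm, ← MemLp.toLp_sub, L1.norm_eq_integral_norm] at h1
      refine lt_of_eq_of_lt (integral_congr_ae ?_) h1
      filter_upwards [MemLp.coeFn_toLp ((hmem y).sub (hmem (p n)))] with x hx
      rw [hx, Pi.sub_apply, Real.norm_eq_abs]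
    · have h2 := hn.2
      simp only [hφ, Real.dist_eq] at h2
      linarith [(abs_lt.1 h2).1]
  classical
  refine ⟨p, fun y => Nat.find (hex y), measurable_find hex fun n => ?_,
    fun y => Nat.find_spec (hex y)⟩
  have hm1 : Measurable fun y => ∫ x, |g y x - g (p n) x| ∂μ := by
    have : Measurable fun z : Y × X => |g z.1 z.2 - g (p n) z.2| :=
      (hg.sub ((hgd (p n)).measurable.comp measurable_snd)).abs
    exact (this.stronglyMeasurable.integral_prod_right (ν := μ)).measurable
  exact (measurableSet_lt hm1 measurable_const).inter
    (measurableSet_lt measurable_const (hem.add_const _))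


theorem exists_pos_ofReal_le {a : ℝ≥0∞} (ha : 0 < a) : ∃ t : ℝ, 0 < t ∧ ENNReal.ofReal t ≤ a := by
  obtain ⟨q, hq0, hq⟩ := ENNReal.lt_iff_exists_nnreal_btwn.1 ha
  refine ⟨q, by simpa using hq0, ?_⟩
  rw [ENNReal.ofReal_coe_nnreal]
  exact hq.le

/-! ### Marginal and conditional densities on a product, and the entropy chain rule. -/

section Disintegration

variable {Y X : Type*} [MeasurableSpace Y] [MeasurableSpace X]
  {P : Measure Y} [IsProbabilityMeasure P] {μ : Measure X} [IsProbabilityMeasure μ]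
  {F : Y × X → ℝ} {c C : ℝ}

/-- The density of the first marginal. -/
noncomputable def marginalDensity (μ : Measure X) (F : Y × X → ℝ) (y : Y) : ℝ := ∫ x, F (y, x) ∂μ

/-- The conditional density of the second component. -/
noncomputable def condDensity (μ : Measure X) (F : Y × X → ℝ) (y : Y) (x : X) : ℝ :=
  F (y, x) / marginalDensity μ F y

theorem IsBoundedDensity.integrable_section (h : IsBoundedDensity (P.prod μ) F c C) (hc : 0 < c)
    (y : Y) : Integrable (fun x => F (y, x)) μ :=
  Integrable.of_bound (h.measurable.comp measurable_prodMk_left).aestronglyMeasurable C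
    (ae_of_all _ fun x => by
      rw [Real.norm_of_nonneg (h.nonneg hc.le _)]; exact h.upper _)

theorem IsBoundedDensity.marginalDensity_mem (h : IsBoundedDensity (P.prod μ) F c C) (hc : 0 < c)
    (y : Y) : c ≤ marginalDensity μ F y ∧ marginalDensity μ F y ≤ C := by
  constructor
  · calc c = ∫ _x, c ∂μ := by simp
      _ ≤ _ := integral_mono (integrable_const _) (h.integrable_section hc y) fun x => h.lower _
  · calc _ ≤ ∫ _x, C ∂μ :=
        integral_mono (h.integrable_section hc y) (integrable_const _) fun x => h.upper _
      _ = C := by simp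

theorem IsBoundedDensity.marginalDensity_pos (h : IsBoundedDensity (P.prod μ) F c C) (hc : 0 < c)
    (y : Y) : 0 < marginalDensity μ F y :=
  hc.trans_le (h.marginalDensity_mem hc y).1

theorem IsBoundedDensity.measurable_marginalDensity (h : IsBoundedDensity (P.prod μ) F c C) :
    Measurable (marginalDensity μ F) :=
  (h.measurable.stronglyMeasurable.integral_prod_right' (ν := μ)).measurable

theorem IsBoundedDensity.marginalDensity (h : IsBoundedDensity (P.prod μ) F c C) (hc : 0 < c) :
    IsBoundedDensity P (marginalDensity μ F) c C where
  measurable := h.measurable_marginalDensity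
  lower y := (h.marginalDensity_mem hc y).1
  upper y := (h.marginalDensity_mem hc y).2
  integral_eq := by
    rw [← h.integral_eq, integral_prod _ (h.integrable hc.le)]
    rfl

theorem IsBoundedDensity.measurable_condDensity (h : IsBoundedDensity (P.prod μ) F c C) :
    Measurable fun z : Y × X => condDensity μ F z.1 z.2 :=
  h.measurable.div (h.measurable_marginalDensity.comp measurable_fst)

theorem IsBoundedDensity.marginalDensity_mul_condDensity (h : IsBoundedDensity (P.prod μ) F c C)
    (hc : 0 < c) (y : Y) (x : X) :
    MeanField.marginalDensity μ F y * condDensity μ F y x = F (y, x) :=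
  mul_div_cancel₀ _ (h.marginalDensity_pos hc y).ne'

theorem IsBoundedDensity.condDensity (h : IsBoundedDensity (P.prod μ) F c C) (hc : 0 < c) (y : Y) :
    IsBoundedDensity μ (condDensity μ F y) (c / C) (C / c) where
  measurable := h.measurable_condDensity.comp measurable_prodMk_left
  lower x := by
    have h1 := h.marginalDensity_mem hc y
    exact div_le_div₀ (h.nonneg hc.le _) (h.lower _) (h.marginalDensity_pos hc y) h1.2
  upper x := by
    have h1 := h.marginalDensity_mem hc y
    exact div_le_div₀ (hc.le.trans (h1.1.trans h1.2)) (h.upper _) hc h1.1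
  integral_eq := by
    simp only [MeanField.condDensity]
    rw [integral_div]
    exact div_self (h.marginalDensity_pos hc y).ne'

/-- The chain rule for the relative entropy. -/
theorem IsBoundedDensity.entropy_eq (h : IsBoundedDensity (P.prod μ) F c C) (hc : 0 < c) :
    ENNReal.ofReal (∫ z, F z * Real.log (F z) ∂(P.prod μ))
      = ENNReal.ofReal (∫ y, MeanField.marginalDensity μ F y
          * Real.log (MeanField.marginalDensity μ F y) ∂P)
        + ∫⁻ y, ENNReal.ofReal (MeanField.marginalDensity μ F y) * ENNReal.ofReal
            (∫ x, MeanField.condDensity μ F y x * Real.log (MeanField.condDensity μ F y x) ∂μ)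
          ∂P := by
  set f := MeanField.marginalDensity μ F with hf
  set g := MeanField.condDensity μ F with hg
  have hfd : IsBoundedDensity P f c C := h.marginalDensity hc
  have hfi := hfd.integrable_mul_log hc.le
  have hFi := h.integrable_mul_log hc.le
  have hcC : 0 ≤ c / C := by
    obtain ⟨y⟩ := P.nonempty_of_neZero
    exact div_nonneg hc.le (hc.le.trans ((hfd.lower y).trans (hfd.upper y)))
  have hgd : ∀ y, IsBoundedDensity μ (g y) (c / C) (C / c) := h.condDensity hc
  have hsec : ∀ y, ∫ x, F (y, x) * Real.log (F (y, x)) ∂μ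
      = f y * Real.log (f y) + f y * ∫ x, g y x * Real.log (g y x) ∂μ := by
    intro y
    have hfy : 0 < f y := h.marginalDensity_pos hc y
    have e : ∀ x, F (y, x) * Real.log (F (y, x))
        = f y * Real.log (f y) * g y x + f y * (g y x * Real.log (g y x)) := by
      intro x
      have h1 : f y * g y x = F (y, x) := h.marginalDensity_mul_condDensity hc y x
      have h2 : 0 < g y x := div_pos (hc.trans_le (h.lower _)) hfy
      rw [← h1, Real.log_mul hfy.ne' h2.ne']
      ring
    simp only [e]
    rw [integral_add (((hgd y).integrable hcC).const_mul _)
      (((hgd y).integrable_mul_log hcC).const_mul _), integral_const_mul, integral_const_mul,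
      (hgd y).integral_eq, mul_one]
  have hfei : Integrable (fun y => f y * ∫ x, g y x * Real.log (g y x) ∂μ) P := by
    refine (hFi.integral_prod_left.sub hfi).congr (ae_of_all _ fun y => ?_)
    simp only [Pi.sub_apply]
    rw [hsec y]
    ring
  have hpos : ∀ y, 0 ≤ f y * ∫ x, g y x * Real.log (g y x) ∂μ := fun y =>
    mul_nonneg (hfd.nonneg hc.le y) ((hgd y).entropy_nonneg hcC)
  rw [integral_prod _ hFi]
  simp only [hsec]
  rw [integral_add hfi hfei, ENNReal.ofReal_add (hfd.entropy_nonneg hc.le)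
    (integral_nonneg hpos), ofReal_integral_eq_lintegral_ofReal hfei (ae_of_all _ hpos)]
  simp only [ENNReal.ofReal_mul (hfd.nonneg hc.le _)]

end Disintegration

/-- Gluing a coupling in the first component with countably many couplings in the second. -/
theorem transportCost_prod_le {Y X : Type*} [MeasurableSpace Y] [MeasurableSpace X]
    {P : Measure Y} [IsProbabilityMeasure P] {μ : Measure X} [IsProbabilityMeasure μ]
    {cY : Y → Y → ℝ≥0∞} {cX : X → X → ℝ≥0∞} (hcY : Measurable fun z : Y × Y => cY z.1 z.2)
    (hcX : Measurable fun z : X × X => cX z.1 z.2) {f : Y → ℝ≥0∞} (hf : Measurable f)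
    {g : ℕ → X → ℝ≥0∞} (hg : ∀ n, Measurable (g n)) {k : Y → ℕ} (hk : Measurable k)
    {π₁ : Measure (Y × Y)} (h1 : π₁.map Prod.fst = P.withDensity f) (h2 : π₁.map Prod.snd = P)
    {π : ℕ → Measure (X × X)} (hπ1 : ∀ n, (π n).map Prod.fst = μ.withDensity (g n))
    (hπ2 : ∀ n, (π n).map Prod.snd = μ) :
    transportCost (fun z z' : Y × X => cY z.1 z'.1 + cX z.2 z'.2)
        ((P.prod μ).withDensity fun z => f z.1 * g (k z.1) z.2) (P.prod μ)
      ≤ (∫⁻ z, cY z.1 z.2 ∂π₁) + ∫⁻ y, f y * ∫⁻ z, cX z.1 z.2 ∂(π (k y)) ∂P := by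
  have hπ₁p : IsProbabilityMeasure π₁ := by
    constructor
    have := congrArg (fun ν : Measure Y => ν univ) h2
    simpa [Measure.map_apply measurable_snd MeasurableSet.univ] using this
  have hπp : ∀ n, IsProbabilityMeasure (π n) := fun n => by
    constructor
    have := congrArg (fun ν : Measure X => ν univ) (hπ2 n)
    simpa [Measure.map_apply measurable_snd MeasurableSet.univ] using this
  -- The coupling in `X` depends on the first point of the pair in `Y` only through the countable
  -- label `k`, so its measurability is free.
  set κ : Kernel (Y × Y) (X × X) :=
    (Kernel.ofFunOfCountable π).comap (fun z => k z.1) (hk.comp measurable_fst) with hκ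
  have hκz : ∀ z, κ z = π (k z.1) := fun z => rfl
  have : IsMarkovKernel κ := ⟨fun z => by rw [hκz]; infer_instance⟩
  have hfstm : ∀ {ψ : Y → ℝ≥0∞}, Measurable ψ → ∫⁻ z, ψ z.1 ∂π₁ = ∫⁻ y, f y * ψ y ∂P := by
    intro ψ hψ
    rw [← lintegral_map hψ measurable_fst, h1, lintegral_withDensity_eq_lintegral_mul _ hf hψ]
    rfl
  have hsndm : ∀ {ψ : Y → ℝ≥0∞}, Measurable ψ → ∫⁻ z, ψ z.2 ∂π₁ = ∫⁻ y, ψ y ∂P := by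
    intro ψ hψ
    rw [← lintegral_map hψ measurable_snd, h2]
  have hkg : Measurable fun z : Y × X => g (k z.1) z.2 := by
    have : Measurable fun q : ℕ × X => g q.1 q.2 := measurable_from_prod_countable_right hg
    exact this.comp ((hk.comp measurable_fst).prodMk measurable_snd)
  have hden : Measurable fun z : Y × X => f z.1 * g (k z.1) z.2 :=
    (hf.comp measurable_fst).mul hkg
  set Θ : (Y × Y) × (X × X) → (Y × X) × (Y × X) :=
    fun q => ((q.1.1, q.2.1), (q.1.2, q.2.2)) with hΘ
  have hΘm : Measurable Θ := by fun_prop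
  have hJ : ∀ {φ : (Y × X) × (Y × X) → ℝ≥0∞}, Measurable φ → ∫⁻ q, φ q ∂((π₁ ⊗ₘ κ).map Θ)
      = ∫⁻ z, ∫⁻ b, φ ((z.1, b.1), (z.2, b.2)) ∂(π (k z.1)) ∂π₁ := by
    intro φ hφ
    rw [lintegral_map hφ hΘm]
    exact Measure.lintegral_compProd (hφ.comp hΘm)
  clear_value Θ κ
  refine (transportCost_le ((π₁ ⊗ₘ κ).map Θ) ?_ ?_).trans ?_
  · refine Measure.ext_of_lintegral _ fun φ hφ => ?_
    have hdφ : Measurable fun z : Y × X => f z.1 * g (k z.1) z.2 * φ z := hden.mul hφ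
    rw [lintegral_map hφ measurable_fst,
      lintegral_withDensity_eq_lintegral_mul _ hden hφ]
    refine (hJ (hφ.comp measurable_fst)).trans ?_
    simp only [Function.comp_apply]
    refine Eq.trans ?_ (lintegral_prod _ hdφ.aemeasurable).symm
    have e : ∀ y, ∫⁻ b : X × X, φ (y, b.1) ∂(π (k y)) = ∫⁻ x, g (k y) x * φ (y, x) ∂μ := by
      intro y
      have hφy : Measurable fun x => φ (y, x) := hφ.comp measurable_prodMk_left
      rw [← lintegral_map hφy measurable_fst, hπ1,
        lintegral_withDensity_eq_lintegral_mul _ (hg _) hφy]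
      rfl
    simp only [e]
    have hm : Measurable fun y => ∫⁻ x, g (k y) x * φ (y, x) ∂μ :=
      (hkg.mul hφ).lintegral_prod_right'
    rw [hfstm hm]
    refine lintegral_congr fun y => ?_
    have hm' : Measurable fun x => g (k y) x * φ (y, x) :=
      (hg _).mul (hφ.comp measurable_prodMk_left)
    rw [← lintegral_const_mul _ hm']
    simp only [mul_assoc]
  · refine Measure.ext_of_lintegral _ fun φ hφ => ?_
    rw [lintegral_map hφ measurable_snd, lintegral_prod _ hφ.aemeasurable]
    refine (hJ (hφ.comp measurable_snd)).trans ?_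
    simp only [Function.comp_apply]
    have e : ∀ z : Y × Y, ∫⁻ b : X × X, φ (z.2, b.2) ∂(π (k z.1)) = ∫⁻ x, φ (z.2, x) ∂μ := by
      intro z
      have hφy : Measurable fun x => φ (z.2, x) := hφ.comp measurable_prodMk_left
      rw [← lintegral_map hφy measurable_snd, hπ2]
    simp only [e]
    exact hsndm hφ.lintegral_prod_right'
  · have hcost : Measurable fun q : (Y × X) × (Y × X) => cY q.1.1 q.2.1 + cX q.1.2 q.2.2 := by
      have a1 : Measurable fun q : (Y × X) × (Y × X) => cY q.1.1 q.2.1 :=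
        hcY.comp (f := fun q : (Y × X) × (Y × X) => (q.1.1, q.2.1)) (by fun_prop)
      have a2 : Measurable fun q : (Y × X) × (Y × X) => cX q.1.2 q.2.2 :=
        hcX.comp (f := fun q : (Y × X) × (Y × X) => (q.1.2, q.2.2)) (by fun_prop)
      exact a1.add a2
    rw [hJ hcost]
    have e : ∀ z : Y × Y, ∫⁻ b : X × X, (cY z.1 z.2 + cX b.1 b.2) ∂(π (k z.1))
        = cY z.1 z.2 + ∫⁻ b, cX b.1 b.2 ∂(π (k z.1)) := by
      intro z
      rw [lintegral_add_left measurable_const, lintegral_const, measure_univ, mul_one]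
    simp only [e]
    have hm : Measurable fun y => ∫⁻ b, cX b.1 b.2 ∂(π (k y)) :=
      (measurable_of_countable fun n => ∫⁻ b, cX b.1 b.2 ∂(π n)).comp hk
    rw [lintegral_add_left hcY, hfstm hm]

/-- Tensorisation of transport-entropy inequalities. -/
theorem IsTransportEntropy.prod {Y X : Type*} [MeasurableSpace Y] [MeasurableSpace X]
    [MeasurableSpace.CountablyGenerated X]
    {P : Measure Y} [IsProbabilityMeasure P] {μ : Measure X} [IsProbabilityMeasure μ]
    {cY : Y → Y → ℝ≥0∞} {cX : X → X → ℝ≥0∞} {wY : Y → ℝ≥0∞} {wX : X → ℝ≥0∞} {K : ℝ≥0}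
    (HY : IsTransportEntropy P cY wY K) (HX : IsTransportEntropy μ cX wX K) :
    IsTransportEntropy (P.prod μ) (fun z z' => cY z.1 z'.1 + cX z.2 z'.2)
      (fun z => wY z.1 + wX z.2) K := by
  have hY := HY.measurable_weight
  have hX := HX.measurable_weight
  have mY : Measurable fun z : Y × X => wY z.1 := hY.comp measurable_fst
  have mX : Measurable fun z : Y × X => wX z.2 := hX.comp measurable_snd
  have hwm : Measurable fun z : Y × X => wY z.1 + wX z.2 := mY.add mX
  have hcle : ∀ z z' : Y × X, cY z.1 z'.1 + cX z.2 z'.2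
      ≤ 2 * ((wY z.1 + wX z.2) + (wY z'.1 + wX z'.2)) := fun z z' => by
    refine (add_le_add (HY.cost_le _ _) (HX.cost_le _ _)).trans_eq ?_
    ring
  have hwt : ∫⁻ z, (wY z.1 + wX z.2) ∂(P.prod μ) ≠ ∞ := by
    rw [lintegral_add_left mY, lintegral_prod _ mY.aemeasurable, lintegral_prod _ mX.aemeasurable]
    simp only [lintegral_const, measure_univ, mul_one]
    exact ENNReal.add_ne_top.2 ⟨HY.weight_ne_top, HX.weight_ne_top⟩
  refine ⟨?_, hwm, hcle, hwt, fun F c C hc hF => ?_⟩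
  · have a1 : Measurable fun q : (Y × X) × (Y × X) => cY q.1.1 q.2.1 :=
      HY.measurable_cost.comp (f := fun q : (Y × X) × (Y × X) => (q.1.1, q.2.1)) (by fun_prop)
    have a2 : Measurable fun q : (Y × X) × (Y × X) => cX q.1.2 q.2.2 :=
      HX.measurable_cost.comp (f := fun q : (Y × X) × (Y × X) => (q.1.2, q.2.2)) (by fun_prop)
    exact a1.add a2
  have : Nonempty Y := P.nonempty_of_neZero
  set f := marginalDensity μ F with hf
  set g := condDensity μ F with hg
  have hfd : IsBoundedDensity P f c C := hF.marginalDensity hc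
  have hgd : ∀ y, IsBoundedDensity μ (g y) (c / C) (C / c) := hF.condDensity hc
  have hcC : 0 < c / C := by
    obtain ⟨y⟩ := this
    exact div_pos hc (hc.trans_le ((hfd.lower y).trans (hfd.upper y)))
  have hgm : Measurable fun z : Y × X => g z.1 z.2 := hF.measurable_condDensity
  refine ENNReal.le_of_forall_pos_le_add fun θ hθ _ => ?_
  have hθ2 : (θ : ℝ≥0∞) / 2 ≠ 0 := by simpa using hθ.ne'
  obtain ⟨δ, hδ, hstab⟩ := transportCost_le_add
    (c := fun z z' : Y × X => cY z.1 z'.1 + cX z.2 z'.2) hwm hcle hwt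
    hF.measurable.ennreal_ofReal (C := ENNReal.ofReal C) ENNReal.ofReal_ne_top
    (fun x => ENNReal.ofReal_le_ofReal (hF.upper x)) (hF.lintegral_eq hc.le) hθ2
  have hK2 : (K : ℝ≥0∞) + 2 ≠ ∞ := by simp
  -- `η ≤ δ` makes the stability estimate applicable. The total loss is `(K + 2) η ≤ θ / 2`: one `η`
  -- for the near-optimal coupling in `Y`, one for those in `X`, and `K η` for the entropy error of
  -- the selected densities.
  obtain ⟨η, hη, hηle⟩ := exists_pos_ofReal_le (lt_min hδ (ENNReal.div_pos hθ2 hK2))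
  obtain ⟨p, k, hk, hpk⟩ := exists_measurable_selection hgm hcC.le hgd hη
  set e : Y → ℝ := fun y => ∫ x, g y x * Real.log (g y x) ∂μ with he
  have hηpos : 0 < ENNReal.ofReal η := ENNReal.ofReal_pos.2 hη
  obtain ⟨π₁, hπ₁1, hπ₁2, hπ₁c⟩ := exists_coupling_of_lt ((HY.le f c C hc hfd).trans_lt
    (ENNReal.lt_add_right (ENNReal.mul_ne_top ENNReal.coe_ne_top ENNReal.ofReal_ne_top)
      hηpos.ne'))
  choose π hπ1 hπ2 hπc using fun n => exists_coupling_of_lt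
    ((HX.le (g (p n)) _ _ hcC (hgd (p n))).trans_lt
    (ENNReal.lt_add_right (ENNReal.mul_ne_top ENNReal.coe_ne_top ENNReal.ofReal_ne_top)
      hηpos.ne'))
  have hgp : ∀ n, Measurable fun x => ENNReal.ofReal (g (p n) x) := fun n =>
    (hgd (p n)).measurable.ennreal_ofReal
  have hkg : Measurable fun z : Y × X => g (p (k z.1)) z.2 := by
    have : Measurable fun q : ℕ × X => g (p q.1) q.2 :=
      measurable_from_prod_countable_right fun n => (hgd (p n)).measurable
    exact this.comp ((hk.comp measurable_fst).prodMk measurable_snd)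
  have hfm := hfd.measurable.ennreal_ofReal
  have hfl := hfd.lintegral_eq hc.le
  have hcost : transportCost (fun z z' : Y × X => cY z.1 z'.1 + cX z.2 z'.2)
      ((P.prod μ).withDensity fun z => ENNReal.ofReal (f z.1)
        * ENNReal.ofReal (g (p (k z.1)) z.2)) (P.prod μ)
      ≤ K * ENNReal.ofReal (∫ z, F z * Real.log (F z) ∂(P.prod μ))
        + (K + 2) * ENNReal.ofReal η := by
    refine (transportCost_prod_le HY.measurable_cost HX.measurable_cost hfm hgp hk hπ₁1 hπ₁2 hπ1
      hπ2).trans ?_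
    have hsec : ∀ y, ∫⁻ z, cX z.1 z.2 ∂(π (k y))
        ≤ K * ENNReal.ofReal (e y) + (K + 1) * ENNReal.ofReal η := by
      intro y
      calc _ ≤ K * ENNReal.ofReal (e (p (k y))) + ENNReal.ofReal η := (hπc (k y)).le
        _ ≤ K * (ENNReal.ofReal (e y) + ENNReal.ofReal η) + ENNReal.ofReal η := by
          gcongr
          exact (ENNReal.ofReal_le_ofReal (hpk y).2.le).trans ENNReal.ofReal_add_le
        _ = _ := by ring
    have hem : Measurable e := by
      have : Measurable fun z : Y × X => g z.1 z.2 * Real.log (g z.1 z.2) :=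
        hgm.mul (Real.measurable_log.comp hgm)
      exact (this.stronglyMeasurable.integral_prod_right (ν := μ)).measurable
    have hfe : Measurable fun y => ENNReal.ofReal (f y) * ENNReal.ofReal (e y) :=
      hfm.mul hem.ennreal_ofReal
    calc _ ≤ (K * ENNReal.ofReal (∫ y, f y * Real.log (f y) ∂P) + ENNReal.ofReal η)
        + ∫⁻ y, ENNReal.ofReal (f y)
            * (K * ENNReal.ofReal (e y) + (K + 1) * ENNReal.ofReal η) ∂P := by
          gcongr with y
          exact hsec y
      _ = (K * ENNReal.ofReal (∫ y, f y * Real.log (f y) ∂P) + ENNReal.ofReal η)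
        + ∫⁻ y, (K * (ENNReal.ofReal (f y) * ENNReal.ofReal (e y))
            + ENNReal.ofReal (f y) * ((K + 1) * ENNReal.ofReal η)) ∂P := by
          congr 1
          refine lintegral_congr fun y => ?_
          ring
      _ = _ := by
          rw [lintegral_add_left (hfe.const_mul _), lintegral_const_mul _ hfe,
            lintegral_mul_const _ hfm, hfl, hF.entropy_eq hc]
          ring
  have hFeq : (fun z : Y × X => ENNReal.ofReal (f z.1) * ENNReal.ofReal (g (p (k z.1)) z.2))
      = fun z => ENNReal.ofReal (f z.1 * g (p (k z.1)) z.2) :=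
    funext fun z => (ENNReal.ofReal_mul (hfd.nonneg hc.le _)).symm
  have hden : Measurable fun z : Y × X =>
      ENNReal.ofReal (f z.1) * ENNReal.ofReal (g (p (k z.1)) z.2) :=
    (hfm.comp measurable_fst).mul hkg.ennreal_ofReal
  refine (hstab _ hden (fun z => ?_) (fun z => ?_) ?_ ?_).trans ?_
  · exact mul_ne_zero (ENNReal.ofReal_pos.2 (hc.trans_le (hfd.lower _))).ne'
      (ENNReal.ofReal_pos.2 (hcC.trans_le ((hgd _).lower _))).ne'
  · exact ENNReal.mul_ne_top ENNReal.ofReal_ne_top ENNReal.ofReal_ne_top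
  · rw [lintegral_prod _ hden.aemeasurable]
    simp only
    have : ∀ y, ∫⁻ x, ENNReal.ofReal (f y) * ENNReal.ofReal (g (p (k y)) x) ∂μ
        = ENNReal.ofReal (f y) := fun y => by
      rw [lintegral_const_mul _ (hgp _), (hgd _).lintegral_eq hcC.le, mul_one]
    simp only [this, hfl]
  · have hFm : Measurable fun z : Y × X => ENNReal.ofReal (F z) -
        ENNReal.ofReal (f z.1) * ENNReal.ofReal (g (p (k z.1)) z.2) :=
      hF.measurable.ennreal_ofReal.sub hden
    rw [lintegral_prod _ hFm.aemeasurable]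
    have hpt : ∀ y, ∫⁻ x, (ENNReal.ofReal (F (y, x)) -
        ENNReal.ofReal (f y) * ENNReal.ofReal (g (p (k y)) x)) ∂μ
        ≤ ENNReal.ofReal (f y) * ENNReal.ofReal η := by
      intro y
      have hab : Measurable fun x => |g y x - g (p (k y)) x| :=
        ((hgd y).measurable.sub (hgd (p (k y))).measurable).abs
      have hai : Integrable (fun x => |g y x - g (p (k y)) x|) μ :=
        (((hgd y).integrable hcC.le).sub ((hgd (p (k y))).integrable hcC.le)).abs
      calc _ ≤ ∫⁻ x, ENNReal.ofReal (f y) * ENNReal.ofReal |g y x - g (p (k y)) x| ∂μ := by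
            refine lintegral_mono fun x => ?_
            rw [← hF.marginalDensity_mul_condDensity hc y x,
              ENNReal.ofReal_mul (hfd.nonneg hc.le _), ← ENNReal.mul_sub fun _ _ =>
              ENNReal.ofReal_ne_top]
            gcongr
            exact ofReal_sub_ofReal_le _ _
        _ = ENNReal.ofReal (f y) * ENNReal.ofReal (∫ x, |g y x - g (p (k y)) x| ∂μ) := by
            rw [lintegral_const_mul _ hab.ennreal_ofReal,
              ofReal_integral_eq_lintegral_ofReal hai (ae_of_all _ fun x => abs_nonneg _)]
        _ ≤ _ := by
            gcongr
            exact (hpk y).1.le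
    calc _ ≤ ∫⁻ y, ENNReal.ofReal (f y) * ENNReal.ofReal η ∂P := lintegral_mono hpt
      _ = ENNReal.ofReal η := by rw [lintegral_mul_const _ hfm, hfl, one_mul]
      _ ≤ δ := hηle.trans (min_le_left _ _)
  · have hη2 : ((K : ℝ≥0∞) + 2) * ENNReal.ofReal η ≤ θ / 2 := by
      calc _ ≤ ((K : ℝ≥0∞) + 2) * ((θ : ℝ≥0∞) / 2 / (K + 2)) := by
            gcongr
            exact hηle.trans (min_le_right _ _)
        _ = _ := ENNReal.mul_div_cancel (by simp) hK2
    calc _ ≤ (K * ENNReal.ofReal (∫ z, F z * Real.log (F z) ∂(P.prod μ)) + θ / 2) + θ / 2 := by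
          gcongr
          exact hcost.trans (by gcongr)
      _ = _ := by rw [add_assoc, ENNReal.add_halves]


/-! ### Transport–entropy inequalities under measurable equivalences and on `N`-fold products. -/

theorem transportCost_comp_le {Z Y : Type*} [MeasurableSpace Z] [MeasurableSpace Y]
    (e : Z ≃ᵐ Y) (c : Y → Y → ℝ≥0∞) (P Q : Measure Z) :
    transportCost (fun z z' => c (e z) (e z')) P Q ≤ transportCost c (P.map e) (Q.map e) := by
  refine le_iInf fun π => le_iInf fun h1 => le_iInf fun h2 => ?_
  have hm : Measurable (Prod.map e.symm e.symm) := e.symm.measurable.prodMap e.symm.measurable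
  refine (transportCost_le (π.map (e.symm.prodCongr e.symm)) ?_ ?_).trans_eq ?_
  · have : Prod.fst ∘ (e.symm.prodCongr e.symm) = e.symm ∘ Prod.fst := rfl
    rw [Measure.map_map measurable_fst (MeasurableEquiv.measurable _), this,
      ← Measure.map_map e.symm.measurable measurable_fst, h1, e.map_symm_map]
  · have : Prod.snd ∘ (e.symm.prodCongr e.symm) = e.symm ∘ Prod.snd := rfl
    rw [Measure.map_map measurable_snd (MeasurableEquiv.measurable _), this,
      ← Measure.map_map e.symm.measurable measurable_snd, h2, e.map_symm_map]
  · rw [lintegral_map_equiv]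
    refine lintegral_congr fun z => ?_
    change c (e (e.symm z.1)) (e (e.symm z.2)) = _
    rw [e.apply_symm_apply, e.apply_symm_apply]

theorem IsTransportEntropy.comp_equiv {Z Y : Type*} [MeasurableSpace Z] [MeasurableSpace Y]
    {P : Measure Y} {cost : Y → Y → ℝ≥0∞} {w : Y → ℝ≥0∞} {K : ℝ≥0}
    (H : IsTransportEntropy P cost w K) (e : Z ≃ᵐ Y) {Q : Measure Z}
    (he : MeasurePreserving e Q P) :
    IsTransportEntropy Q (fun z z' => cost (e z) (e z')) (fun z => w (e z)) K where
  measurable_cost := H.measurable_cost.comp (f := fun z : Z × Z => (e z.1, e z.2))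
    ((e.measurable.comp measurable_fst).prodMk (e.measurable.comp measurable_snd))
  measurable_weight := H.measurable_weight.comp e.measurable
  cost_le _ _ := H.cost_le _ _
  weight_ne_top := by
    rw [he.lintegral_comp H.measurable_weight]
    exact H.weight_ne_top
  le f c C hc hf := by
    have hfm : Measurable fun y => f (e.symm y) := hf.measurable.comp e.symm.measurable
    have hmap : (Q.withDensity fun x => ENNReal.ofReal (f x)).map e
        = P.withDensity fun y => ENNReal.ofReal (f (e.symm y)) := by
      ext s hs
      rw [Measure.map_apply e.measurable hs, withDensity_apply _ (e.measurable hs),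
        withDensity_apply _ hs, ← he.map_eq,
        setLIntegral_map hs hfm.ennreal_ofReal e.measurable]
      simp
    have hint : ∀ φ : Y → ℝ, ∫ z, φ (e z) ∂Q = ∫ y, φ y ∂P := fun φ => he.integral_comp' φ
    have hfe : IsBoundedDensity P (fun y => f (e.symm y)) c C := by
      refine ⟨hfm, fun y => hf.lower _, fun y => hf.upper _, ?_⟩
      rw [← hint, ← hf.integral_eq]
      simp
    refine (transportCost_comp_le e cost _ _).trans ?_
    rw [hmap, he.map_eq]
    refine (H.le _ _ _ hc hfe).trans_eq ?_
    rw [← hint]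
    simp

theorem IsTransportEntropy.pi {X : Type*} [MeasurableSpace X]
    [MeasurableSpace.CountablyGenerated X] {μ : Measure X} [IsProbabilityMeasure μ]
    {c : X → X → ℝ≥0∞} {w : X → ℝ≥0∞} {K : ℝ≥0} (H : IsTransportEntropy μ c w K) (n : ℕ) :
    IsTransportEntropy (Measure.pi fun _ : Fin n => μ) (fun x y => ∑ i, c (x i) (y i))
      (fun x => ∑ i, w (x i)) K := by
  induction n with
  | zero =>
    refine ⟨by simp, by simp, by simp, by simp, fun f a b ha hf => ?_⟩
    have := hf.isProbabilityMeasure ha.le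
    refine (transportCost_le (((Measure.pi fun _ : Fin 0 => μ).withDensity
      fun x => ENNReal.ofReal (f x)).prod (Measure.pi fun _ : Fin 0 => μ)) ?_ ?_).trans ?_
    · rw [Measure.map_fst_prod, measure_univ, one_smul]
    · rw [Measure.map_snd_prod, measure_univ, one_smul]
    · simp
  | succ n ih =>
    -- Coordinate `0` is split off and swapped into the second slot, matching the order in which the
    -- induction hypothesis is tensorised.
    have h := (ih.prod H).comp_equiv
      ((MeasurableEquiv.piFinSuccAbove (fun _ : Fin (n + 1) => X) 0).trans MeasurableEquiv.prodComm)
      (Measure.measurePreserving_swap.comp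
        (measurePreserving_piFinSuccAbove (fun _ : Fin (n + 1) => μ) 0))
    convert h using 1
    · ext x y
      rw [Fin.sum_univ_succ, add_comm]
      rfl
    · ext x
      rw [Fin.sum_univ_succ, add_comm]
      rfl

/-- An upper bound on `u` bounds the tilted density above, while no lower bound is available; this
is why the inequality was extended to densities reaching zero. -/
theorem IsTransportEntropy.transportCost_tilted_le {Y : Type*} [MeasurableSpace Y] {P : Measure Y}
    [IsProbabilityMeasure P] {cost : Y → Y → ℝ≥0∞} {w : Y → ℝ≥0∞} {K : ℝ≥0}
    (H : IsTransportEntropy P cost w K) {u : Y → ℝ} (hu : Measurable u)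
    (hexp : Integrable (fun x => Real.exp (u x)) P) {B : ℝ} (hB : ∀ᵐ x ∂P, u x ≤ B) :
    transportCost cost (P.tilted u) P ≤ K * klDiv (P.tilted u) P := by
  have hZ : 0 < ∫ x, Real.exp (u x) ∂P := integral_exp_pos hexp
  set Z := ∫ x, Real.exp (u x) ∂P with hZdef
  -- The bound on `u` holds only almost everywhere, whereas `IsBoundedDensity` is pointwise;
  -- truncation gives an equivalent version of the density.
  set f : Y → ℝ := fun x => Real.exp (min (u x) B) / Z with hf
  have hfu : ∀ᵐ x ∂P, f x = Real.exp (u x) / Z := by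
    filter_upwards [hB] with x hx
    simp only [hf, min_eq_left hx]
  have hfd : IsBoundedDensity P f 0 (Real.exp B / Z) := by
    refine ⟨?_, fun x => by positivity, fun x => ?_, ?_⟩
    · exact (Real.measurable_exp.comp (hu.min measurable_const)).div_const _
    · simp only [hf]
      gcongr
      exact min_le_right _ _
    · rw [integral_congr_ae hfu, integral_div, div_self hZ.ne']
  have htilt : P.tilted u = P.withDensity fun x => ENNReal.ofReal (f x) := by
    refine withDensity_congr_ae ?_
    filter_upwards [hfu] with x hx
    rw [hx]
  rw [htilt, hfd.klDiv_eq le_rfl]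
  exact H.le_of_nonneg hfd

theorem IsP2.of_le_smul {X : Type*} [MetricSpace X] [MeasureSpace X] {μ ν : Measure X}
    (hμ : IsP2 μ) [IsProbabilityMeasure ν] {C : ℝ≥0∞} (hC : C ≠ ∞) (h : ν ≤ C • μ) : IsP2 ν := by
  refine ⟨inferInstance, fun x₀ => ?_⟩
  calc ∫⁻ x, edist x x₀ ^ 2 ∂ν ≤ ∫⁻ x, edist x x₀ ^ 2 ∂(C • μ) := lintegral_mono' h le_rfl
    _ < ∞ := by
      rw [lintegral_smul_measure, smul_eq_mul]
      exact ENNReal.mul_lt_top hC.lt_top (hμ.2 x₀)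

theorem edist_sq_le {X : Type*} [PseudoEMetricSpace X] (x y z : X) :
    edist x y ^ 2 ≤ 2 * (edist x z ^ 2 + edist y z ^ 2) := by
  have h1 : edist x y ≤ edist x z + edist y z := by
    rw [edist_comm y z]
    exact edist_triangle _ _ _
  calc edist x y ^ 2 ≤ (edist x z + edist y z) ^ 2 := by gcongr
    _ ≤ _ := by
      generalize edist x z = a
      generalize edist y z = b
      rcases eq_or_ne a ∞ with rfl | ha
      · simp
      rcases eq_or_ne b ∞ with rfl | hb
      · simp
      lift a to ℝ≥0 using ha
      lift b to ℝ≥0 using hb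
      have : (a + b) ^ 2 ≤ 2 * (a ^ 2 + b ^ 2) := add_sq_le
      exact_mod_cast this

variable {X : Type*} [MetricSpace X] [MeasureSpace X] [BorelSpace X] [SecondCountableTopology X]

/-- A bounded density with respect to `μ` inherits the finite second moment, hence is an admissible
competitor; the weight is the squared distance to a base point. -/
theorem Talagrand.isTransportEntropy {μ : Measure X} (hμ : IsP2 μ) (h : Talagrand μ) (x₀ : X) :
    ∃ K : ℝ≥0,
      IsTransportEntropy μ (fun x y => edist x y ^ 2) (fun x => edist x x₀ ^ 2) K := by
  obtain ⟨K, hK⟩ := h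
  have := hμ.1
  refine ⟨K, ⟨by fun_prop, by fun_prop, fun x y => edist_sq_le x y x₀, (hμ.2 x₀).ne,
    fun f c C hc hf => ?_⟩⟩
  have hp := hf.isProbabilityMeasure hc.le
  have hle : (μ.withDensity fun x => ENNReal.ofReal (f x)) ≤ ENNReal.ofReal C • μ := by
    rw [← withDensity_const]
    exact withDensity_mono (ae_of_all _ fun x => ENNReal.ofReal_le_ofReal (hf.upper x))
  rw [← hf.klDiv_eq hc.le]
  exact hK _ (hμ.of_le_smul ENNReal.ofReal_ne_top hle)

theorem Talagrand.wassersteinSqN_tilted_le {μ : Measure X} (hμ : IsP2 μ) (h : Talagrand μ) :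
    ∃ K : ℝ≥0, ∀ (N : ℕ) (u : (Fin N → X) → ℝ) (B : ℝ), Measurable u →
      Integrable (fun x => Real.exp (u x)) (Measure.pi fun _ => μ) →
      (∀ᵐ x ∂(Measure.pi fun _ => μ), u x ≤ B) →
      wassersteinSqN ((Measure.pi fun _ => μ).tilted u) (Measure.pi fun _ => μ)
        ≤ K * klDiv ((Measure.pi fun _ => μ).tilted u) (Measure.pi fun _ => μ) := by
  have := hμ.1
  obtain ⟨x₀⟩ := μ.nonempty_of_neZero
  obtain ⟨K, hK⟩ := h.isTransportEntropy hμ x₀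
  exact ⟨K, fun N u B hu hexp hB => (hK.pi N).transportCost_tilted_le hu hexp hB⟩

end Transport


/-! ### Estimates for the Gibbs measure under an abstract regularity assumption -/

section Gibbs

variable {X : Type*} [MetricSpace X] [MeasureSpace X] [BorelSpace X] [SecondCountableTopology X]
  [SigmaFinite (volume : Measure X)] [IsLocallyFiniteMeasure (volume : Measure X)]
  {μ : Measure X} {V : X → ℝ} {W G : X → X → ℝ} {C₀ : ℝ}

theorem IsUniqueMinimiser.gibbs_estimates [NullSingletonClass μ] (hμ : IsUniqueMinimiser V W μ)
    (hV : Measurable V) (hW : Measurable fun z : X × X => W z.1 z.2)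
    (hs : ∀ x y, W x y = W y x) (hl : LocallyIntegrable fun z : X × X => W z.1 z.2)
    (hG : IsRegularApprox W G μ (1 / 4096) C₀) :
    (∀ N : ℕ, 1 ≤ N →
      IsProbabilityMeasure (gibbsMeasure V W N) ∧
      relPartition W μ N
        = ENNReal.ofReal (Real.exp (N * (energy V W μ).toReal)) * gibbsNormalisation V W N ∧
      gibbsMeasure V W N = (relPartition W μ N)⁻¹ •
        (Measure.pi fun _ : Fin N => μ).withDensity
          (fun x => ENNReal.ofReal (Real.exp (-fluctuationEnergy W μ x)))) ∧
    (∃ C : ℝ, ∀ N : ℕ, 1 ≤ N → relPartition W μ N ≤ ENNReal.ofReal C) ∧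
    (∃ C : ℝ, ∀ N : ℕ, 1 ≤ N →
      avgEntropy (gibbsMeasure V W N) (Measure.pi fun _ => μ) ≤ ENNReal.ofReal (C / N) ∧
      avgEntropy (Measure.pi fun _ => μ) (gibbsMeasure V W N) ≤ ENNReal.ofReal (C / N)) ∧
    (Talagrand μ → ∃ C : ℝ, ∀ N : ℕ, 1 ≤ N →
      wassersteinSqN (gibbsMeasure V W N) (Measure.pi fun _ => μ) / (N : ℝ≥0∞)
        ≤ ENNReal.ofReal (C / N)) := by
  have hp : IsProbabilityMeasure μ := hμ.1.1
  have hi : Integrable (fun z : X × X => W z.1 z.2) (μ.prod μ) := hμ.hasFiniteEnergy.2.2.2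
  have kW : IsIntegrableKernel W μ := (hG.isIntegrableKernel hW hs hi).1
  have hvol : volume ≪ μ := hμ.volume_absolutelyContinuous hV kW hl
  set B : ℝ := Real.exp (1 / 16 + (C₀ + 3 * (1 / 4096))) with hBdef
  have hB0 : 0 ≤ B := (Real.exp_pos _).le
  have hB : ∀ {N : ℕ}, 1 ≤ N → ∫⁻ x : Fin N → X, ENNReal.ofReal
      (Real.exp (-2 * fluctuationEnergy W μ x)) ∂Measure.pi (fun _ => μ) ≤ ENNReal.ofReal B :=
    fun hN => hG.lintegral_exp_le hW hs hi (by norm_num) le_rfl hN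
  have hM : ∀ {N : ℕ}, 1 ≤ N → gibbsMeasure V W N
      = (Measure.pi fun _ : Fin N => μ).tilted fun x => -fluctuationEnergy W μ x := fun hN =>
    (hμ.gibbsMeasure_eq kW hvol hN).trans (kW.tilted_eq (hB hN) hB0)
  set w := ∫ z : X × X, W z.1 z.2 ∂μ.prod μ with hw
  -- The larger of the two entropy bounds, used for both directions.
  set C₁ : ℝ := B * Real.exp |w| + |w| with hC₁
  have hC₁0 : 0 ≤ C₁ := by positivity
  have hBC : B + |w| ≤ C₁ := by
    have h1 : (1 : ℝ) ≤ Real.exp |w| := Real.one_le_exp (abs_nonneg _)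
    nlinarith
  have hk1 : ∀ {N : ℕ}, 1 ≤ N →
      klDiv (gibbsMeasure V W N) (Measure.pi fun _ => μ) ≤ ENNReal.ofReal C₁ := fun hN => by
    rw [hM hN]
    exact (kW.klDiv_le hN (hB hN) hB0 hw).2
  have hk2 : ∀ {N : ℕ}, 1 ≤ N →
      klDiv (Measure.pi fun _ => μ) (gibbsMeasure V W N) ≤ ENNReal.ofReal C₁ := fun hN => by
    rw [hM hN]
    exact (kW.klDiv_le hN (hB hN) hB0 hw).1.trans (ENNReal.ofReal_le_ofReal hBC)
  have hdiv : ∀ {N : ℕ}, 1 ≤ N → ∀ {a : ℝ≥0∞} {C : ℝ}, a ≤ ENNReal.ofReal C →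
      a / (N : ℝ≥0∞) ≤ ENNReal.ofReal (C / N) := fun {N} hN a C h => by
    rw [ENNReal.ofReal_div_of_pos (by exact_mod_cast hN), ENNReal.ofReal_natCast]
    gcongr
  refine ⟨fun N hN => ⟨?_, hμ.relPartition_eq kW hvol hN, hμ.gibbsMeasure_eq kW hvol hN⟩,
    ⟨1 + B, fun N hN => IsIntegrableKernel.relPartition_le (hB hN) hB0⟩,
    ⟨C₁, fun N hN => ⟨hdiv hN (hk1 hN), hdiv hN (hk2 hN)⟩⟩, fun hT => ?_⟩
  · rw [hM hN]
    exact isProbabilityMeasure_tilted (kW.integrable_exp (hB hN) hB0).1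
  · obtain ⟨K, hK⟩ := hT.wassersteinSqN_tilted_le hμ.1
    refine ⟨K * C₁, fun N hN => hdiv hN ?_⟩
    obtain ⟨b, hb⟩ := hG.neg_fluctuationEnergy_le hW hs hi (by norm_num) le_rfl hN
    have h := hK N (fun x => -fluctuationEnergy W μ x) b (kW.measurable_fluctuationEnergy N).neg
      (kW.integrable_exp (hB hN) hB0).1 hb
    rw [ENNReal.ofReal_mul K.coe_nonneg, ENNReal.ofReal_coe_nnreal, hM hN]
    refine h.trans ?_
    gcongr
    rw [← hM hN]
    exact hk1 hN

end Gibbs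

/-! ### Measure-theoretic properties of the domains -/

namespace Domain

variable {d : ℕ}

instance instSecondCountableTopologyCarrier (D : Domain d) :
    SecondCountableTopology D.Carrier := by
  cases D with
  | torus => exact inferInstanceAs (SecondCountableTopology (Torus d))
  | space => exact inferInstanceAs (SecondCountableTopology (Euc d))
  | bounded U _ _ _ => exact inferInstanceAs (SecondCountableTopology ↥U)

instance instIsFiniteMeasureTorus : IsFiniteMeasure (volume : Measure (torus : Domain d).Carrier) :=
  inferInstanceAs (IsFiniteMeasure
    ((volume : Measure (Fin d → UnitAddCircle)).map (WithLp.toLp 2)))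

theorem volume_bounded_apply {U : Set (Euc d)} {h1 : IsOpen U} {h2 : Bornology.IsBounded U}
    {h3 : HasSmoothBoundary U} (s : Set (bounded U h1 h2 h3).Carrier) :
    (volume : Measure (bounded U h1 h2 h3).Carrier) s
      = (volume : Measure (Euc d)) ((Subtype.val : U → Euc d) '' s) :=
  (MeasurableEmbedding.subtype_coe h1.measurableSet).comap_apply _ _

instance instIsFiniteMeasureBounded {U : Set (Euc d)} {h1 : IsOpen U} {h2 : Bornology.IsBounded U}
    {h3 : HasSmoothBoundary U} :
    IsFiniteMeasure (volume : Measure (bounded U h1 h2 h3).Carrier) := by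
  refine ⟨?_⟩
  rw [volume_bounded_apply]
  refine lt_of_le_of_lt (measure_mono ?_) h2.measure_lt_top
  rintro _ ⟨x, -, rfl⟩
  exact x.2

instance instSigmaFiniteCarrier (D : Domain d) : SigmaFinite (volume : Measure D.Carrier) := by
  cases D with
  | torus => infer_instance
  | space => exact inferInstanceAs (SigmaFinite (volume : Measure (Euc d)))
  | bounded U _ _ _ => infer_instance

instance instIsLocallyFiniteMeasureCarrier (D : Domain d) :
    IsLocallyFiniteMeasure (volume : Measure D.Carrier) := by
  cases D with
  | torus => infer_instance
  | space => exact inferInstanceAs (IsLocallyFiniteMeasure (volume : Measure (Euc d)))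
  | bounded U _ _ _ => infer_instance

theorem volume_singleton_unitAddCircle (x : UnitAddCircle) :
    volume ({x} : Set UnitAddCircle) = 0 := by
  refine le_antisymm (le_of_forall_gt_imp_ge_of_dense fun ε hε => ?_) zero_le
  obtain ⟨t, ht0, ht⟩ := exists_pos_ofReal_le hε
  calc volume ({x} : Set UnitAddCircle) ≤ volume (Metric.closedBall x (t / 2)) :=
        measure_mono (singleton_subset_iff.2 (Metric.mem_closedBall_self (by positivity)))
    _ ≤ ENNReal.ofReal t := by
        rw [AddCircle.volume_closedBall]
        refine ENNReal.ofReal_le_ofReal ((min_le_right _ _).trans_eq ?_)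
        ring
    _ ≤ ε := ht

theorem nullSingletonClass_volume (hd : 1 ≤ d) (D : Domain d) :
    NullSingletonClass (volume : Measure D.Carrier) := by
  have : Nonempty (Fin d) := ⟨⟨0, hd⟩⟩
  have hE : NullSingletonClass (volume : Measure (Euc d)) := inferInstance
  cases D with
  | torus =>
    have hC : NullSingletonClass (volume : Measure UnitAddCircle) :=
      ⟨volume_singleton_unitAddCircle⟩
    have key : ∀ x : Torus d,
        ((volume : Measure (Fin d → UnitAddCircle)).map (WithLp.toLp 2) : Measure (Torus d)) {x}
          = 0 := by
      intro x
      rw [Measure.map_apply (WithLp.measurable_toLp 2 _) (measurableSet_singleton _)]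
      have : (WithLp.toLp 2 : (Fin d → UnitAddCircle) → Torus d) ⁻¹' {x} = {WithLp.ofLp x} := by
        ext y
        simp only [mem_preimage, mem_singleton_iff]
        exact ⟨fun h => by rw [← h], fun h => by rw [h]⟩
      rw [this]
      exact measure_singleton _
    exact ⟨key⟩
  | space => exact hE
  | bounded U _ _ _ =>
    have key : ∀ x : U, (volume : Measure (Euc d)) (Subtype.val '' {x}) = 0 := fun x => by
      rw [image_singleton]
      exact measure_singleton _
    refine ⟨fun x => ?_⟩
    rw [volume_bounded_apply]
    exact key x

/-! ### Measurability of the heat kernels -/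

/-- The heat kernel, extended by zero to nonpositive times. -/
noncomputable def heatKernelPos (D : Domain d) (t : ℝ) (x y : D.Carrier) : ℝ :=
  if 0 < t then D.heatKernel t x y else 0

theorem summable_circleHeatKernel {t : ℝ} (ht : 0 < t) (u : UnitAddCircle) :
    Summable fun n : ℤ => Real.exp (-(4 * Real.pi ^ 2 * (n : ℝ) ^ 2 * t)) * (fourier n u).re := by
  have ha : 0 < 4 * Real.pi ^ 2 * t := by positivity
  have hb : Summable fun n : ℤ => Real.exp (-(4 * Real.pi ^ 2 * (n : ℝ) ^ 2 * t)) := by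
    have hn : Summable fun n : ℕ => Real.exp (-(4 * Real.pi ^ 2 * (n : ℝ) ^ 2 * t)) := by
      refine Summable.of_nonneg_of_le (fun n => (Real.exp_pos _).le) (fun n => ?_)
        (Real.summable_exp_nat_mul_iff.2 (neg_neg_of_pos ha))
      refine Real.exp_le_exp.2 ?_
      have h1 : (n : ℝ) ≤ (n : ℝ) ^ 2 := by exact_mod_cast Nat.le_self_pow two_ne_zero n
      nlinarith
    refine Summable.of_nat_of_neg (by simpa using hn) (by simpa using hn)
  refine Summable.of_norm_bounded hb fun n => ?_
  rw [norm_mul, Real.norm_of_nonneg (Real.exp_pos _).le]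
  refine mul_le_of_le_one_right (Real.exp_pos _).le ?_
  refine (Complex.abs_re_le_norm _).trans ?_
  rw [fourier_apply]
  exact (Circle.norm_coe _).le

/-- A pointwise limit of finite Fourier sums. Convergence is used only at positive times, hence the
cut-off. -/
theorem measurable_circleHeatKernel :
    Measurable fun q : ℝ × UnitAddCircle => if 0 < q.1 then circleHeatKernel q.1 q.2 else 0 := by
  refine measurable_of_tendsto_metrizable' (atTop : Filter (Finset ℤ))
    (f := fun (s : Finset ℤ) q => if 0 < q.1 then
      ∑ n ∈ s, Real.exp (-(4 * Real.pi ^ 2 * (n : ℝ) ^ 2 * q.1)) * (fourier n q.2).re else 0)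
    (fun s => ?_) (tendsto_pi_nhds.2 fun q => ?_)
  · refine Measurable.ite (measurableSet_lt measurable_const measurable_fst) ?_ measurable_const
    refine Finset.measurable_fun_sum _ fun n _ => ?_
    have h1 : Measurable fun q : ℝ × UnitAddCircle => (fourier n q.2).re :=
      (Complex.continuous_re.comp ((map_continuous (fourier n)).comp continuous_snd)).measurable
    exact Measurable.mul (by fun_prop) h1
  · by_cases hq : 0 < q.1
    · simp only [hq, if_true]
      exact (summable_circleHeatKernel hq q.2).hasSum
    · simp only [hq, if_false]
      exact tendsto_const_nhds

theorem measurable_heatKernelPos (D : Domain d) :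
    Measurable fun q : ℝ × D.Carrier × D.Carrier => D.heatKernelPos q.1 q.2.1 q.2.2 := by
  cases D with
  | torus =>
    change Measurable fun q : ℝ × Torus d × Torus d =>
      if 0 < q.1 then ∏ i, circleHeatKernel q.1 (q.2.1 i - q.2.2 i) else 0
    -- Repeating the cut-off inside the product makes each factor a jointly measurable function.
    have e : (fun q : ℝ × Torus d × Torus d =>
        if 0 < q.1 then ∏ i, circleHeatKernel q.1 (q.2.1 i - q.2.2 i) else 0)
        = fun q => if 0 < q.1 then ∏ i, (if 0 < q.1 then
          circleHeatKernel q.1 (q.2.1 i - q.2.2 i) else 0) else 0 := by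
      ext q
      split_ifs <;> rfl
    rw [e]
    refine Measurable.ite (measurableSet_lt measurable_const measurable_fst) ?_ measurable_const
    refine Finset.measurable_fun_prod _ fun i _ => ?_
    have hi : Measurable fun x : Torus d => x i := Continuous.measurable (by fun_prop)
    have hm : Measurable fun q : ℝ × Torus d × Torus d => q.2.1 i - q.2.2 i :=
      (hi.comp (measurable_fst.comp measurable_snd)).sub
        (hi.comp (measurable_snd.comp measurable_snd))
    exact measurable_circleHeatKernel.comp (measurable_fst.prodMk hm)
  | space =>
    change Measurable fun q : ℝ × Euc d × Euc d =>
      if 0 < q.1 then gaussianHeatKernel q.1 q.2.1 q.2.2 else 0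
    refine Measurable.ite (measurableSet_lt measurable_const measurable_fst) ?_ measurable_const
    unfold gaussianHeatKernel
    fun_prop
  | bounded U _ _ _ =>
    change Measurable fun q : ℝ × U × U =>
      if 0 < q.1 then neumannHeatKernel U q.1 q.2.1 q.2.2 else 0
    by_cases h : ∃ p, IsNeumannHeatKernel U p
    · have hp := h.choose_spec
      have e : neumannHeatKernel U = h.choose := dif_pos h
      rw [e]
      -- The Neumann kernel is known only through its defining properties; joint continuity at
      -- positive times is all that is used.
      have hc : ContinuousOn (fun q : ℝ × U × U => h.choose q.1 q.2.1 q.2.2) {q | 0 < q.1} :=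
        hp.continuousOn.comp (f := fun q : ℝ × U × U => (q.1, (q.2.1 : Euc d), (q.2.2 : Euc d)))
          (by fun_prop) fun q hq => ⟨hq, q.2.1.2, q.2.2.2⟩
      classical
      exact ContinuousOn.measurable_piecewise (g := fun _ => 0) hc continuousOn_const
        (measurableSet_lt measurable_const measurable_fst)
    · have e : neumannHeatKernel U = 0 := dif_neg h
      rw [e]
      simp

/-- The subordination integral runs over positive times only, so the heat kernel may be replaced by
its extension by zero, which is jointly measurable also in time. -/
theorem measurable_regKernel (D : Domain d) {ε : ℝ} (hε : 0 < ε) :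
    Measurable fun q : (D.Carrier × D.Carrier) × (D.Carrier × D.Carrier) =>
      D.regKernel ε q.1 q.2 := by
  have hm : Measurable fun q : ((D.Carrier × D.Carrier) × (D.Carrier × D.Carrier)) × ℝ =>
      D.heatKernelPos q.2 q.1.1.1 q.1.2.1 * D.heatKernelPos q.2 q.1.1.2 q.1.2.2 :=
    (D.measurable_heatKernelPos.comp
      (f := fun q : ((D.Carrier × D.Carrier) × (D.Carrier × D.Carrier)) × ℝ =>
        (q.2, q.1.1.1, q.1.2.1)) (by fun_prop)).mul
      (D.measurable_heatKernelPos.comp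
      (f := fun q : ((D.Carrier × D.Carrier) × (D.Carrier × D.Carrier)) × ℝ =>
        (q.2, q.1.1.2, q.1.2.2)) (by fun_prop))
  have hsq : ∀ {s : ℝ}, 0 < s → ∀ z z' : D.Carrier × D.Carrier, D.heatKernelSq s z z'
      = D.heatKernelPos s z.1 z'.1 * D.heatKernelPos s z.2 z'.2 := fun hs z z' => by
    simp only [heatKernelSq, heatKernelPos, hs, if_true]
  unfold regKernel
  split_ifs
  · have e : ∀ q : (D.Carrier × D.Carrier) × (D.Carrier × D.Carrier),
        D.halfHeatKernelSq ε q.1 q.2 = ∫ s in Ioi 0, halfStableDensity ε s *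
          (D.heatKernelPos s q.1.1 q.2.1 * D.heatKernelPos s q.1.2 q.2.2) := fun q =>
      setIntegral_congr_fun measurableSet_Ioi fun s hs => by
        simp only [hsq hs]
    simp only [e]
    have hh : Measurable fun s : ℝ => halfStableDensity ε s := by
      unfold halfStableDensity
      fun_prop
    exact (((hh.comp measurable_snd).mul hm).stronglyMeasurable.integral_prod_right'
      (ν := volume.restrict (Ioi 0))).measurable
  · simp only [hsq hε]
    exact hm.comp (f := fun q => (q, ε)) (by fun_prop)

theorem measurable_regularise (D : Domain d) {ε : ℝ} (hε : 0 < ε) {W : D.Carrier → D.Carrier → ℝ}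
    (hW : Measurable fun z : D.Carrier × D.Carrier => W z.1 z.2) :
    Measurable fun z : D.Carrier × D.Carrier => D.regularise ε W z.1 z.2 :=
  (((D.measurable_regKernel hε).mul (hW.comp measurable_snd)).stronglyMeasurable.integral_prod_right'
    (ν := (volume : Measure (D.Carrier × D.Carrier)))).measurable

theorem regKernel_swap (D : Domain d) (ε : ℝ) (z z' : D.Carrier × D.Carrier) :
    D.regKernel ε z.swap z'.swap = D.regKernel ε z z' := by
  have h : ∀ s, D.heatKernelSq s z.swap z'.swap = D.heatKernelSq s z z' := fun s => mul_comm _ _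
  simp only [regKernel, halfHeatKernelSq, h]

theorem regularise_comm (D : Domain d) (ε : ℝ) {W : D.Carrier → D.Carrier → ℝ}
    (hW : ∀ x y, W x y = W y x) (x y : D.Carrier) :
    D.regularise ε W x y = D.regularise ε W y x := by
  unfold regularise
  refine (integral_prod_swap (μ := (volume : Measure D.Carrier))
    (ν := (volume : Measure D.Carrier))
    (fun z => D.regKernel ε (x, y) z * W z.1 z.2)).symm.trans ?_
  refine integral_congr_ae (ae_of_all _ fun z => ?_)
  change D.regKernel ε (y, x).swap z.swap * W z.2 z.1 = _
  rw [regKernel_swap, hW]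

end Domain

/-- The hypotheses with `p = 1` and `p = 2`, and the lower bound on `W - P_ε W`, have errors that
are positive powers of `ε`, so one small `ε` serves all three. The logarithmic diagonal bound then
becomes a constant, as `ε` is never sent to zero. -/
theorem exists_regularise_isRegularApprox {d : ℕ} {D : Domain d} {W : D.Carrier → D.Carrier → ℝ}
    (hW : IsRepulsive D W) (hW' : IsLogRegular D W) {μ : Measure D.Carrier}
    [IsProbabilityMeasure μ] (hμ : HasBoundedDensity μ) {δ : ℝ} (hδ : 0 < δ) :
    ∃ ε C₀ : ℝ, IsRegularApprox W (D.regularise ε W) μ δ C₀ := by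
  have hWm : Measurable fun z : D.Carrier × D.Carrier => W z.1 z.2 :=
    hW.lowerSemicontinuous.measurable
  obtain ⟨C₀, hC₀⟩ := hW'.log_bound
  obtain ⟨C₁, h₁⟩ := hW'.besov 1 le_rfl
  obtain ⟨κ₁, hκ₁, h₁⟩ := h₁ μ inferInstance hμ
  obtain ⟨C₂, h₂⟩ := hW'.besov 2 one_le_two
  obtain ⟨κ₂, hκ₂, h₂⟩ := h₂ μ inferInstance hμ
  obtain ⟨α, hα, ε₀, hε₀, K, hK⟩ := hW'.superharmonic
  have hsmall : ∀ c κ : ℝ, 0 < κ → ∀ᶠ ε in 𝓝[>] (0 : ℝ), c * ε ^ κ < δ := by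
    intro c κ hκ
    have h : Tendsto (fun ε : ℝ => c * ε ^ κ) (𝓝[>] 0) (𝓝 (c * 0 ^ κ)) :=
      ((Real.continuousAt_rpow_const 0 κ (Or.inr hκ.le)).tendsto.const_mul c).mono_left
        nhdsWithin_le_nhds
    rw [Real.zero_rpow hκ.ne', mul_zero] at h
    exact h.eventually (gt_mem_nhds hδ)
  have hI : ∀ a : ℝ, 0 < a → ∀ᶠ ε in 𝓝[>] (0 : ℝ), ε ∈ Ioo 0 a := fun a ha => Ioo_mem_nhdsGT ha
  obtain ⟨ε, e1, e2, e3, e4, e5⟩ := ((hsmall (C₁ (densityNorm μ)) κ₁ hκ₁).and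
    ((hsmall (C₂ (densityNorm μ)) κ₂ hκ₂).and ((hsmall K α hα).and
    ((hI 1 one_pos).and (hI ε₀ hε₀))))).exists
  refine ⟨ε, C₀ * (|Real.log ε| + 1), D.measurable_regularise e4.1 hWm,
    D.regularise_comm ε hW.symm, fun ρ σ hρ hσ => hW.hStable ε e4.1 ρ σ hρ hσ,
    fun x => hC₀ x ε e4, fun x => ?_, fun x => ?_, fun x y hxy => ?_⟩
  · have := h₁ ε e4.1 x
    simp only [Real.rpow_one] at this
    exact this.trans (ENNReal.ofReal_le_ofReal e1.le)
  · have := h₂ ε e4.1 x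
    simp only [Real.rpow_two, sq_abs] at this
    exact this.trans (ENNReal.ofReal_le_ofReal e2.le)
  · have := hK ε e5 x y hxy
    linarith

end MeanField

open MeanField
theorem theorem4p1 {d : ℕ} (hd : 1 ≤ d) (D : Domain d)
    (W : D.Carrier → D.Carrier → ℝ) (V : D.Carrier → ℝ) (hV : Measurable V)
    (hW : IsRepulsive D W) (hW' : IsLogRegular D W)
    (μ : Measure D.Carrier) (hμ : IsUniqueMinimiser V W μ) (hμb : HasBoundedDensity μ) :
    (∀ N : ℕ, 1 ≤ N →
      IsProbabilityMeasure (gibbsMeasure V W N) ∧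
      relPartition W μ N
        = ENNReal.ofReal (Real.exp (N * (energy V W μ).toReal)) * gibbsNormalisation V W N ∧
      gibbsMeasure V W N = (relPartition W μ N)⁻¹ •
        (Measure.pi fun _ : Fin N => μ).withDensity
          (fun x => ENNReal.ofReal (Real.exp (-fluctuationEnergy W μ x)))) ∧
    (∃ C : ℝ, ∀ N : ℕ, 1 ≤ N → relPartition W μ N ≤ ENNReal.ofReal C) ∧
    (∃ C : ℝ, ∀ N : ℕ, 1 ≤ N →
      avgEntropy (gibbsMeasure V W N) (Measure.pi fun _ => μ) ≤ ENNReal.ofReal (C / N) ∧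
      avgEntropy (Measure.pi fun _ => μ) (gibbsMeasure V W N) ≤ ENNReal.ofReal (C / N)) ∧
    (Talagrand μ → ∃ C : ℝ, ∀ N : ℕ, 1 ≤ N →
      wassersteinSqN (gibbsMeasure V W N) (Measure.pi fun _ => μ) / (N : ℝ≥0∞)
        ≤ ENNReal.ofReal (C / N)) := by
  have hp : IsProbabilityMeasure μ := hμ.1.1
  have hv := D.nullSingletonClass_volume hd
  -- As `d ≥ 1`, Lebesgue measure has no atoms, hence neither has `μ`, and the diagonal is null for
  -- `μ ⊗ μ`.
  have hn : NullSingletonClass μ := ⟨fun x => hμb.1 (measure_singleton x)⟩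
  obtain ⟨ε, C₀, hG⟩ := exists_regularise_isRegularApprox hW hW' hμb
    (show (0 : ℝ) < 1 / 4096 by norm_num)
  exact hμ.gibbs_estimates hV hW.lowerSemicontinuous.measurable hW.symm hW.locallyIntegrable hG
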